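/- **Model.** Items $1,\dots,n$ ($n\ge 1$) with independent nonnegative random sizes $X_1,\dots,X_n$ of arbitrary known distributions are packed in this order into bins. A (deterministic, measurable) policy chooses for each item $i$ one of $n$ available bins as a function of the observed sizes of the items $1,\dots,i-1$; the size of item $i$ is revealed after it has been packed. A bin of capacity $c$ is broken once the total size of its items exceeds $c$, and a broken bin may not be used again. For a penalty $C\ge 1$, the cost $\mathrm{cost}_c(\mathcal P)$ of a policy $\mathcal P$ is the expected number of bins it opens plus $C$ times the expected number of bins it breaks. Let $\mathrm{OPT}_1$ be the infimum of $\mathrm{cost}_1(\mathcal Q)$ over all policies $\mathcal Q$ for bins of capacity $1$. **Machine.** Algorithms run on a real random access machine: it adds, subtracts and compares natural numbers, adds, subtracts, multiplies, divides and compares real numbers, and has indirectly addressed memory for both, all at unit cost. The input is $n$, $C$, $\varepsilon$, and, through unit-cost queries, the values $\mathbb P(X_i\le y)$ and $\mathbb E[X_i\mathbf 1_{\{X_i\le y\}}]$ for any $i$ and $y$ that the algorithm has computed. **Theorem.** There is an absolute constant $K$ such that for every $0<\varepsilon\le\sqrt6(\sqrt{15}-3)$ there is an algorithm which, for every $n\ge1$,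 every $C\ge 1$ and all distributions of $X_1,\dots,X_n$, computes a policy $\mathcal P$ for bins of capacity $1+\varepsilon$ with $$\mathrm{cost}_{1+\varepsilon}(\mathcal P)\le(1+\varepsilon)\,\mathrm{OPT}_1 ,$$ in time at most $$K\,\frac{n^{2(6/\varepsilon)^5}}{\varepsilon^{10}} .$$ The policy is returned as the contents of the machine's memory, using at most this number of cells, together with a program, not depending on the instance, which without any further access to the distributions determines the bin of each item from the memory and the sizes revealed so far; the time bound covers the computation of the policy and its evaluation on all $n$ items, for every sequence of item sizes. -/

import Mathlib

open MeasureTheory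
open scoped NNReal ENNReal

namespace BinPacking

/-! ## Sequential adaptive policies and their cost

Item sizes are nonnegative reals. The items `0, …, n - 1` are packed in this order, and the available
bins are named by `Fin n`. -/

/-- A deterministic adaptive policy for `n` items, given as a decision tree: the bin of item `i` is a
function of the sizes of the items `k < i` (the bins of these items are determined by the same data,
so this is the whole history). -/
structure Policy (n : ℕ) where
  choose : (i : Fin n) → (Fin (i : ℕ) → ℝ≥0) → Fin n
  measurable_choose : ∀ i, Measurable (choose i)

namespace Policy

variable {n : ℕ}

/-- The bin into which item `i` is packed when the sizes turn out to be `x`. -/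
def bin (P : Policy n) (x : Fin n → ℝ≥0) (i : Fin n) : Fin n :=
  P.choose i (fun k => x (Fin.castLE i.isLt.le k))

/-- The total size of the items `k < m` that are packed into bin `j`. -/
def usage (P : Policy n) (x : Fin n → ℝ≥0) (m : ℕ) (j : Fin n) : ℝ≥0 :=
  ∑ k ∈ Finset.univ.filter (fun k : Fin n => (k : ℕ) < m ∧ P.bin x k = j), x k

/-- A policy is feasible for bins of capacity `c` if it never packs an item into a bin that has
already overflowed. -/
def Feasible (P : Policy n) (c : ℝ) : Prop :=
  ∀ (x : Fin n → ℝ≥0) (i : Fin n), (P.usage x i (P.bin x i) : ℝ) ≤ c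

/-- The bins that are opened. -/
def opened (P : Policy n) (x : Fin n → ℝ≥0) : Finset (Fin n) :=
  Finset.univ.image (P.bin x)

open Classical in
/-- The bins of capacity `c` that have overflowed at the end. -/
noncomputable def broken (P : Policy n) (c : ℝ) (x : Fin n → ℝ≥0) : Finset (Fin n) :=
  Finset.univ.filter (fun j => c < (P.usage x n j : ℝ))

/-- The expected cost for bins of capacity `c`, overflow penalty `C` and independent item sizes with
laws `μ i`: the expected number of opened bins plus `C` times the expected number of broken ones. -/
noncomputable def cost (P : Policy n) (μ : Fin n → Measure ℝ≥0) (C : ℝ≥0) (c : ℝ) : ℝ≥0∞ :=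
  (∫⁻ x, ((P.opened x).card : ℝ≥0∞) ∂(Measure.pi μ))
    + (C : ℝ≥0∞) * ∫⁻ x, ((P.broken c x).card : ℝ≥0∞) ∂(Measure.pi μ)

end Policy

/-- The optimal expected cost: the infimum over all feasible policies for bins of capacity `c`. -/
noncomputable def optCost {n : ℕ} (μ : Fin n → Measure ℝ≥0) (C : ℝ≥0) (c : ℝ) : ℝ≥0∞ :=
  ⨅ (Q : Policy n) (_ : Q.Feasible c), Q.cost μ C c

/-! ## A real random access machine

The memory has a natural number cell and a real cell for every address, with indirect addressing.
Natural numbers can be added, subtracted (truncated at `0`) and compared; reals can be added,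
subtracted, multiplied, divided and compared. There is no rounding of reals to integers, and the only
constants are natural numbers. Distributions are accessed through an oracle. Each occurrence of a
constant, memory access, operation, comparison, assignment or oracle call takes one time unit. -/

/-- The memory of the machine. -/
structure Mem where
  nat : ℕ → ℕ
  real : ℕ → ℝ

/-- Access to the distributions of the items. -/
structure Oracle where
  cdf : ℕ → ℝ → ℝ
  partialMean : ℕ → ℝ → ℝ

/-- Expressions with values in the natural numbers; `cell a` is the content of cell `a`. -/
inductive NatExp where
  | lit (k : ℕ)
  | cell (a : NatExp)
  | add (a b : NatExp)
  | sub (a b : NatExp)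

namespace NatExp

def eval (σ : Mem) : NatExp → ℕ
  | lit k => k
  | cell a => σ.nat (a.eval σ)
  | add a b => a.eval σ + b.eval σ
  | sub a b => a.eval σ - b.eval σ

/-- The time it takes to evaluate an expression. -/
def time : NatExp → ℕ
  | lit _ => 1
  | cell a => a.time + 1
  | add a b => a.time + b.time + 1
  | sub a b => a.time + b.time + 1

end NatExp

/-- Expressions with real values; `cell a` is the content of cell `a`. Division by `0` gives `0`. -/
inductive RealExp where
  | lit (k : ℕ)
  | cell (a : NatExp)
  | add (a b : RealExp)
  | sub (a b : RealExp)
  | mul (a b : RealExp)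
  | div (a b : RealExp)

namespace RealExp

noncomputable def eval (σ : Mem) : RealExp → ℝ
  | lit k => (k : ℝ)
  | cell a => σ.real (a.eval σ)
  | add a b => a.eval σ + b.eval σ
  | sub a b => a.eval σ - b.eval σ
  | mul a b => a.eval σ * b.eval σ
  | div a b => a.eval σ / b.eval σ

/-- The time it takes to evaluate an expression. -/
def time : RealExp → ℕ
  | lit _ => 1
  | cell a => a.time + 1
  | add a b => a.time + b.time + 1
  | sub a b => a.time + b.time + 1
  | mul a b => a.time + b.time + 1
  | div a b => a.time + b.time + 1

end RealExp

/-- Tests. -/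
inductive Test where
  | natLe (a b : NatExp)
  | realLe (a b : RealExp)

namespace Test

def Holds (σ : Mem) : Test → Prop
  | natLe a b => a.eval σ ≤ b.eval σ
  | realLe a b => a.eval σ ≤ b.eval σ

/-- The time it takes to carry out a test. -/
def time : Test → ℕ
  | natLe a b => a.time + b.time + 1
  | realLe a b => a.time + b.time + 1

end Test

/-- Programs. -/
inductive Program where
  | skip
  | setNat (a e : NatExp)
  | setReal (a : NatExp) (e : RealExp)
  | askCdf (a i : NatExp) (y : RealExp)
  | askPartialMean (a i : NatExp) (y : RealExp)
  | seq (p q : Program)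
  | cond (b : Test) (p q : Program)
  | loop (b : Test) (p : Program)

/-- `Exec O p σ t τ`: started with memory `σ`, and with access to the oracle `O`, the program `p`
stops after exactly `t` time units with memory `τ`. Here `setNat a e` and `setReal a e` store `e` in
cell `a`, the two oracle calls store the answer in the real cell `a`, and `loop b p` repeats `p` as
long as `b` holds. -/
inductive Exec (O : Oracle) : Program → Mem → ℕ → Mem → Prop
  | skip (σ : Mem) : Exec O .skip σ 1 σ
  | setNat (σ : Mem) (a e : NatExp) :
      Exec O (.setNat a e) σ (a.time + e.time + 1)
        { σ with nat := Function.update σ.nat (a.eval σ) (e.eval σ) }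
  | setReal (σ : Mem) (a : NatExp) (e : RealExp) :
      Exec O (.setReal a e) σ (a.time + e.time + 1)
        { σ with real := Function.update σ.real (a.eval σ) (e.eval σ) }
  | askCdf (σ : Mem) (a i : NatExp) (y : RealExp) :
      Exec O (.askCdf a i y) σ (a.time + i.time + y.time + 1)
        { σ with real := Function.update σ.real (a.eval σ) (O.cdf (i.eval σ) (y.eval σ)) }
  | askPartialMean (σ : Mem) (a i : NatExp) (y : RealExp) :
      Exec O (.askPartialMean a i y) σ (a.time + i.time + y.time + 1)
        { σ with real := Function.update σ.real (a.eval σ) (O.partialMean (i.eval σ) (y.eval σ)) }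
  | seq {p q : Program} {σ σ' τ : Mem} {s t : ℕ} :
      Exec O p σ s σ' → Exec O q σ' t τ → Exec O (.seq p q) σ (s + t) τ
  | cond_true {b : Test} {p q : Program} {σ τ : Mem} {t : ℕ} :
      b.Holds σ → Exec O p σ t τ → Exec O (.cond b p q) σ (b.time + t) τ
  | cond_false {b : Test} {p q : Program} {σ τ : Mem} {t : ℕ} :
      ¬ b.Holds σ → Exec O q σ t τ → Exec O (.cond b p q) σ (b.time + t) τ
  | loop_true {b : Test} {p : Program} {σ σ' τ : Mem} {s t : ℕ} :
      b.Holds σ → Exec O p σ s σ' → Exec O (.loop b p) σ' t τ →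
        Exec O (.loop b p) σ (b.time + s + t) τ
  | loop_false {b : Test} {p : Program} {σ : Mem} :
      ¬ b.Holds σ → Exec O (.loop b p) σ b.time σ

/-- The number of memory cells in use, that is, with nonzero content. -/
noncomputable def Mem.size (σ : Mem) : ℕ∞ :=
  {a | σ.nat a ≠ 0}.encard + {a | σ.real a ≠ 0}.encard

/-- The memory at the start: it holds the number `n` of items, the penalty `C` and `ε`. -/
noncomputable def Mem.initial (n : ℕ) (C : ℝ≥0) (ε : ℝ) : Mem where
  nat := Function.update 0 0 n
  real := Function.update (Function.update 0 0 (C : ℝ)) 1 ε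

/-- The memory after the size `x` of the item just packed has been revealed (in real cell `0`). -/
noncomputable def Mem.reveal (σ : Mem) (x : ℝ≥0) : Mem :=
  { σ with real := Function.update σ.real 0 (x : ℝ) }

/-- The oracle for items with laws `μ i`: the distribution function `y ↦ ℙ(X i ≤ y)` and the partial
mean `y ↦ 𝔼[X i; X i ≤ y]`. -/
noncomputable def Oracle.ofLaws {n : ℕ} (μ : Fin n → Measure ℝ≥0) : Oracle where
  cdf i y := if h : i < n then (μ ⟨i, h⟩).real {z | (z : ℝ) ≤ y} else 0
  partialMean i y := if h : i < n then ∫ z in {z : ℝ≥0 | (z : ℝ) ≤ y}, (z : ℝ) ∂(μ ⟨i, h⟩) else 0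

/-- The oracle that gives no information. -/
def Oracle.none : Oracle where
  cdf _ _ := 0
  partialMean _ _ := 0

/-- `Packs p σ l t`: started with memory `σ`, the program `p` (which has no access to the
distributions) is run once for each entry `(x, j)` of `l`. Each time it stops with `j` in natural
number cell `0`, which says that the current item is packed into bin `j`; then the size `x` of this
item is revealed. All these runs together take `t` time units. -/
inductive Packs (p : Program) : Mem → List (ℝ≥0 × ℕ) → ℕ → Prop
  | nil (σ : Mem) : Packs p σ [] 0
  | cons {σ τ : Mem} {s t : ℕ} {x : ℝ≥0} {l : List (ℝ≥0 × ℕ)} :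
      Exec Oracle.none p σ s τ → Packs p (τ.reveal x) l t →
        Packs p σ ((x, τ.nat 0) :: l) (s + t)

/-- An algorithm that computes policies: `prep` is run once, with access to the distributions, and
what it leaves in the memory describes a policy; `decide` evaluates the policy, item after item. -/
structure Algorithm where
  prep : Program
  decide : Program

/-- On the memory `σ₀` and the oracle `O`, the algorithm computes a description of size at most `T` of
the policy `P`. Whatever the item sizes are, computing the description and evaluating the policy on
all the items takes at most `T` time units altogether. -/
def Algorithm.Computes (A : Algorithm) (O : Oracle) (σ₀ : Mem) {n : ℕ} (P : Policy n) (T : ℕ) :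
    Prop :=
  ∃ (s : ℕ) (σ : Mem), Exec O A.prep σ₀ s σ ∧ σ.size ≤ (T : ℕ∞) ∧
    ∀ x : Fin n → ℝ≥0, ∃ t : ℕ,
      Packs A.decide σ (List.ofFn fun i => (x i, (P.bin x i : ℕ))) t ∧ s + t ≤ T

end BinPacking

/-! Write `N` for the resolution `res`, `q` for the tolerance `tol` and `M = N + q + 2` for `top`.
Sizes are measured in units of `1 / N` and rounded at random to a neighbouring integer, without
changing the mean. The probability of rounding `t` to `k` is a hat function of `t`, that is, a
second difference of `y ↦ max 0 (y - t)`. Hence the law of a rounded size is given exactly by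
finitely many values `y ℙ(X ≤ y) - 𝔼[X; X ≤ y]` (`integral_interp_ofLaws`).

With integer sizes a usable bin is described by a level in `1, …, M`, and only the number of bins on
each level matters. Backward induction over these multisets, encoded as numbers in base `2n + 1`,
gives the optimal expected cost `value` of a rounded problem in which a new bin costs `price = 1 + M
/ q²`. The theorem follows from two comparisons: the computed policy costs at most `value 0 0`
(`cost_policy_le`), and `value 0 0` is at most `loss` times the optimum (`value_le_optCost`), where
`loss = price * (1 + N / q²)`.

Both comparisons rest on one estimate: rounding `t` adds to an accumulated deviation `d` an error of
mean zero and variance at most `t` (`interp_sq`). So `d²` plus the remaining capacity does not grow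
in expectation. Divided by `q²` it is a potential that is at least `1` as soon as `d` exceeds `q`,
and so pays for replacing a bin whose deviation has become too large.

For the lower bound, a policy `Q` for capacity `1` is imitated by virtual bins. Every bin of `Q` has
a current virtual substitute; when the deviation of the substitute exceeds `q`, it is parked and a
new one is opened. A bin of `Q` thus costs `price` and an initial potential `price * N / q²`,
together `loss`. As long as the bin of `Q` is unbroken, the level of its substitute stays at most
`M`.

For the upper bound the roles are exchanged: real bins follow the virtual ones, and a real bin whose
usage is too far ahead of its level is retired. The rounding is derandomized by the method of
conditional expectations, always taking the neighbour with the smaller sum of future cost and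
potential (`Tracks.cost_le`). Level and deviation bound the real usage, so capacity `(M + q) / N` is
enough.

With `k = ⌈1 / ε⌉`, `N = 27 k³` and `q = 9 k²`, the loss and the capacity are at most `1 + ε`. The
tables have `n` rows of length `(2n + 1) ^ M`, where `M` is of order `ε⁻³`, so for `n ≥ 2` the time
is far below the bound. The case `n = 1`, where the bound is only polynomial in `1 / ε`, is treated
without tables. -/

namespace BinPacking

/-! ## Randomized rounding to integers -/

/-- The expectation of `g` at the randomized rounding of `t` to an adjacent natural number. -/
noncomputable def interp (g : ℕ → ℝ) (t : ℝ) : ℝ :=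
  (1 - (t - ⌊t⌋₊)) * g ⌊t⌋₊ + (t - ⌊t⌋₊) * g (⌊t⌋₊ + 1)

/-- The hat function with peak at `k`. -/
noncomputable def hat (k : ℕ) (t : ℝ) : ℝ :=
  max 0 (k + 1 - t) - 2 * max 0 (k - t) + max 0 (k - 1 - t)

/-- Only the hats at the two neighbours of `t` are nonzero, and their values are the two weights in
`interp`. So `hat k t` is the probability that `t` is rounded to `k`. -/
lemma hat_floor {t : ℝ} (ht : 0 ≤ t) : hat ⌊t⌋₊ t = 1 - (t - ⌊t⌋₊) := by
  have h1 := Nat.floor_le ht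
  have h2 := Nat.lt_floor_add_one t
  rw [hat, max_eq_right (by linarith), max_eq_left (by linarith), max_eq_left (by linarith)]
  ring

lemma hat_floor_add_one {t : ℝ} (ht : 0 ≤ t) : hat (⌊t⌋₊ + 1) t = t - ⌊t⌋₊ := by
  have h1 := Nat.floor_le ht
  have h2 := Nat.lt_floor_add_one t
  rw [hat]
  push_cast
  rw [max_eq_right (by linarith), max_eq_right (by linarith), max_eq_left (by linarith)]
  ring

lemma hat_eq_zero {t : ℝ} (ht : 0 ≤ t) {k : ℕ} (h : k ≠ ⌊t⌋₊) (h' : k ≠ ⌊t⌋₊ + 1) :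
    hat k t = 0 := by
  have h1 := Nat.floor_le ht
  have h2 := Nat.lt_floor_add_one t
  rw [hat]
  rcases lt_or_gt_of_ne h with hk | hk
  · have : (k : ℝ) + 1 ≤ ⌊t⌋₊ := by exact_mod_cast hk
    rw [max_eq_left (by linarith), max_eq_left (by linarith), max_eq_left (by linarith)]
    ring
  · have : (⌊t⌋₊ : ℝ) + 2 ≤ k := by
      have : ⌊t⌋₊ + 2 ≤ k := by omega
      exact_mod_cast this
    rw [max_eq_right (by linarith), max_eq_right (by linarith), max_eq_right (by linarith)]
    ring

/-- Splitting off the eventual constant `G` leaves finitely many terms, so expectations need only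
the probabilities of the rounded sizes `k < m`. -/
lemma interp_eq_sum {g : ℕ → ℝ} {G : ℝ} {m : ℕ} (hg : ∀ k, m ≤ k → g k = G) {t : ℝ}
    (ht : 0 ≤ t) : interp g t = G + ∑ k ∈ Finset.range m, (g k - G) * hat k t := by
  have key : ∑ k ∈ Finset.range m, (g k - G) * hat k t =
      (g ⌊t⌋₊ - G) * hat ⌊t⌋₊ t + (g (⌊t⌋₊ + 1) - G) * hat (⌊t⌋₊ + 1) t := by
    -- The range is enlarged until it surely contains both neighbours of `t`; the added terms vanish
    -- because `g k = G` there.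
    have h2 : ∑ k ∈ Finset.range m, (g k - G) * hat k t =
        ∑ k ∈ Finset.range (m + ⌊t⌋₊ + 2), (g k - G) * hat k t := by
      apply Finset.sum_subset
      · intro k hk
        simp only [Finset.mem_range] at hk ⊢
        omega
      · intro k _ hk
        rw [hg k (by simpa using hk)]
        simp
    rw [h2, Finset.sum_eq_add (⌊t⌋₊) (⌊t⌋₊ + 1) (by omega)]
    · intro c _ hc
      rw [hat_eq_zero ht hc.1 hc.2, mul_zero]
    · intro h
      simp only [Finset.mem_range, not_lt] at h
      omega
    · intro h
      simp only [Finset.mem_range, not_lt] at h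
      omega
  rw [key, hat_floor ht, hat_floor_add_one ht, interp]
  ring

lemma interp_mono {g g' : ℕ → ℝ} (h : ∀ k, g k ≤ g' k) {t : ℝ} (ht : 0 ≤ t) :
    interp g t ≤ interp g' t := by
  have h1 := Nat.floor_le ht
  have h2 := Nat.lt_floor_add_one t
  rw [interp, interp]
  have := h ⌊t⌋₊
  have := h (⌊t⌋₊ + 1)
  gcongr
  linarith

lemma interp_nonneg {g : ℕ → ℝ} (h : ∀ k, 0 ≤ g k) {t : ℝ} (ht : 0 ≤ t) : 0 ≤ interp g t := by
  have := interp_mono (g := fun _ => 0) h ht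
  simpa [interp] using this

/-- The excess of `y` over the item size, in expectation, from oracle answers. -/
def Oracle.excess (O : Oracle) (i : ℕ) (y : ℝ) : ℝ := y * O.cdf i y - O.partialMean i y

/-- The probability that the size of item `i`, in units of `1 / N`, is rounded to `k`. -/
noncomputable def Oracle.prob (O : Oracle) (N i k : ℕ) : ℝ :=
  N * (O.excess i ((k + 1) / N) - 2 * O.excess i (k / N) + O.excess i ((k - 1) / N))

section
variable (ν : Measure ℝ≥0) [IsProbabilityMeasure ν]

lemma integrable_max (y : ℝ) : Integrable (fun z : ℝ≥0 => max 0 (y - z)) ν := by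
  refine Integrable.of_bound (C := |y|) (by fun_prop) (Filter.Eventually.of_forall fun z => ?_)
  rw [Real.norm_eq_abs, abs_of_nonneg (le_max_left _ _)]
  have : (0 : ℝ) ≤ z := z.2
  exact max_le (abs_nonneg _) (by linarith [le_abs_self y])

/-- This is where the two kinds of oracle answers come together. -/
lemma integral_max (y : ℝ) :
    ∫ z : ℝ≥0, max 0 (y - z) ∂ν
      = y * ν.real {z | (z : ℝ) ≤ y} - ∫ z in {z : ℝ≥0 | (z : ℝ) ≤ y}, (z : ℝ) ∂ν := by
  have hm : MeasurableSet {z : ℝ≥0 | (z : ℝ) ≤ y} :=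
    measurableSet_le (by fun_prop) measurable_const
  have h1 : (fun z : ℝ≥0 => max 0 (y - (z : ℝ))) =
      Set.indicator {z : ℝ≥0 | (z : ℝ) ≤ y} (fun z => y - (z : ℝ)) := by
    ext z
    by_cases h : (z : ℝ) ≤ y
    · rw [Set.indicator_of_mem (by exact h), max_eq_right (by linarith)]
    · rw [Set.indicator_of_notMem (by exact h), max_eq_left (by linarith)]
  have hz : IntegrableOn (fun z : ℝ≥0 => (z : ℝ)) {z : ℝ≥0 | (z : ℝ) ≤ y} ν := by
    refine Measure.integrableOn_of_bounded (M := |y|) (measure_ne_top _ _) (by fun_prop) ?_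
    refine (ae_restrict_iff' hm).2 (Filter.Eventually.of_forall fun z hz => ?_)
    have h0 : (0 : ℝ) ≤ z := z.2
    have h1 : (z : ℝ) ≤ y := hz
    rw [Real.norm_eq_abs, abs_of_nonneg h0]
    linarith [le_abs_self y]
  rw [h1, integral_indicator hm, integral_sub (integrable_const _).integrableOn hz]
  simp [mul_comm]

/-- After scaling by `N`, a hat is a second difference with step `1 / N` of `y ↦ max 0 (y - z)`. The
function `A` stands for `Oracle.excess`. -/
lemma integral_hat {N : ℕ} (hN : 0 < N) (k : ℕ) (A : ℝ → ℝ)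
    (hA : ∀ y, A y = ∫ z : ℝ≥0, max 0 (y - z) ∂ν) :
    Integrable (fun z : ℝ≥0 => hat k (N * z)) ν ∧
    ∫ z : ℝ≥0, hat k (N * z) ∂ν = N * (A ((k + 1) / N) - 2 * A (k / N) + A ((k - 1) / N)) := by
  have hN' : (0 : ℝ) < N := by exact_mod_cast hN
  have h : (fun z : ℝ≥0 => hat k (N * z)) = fun z : ℝ≥0 => N * (max 0 ((k + 1) / N - (z : ℝ))
      - 2 * max 0 (k / N - (z : ℝ)) + max 0 ((k - 1) / N - (z : ℝ))) := by
    have aux : ∀ u z : ℝ, max 0 (u - N * z) = N * max 0 (u / N - z) := by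
      intro u z
      rw [mul_max_of_nonneg _ _ hN'.le, mul_zero, mul_sub, mul_div_cancel₀ _ hN'.ne']
    ext z
    rw [hat, aux, aux, aux]
    ring
  rw [h]
  have i1 := integrable_max ν ((k + 1) / N)
  have i2 := integrable_max ν (k / N)
  have i3 := integrable_max ν ((k - 1) / N)
  have i4 := (i1.sub (i2.const_mul 2)).add i3
  refine ⟨i4.const_mul _, ?_⟩
  have e := integral_add (i1.sub (i2.const_mul 2)) i3
  simp only [Pi.sub_apply] at e
  rw [integral_const_mul, e, integral_sub i1 (i2.const_mul 2), integral_const_mul, hA, hA, hA]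

lemma integral_interp {N : ℕ} (hN : 0 < N) {g : ℕ → ℝ} {G : ℝ} {m : ℕ}
    (hg : ∀ k, m ≤ k → g k = G) (A : ℝ → ℝ)
    (hA : ∀ y, A y = ∫ z : ℝ≥0, max 0 (y - z) ∂ν) :
    Integrable (fun z : ℝ≥0 => interp g (N * z)) ν ∧
    ∫ z : ℝ≥0, interp g (N * z) ∂ν = G + ∑ k ∈ Finset.range m,
      (g k - G) * (N * (A ((k + 1) / N) - 2 * A (k / N) + A ((k - 1) / N))) := by
  have h : (fun z : ℝ≥0 => interp g (N * z)) =
      fun z : ℝ≥0 => G + ∑ k ∈ Finset.range m, (g k - G) * hat k (N * z) := by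
    ext z
    exact interp_eq_sum hg (by positivity)
  have hi : ∀ k ∈ Finset.range m, Integrable (fun z : ℝ≥0 => (g k - G) * hat k (N * z)) ν :=
    fun k _ => (integral_hat ν hN k A hA).1.const_mul _
  rw [h]
  refine ⟨(integrable_const _).add (integrable_finsetSum _ hi), ?_⟩
  rw [integral_add (integrable_const _) (integrable_finsetSum _ hi), integral_finsetSum _ hi]
  simp only [integral_const_mul, (integral_hat ν hN _ A hA).2]
  simp

end

lemma integral_interp_ofLaws {n : ℕ} (μ : Fin n → Measure ℝ≥0) [∀ i, IsProbabilityMeasure (μ i)]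
    {N : ℕ} (hN : 0 < N) (i : Fin n) {g : ℕ → ℝ} {G : ℝ} {m : ℕ} (hg : ∀ k, m ≤ k → g k = G) :
    Integrable (fun z : ℝ≥0 => interp g (N * z)) (μ i) ∧
    ∫ z : ℝ≥0, interp g (N * z) ∂(μ i) =
      G + ∑ k ∈ Finset.range m, (g k - G) * (Oracle.ofLaws μ).prob N i k := by
  apply integral_interp (μ i) hN hg
  intro y
  rw [integral_max]
  simp [Oracle.excess, Oracle.ofLaws]

end BinPacking

namespace BinPacking

/-! ## The dynamic program -/

/-- The weight of a bin of level `ℓ` in the encoding of a multiset of levels as a number. -/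
def weight (B M ℓ : ℕ) : ℕ := if 1 ≤ ℓ ∧ ℓ ≤ M then B ^ (ℓ - 1) else 0

lemma weight_le {B M : ℕ} (hB : 0 < B) (ℓ : ℕ) : weight B M ℓ ≤ B ^ (M - 1) := by
  rw [weight]
  split_ifs with h
  · exact Nat.pow_le_pow_right hB (by omega)
  · exact Nat.zero_le _

lemma weight_of_lt {B M ℓ : ℕ} (h : M < ℓ) : weight B M ℓ = 0 := if_neg (by omega)

/-- Levels above `L` contribute multiples of `B ^ L`. The others are fewer than `B` summands of size
at most `B ^ (L - 1)`, so there is no carry. -/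
lemma sum_weight_mod {ι : Type*} [Fintype ι] {B M L : ℕ} (hL : 1 ≤ L)
    (hB : Fintype.card ι < B) (lev : ι → ℕ) :
    (∑ j, weight B M (lev j)) % B ^ L =
      ∑ j ∈ Finset.univ.filter (fun j => lev j ≤ L), weight B M (lev j) := by
  rw [← Finset.sum_filter_add_sum_filter_not Finset.univ (fun j => lev j ≤ L)]
  have h1 : B ^ L ∣ ∑ j ∈ Finset.univ.filter (fun j => ¬ lev j ≤ L), weight B M (lev j) := by
    apply Finset.dvd_sum
    intro j hj
    rw [Finset.mem_filter] at hj
    rw [weight]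
    split_ifs with h
    · exact pow_dvd_pow _ (by omega)
    · exact dvd_zero _
  obtain ⟨c, hc⟩ := h1
  rw [hc, Nat.add_mul_mod_self_left, Nat.mod_eq_of_lt]
  calc ∑ j ∈ Finset.univ.filter (fun j => lev j ≤ L), weight B M (lev j)
      ≤ ∑ j ∈ Finset.univ.filter (fun j => lev j ≤ L), B ^ (L - 1) := by
        apply Finset.sum_le_sum
        intro j hj
        rw [Finset.mem_filter] at hj
        rw [weight]
        split_ifs with h
        · exact Nat.pow_le_pow_right (by omega) (by omega)
        · exact Nat.zero_le _
    _ ≤ Fintype.card ι * B ^ (L - 1) := by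
        rw [Finset.sum_const, smul_eq_mul]
        exact Nat.mul_le_mul_right _ (Finset.card_le_univ _)
    _ < B * B ^ (L - 1) := Nat.mul_lt_mul_of_pos_right hB (Nat.pow_pos (by omega))
    _ = B ^ L := by rw [← pow_succ', Nat.sub_add_cancel hL]

/-- A digit of the encoding is tested for being nonzero: without a bin of level `L` the remainder
comes from lower levels alone and stays below `B ^ (L - 1)`. -/
lemma weight_le_mod_iff {ι : Type*} [Fintype ι] {B M L : ℕ} (hL : 1 ≤ L) (hLM : L ≤ M)
    (hB : Fintype.card ι < B) (lev : ι → ℕ) :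
    weight B M L ≤ (∑ j, weight B M (lev j)) % B ^ L ↔ ∃ j, lev j = L := by
  rw [sum_weight_mod hL hB]
  constructor
  · intro h
    by_contra! hne
    have h2 : (∑ j ∈ Finset.univ.filter (fun j => lev j ≤ L), weight B M (lev j)) <
        weight B M L := by
      have hw : weight B M L = B ^ (L - 1) := if_pos ⟨hL, hLM⟩
      rcases Nat.lt_or_ge 1 L with h1 | h1
      · calc _ = ∑ j ∈ Finset.univ.filter (fun j => lev j ≤ L - 1), weight B M (lev j) := by
              congr 1
              ext j
              have := hne j
              simp only [Finset.mem_filter, Finset.mem_univ, true_and]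
              omega
          _ = (∑ j, weight B M (lev j)) % B ^ (L - 1) :=
              (sum_weight_mod (by omega) hB lev).symm
          _ < B ^ (L - 1) := Nat.mod_lt _ (Nat.pow_pos (by omega))
          _ = weight B M L := hw.symm
      · rw [Finset.sum_eq_zero]
        · rw [hw]
          exact Nat.pow_pos (by omega)
        · intro j hj
          have := hne j
          rw [Finset.mem_filter] at hj
          rw [weight, if_neg]
          omega
    omega
  · rintro ⟨j, rfl⟩
    exact Finset.single_le_sum (f := fun j => weight B M (lev j)) (fun _ _ => Nat.zero_le _)
      (by simp)

/-- The expected cost, as estimated by `f`, of packing an item, whose rounded size is `k` with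
probability `π k`, into a bin of level `L`, where the other bins are encoded by `s`. -/
noncomputable def packVal (W : ℕ → ℕ) (M : ℕ) (C : ℝ) (f π : ℕ → ℝ) (L s : ℕ) : ℝ :=
  (C + f s) + ∑ k ∈ Finset.range (M + 1 - L), (f (s + W (L + k)) - (C + f s)) * π k

/-- The data of the dynamic program: the number of items, the resolution and the tolerance, the
penalty and the oracle. -/
structure Instance where
  items : ℕ
  res : ℕ
  tol : ℕ
  penalty : ℝ
  oracle : Oracle

namespace Instance
variable (D : Instance)

/-- The largest level of a usable bin. -/
def top : ℕ := D.res + D.tol + 2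

/-- The base of the encoding. -/
def base : ℕ := 2 * D.items + 1

/-- The price of opening a bin. -/
noncomputable def price : ℝ := 1 + D.top / (D.tol : ℝ) ^ 2

/-- The weights of the levels. -/
def wt : ℕ → ℕ := weight D.base D.top

/-- The expected cost of packing item `i` into a bin of level `L`. -/
noncomputable def pack (f : ℕ → ℝ) (i L s : ℕ) : ℝ :=
  packVal D.wt D.top D.penalty f (D.oracle.prob D.res i) L s

open Classical in
/-- The best action and its value for item `i` if only the `c` highest levels and a new bin
(action `0`) are taken into account. -/
noncomputable def scan (f : ℕ → ℝ) (i s : ℕ) : ℕ → ℕ × ℝ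
  | 0 => (0, D.price + D.pack f i 1 s)
  | c + 1 =>
    if D.wt (D.top - c) ≤ s % D.base ^ (D.top - c) ∧
        D.pack f i (D.top - c) (s - D.wt (D.top - c)) ≤ (scan f i s c).2
    then (D.top - c, D.pack f i (D.top - c) (s - D.wt (D.top - c)))
    else scan f i s c

/-- The optimal expected cost of the last `r` items. -/
noncomputable def valueRem : ℕ → ℕ → ℝ
  | 0 => fun _ => 0
  | r + 1 => fun s => (D.scan (valueRem r) (D.items - (r + 1)) s D.top).2

/-- The optimal expected cost of the items from `i` on. -/
noncomputable def value (i : ℕ) : ℕ → ℝ := D.valueRem (D.items - i)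

/-- The optimal action for item `i`. -/
noncomputable def act (i s : ℕ) : ℕ := (D.scan (D.value (i + 1)) i s D.top).1

lemma value_last : D.value D.items = fun _ => 0 := by simp [value, valueRem]

lemma value_eq {i : ℕ} (hi : i < D.items) (s : ℕ) :
    D.value i s = (D.scan (D.value (i + 1)) i s D.top).2 := by
  have h : D.items - i = (D.items - (i + 1)) + 1 := by omega
  have h2 : D.items - (D.items - (i + 1) + 1) = i := by omega
  rw [value, h, valueRem, h2, value]

lemma scan_le_new (f : ℕ → ℝ) (i s c : ℕ) :
    (D.scan f i s c).2 ≤ D.price + D.pack f i 1 s := by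
  induction c with
  | zero => rfl
  | succ c ih =>
    rw [scan]
    split_ifs with h
    · exact h.2.trans ih
    · exact ih

/-- The hypothesis `D.top < L + c` places `L` among the `c` highest levels. -/
lemma scan_le_pack (f : ℕ → ℝ) (i s c L : ℕ) (hL : L ≤ D.top) (hLc : D.top < L + c)
    (h : D.wt L ≤ s % D.base ^ L) :
    (D.scan f i s c).2 ≤ D.pack f i L (s - D.wt L) := by
  induction c with
  | zero => omega
  | succ c ih =>
    rw [scan]
    by_cases hc : D.top < L + c
    · split_ifs with h'
      · exact h'.2.trans (ih hc)
      · exact ih hc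
    · have : D.top - c = L := by omega
      rw [this]
      split_ifs with h'
      · exact le_rfl
      · rw [not_and] at h'
        exact (not_le.1 (h' h)).le

lemma scan_spec (f : ℕ → ℝ) (i s c : ℕ) (hc : c ≤ D.top) :
    D.scan f i s c = (0, D.price + D.pack f i 1 s) ∨
    ∃ L, 1 ≤ L ∧ L ≤ D.top ∧ D.wt L ≤ s % D.base ^ L ∧
      D.scan f i s c = (L, D.pack f i L (s - D.wt L)) := by
  induction c with
  | zero => exact .inl rfl
  | succ c ih =>
    rw [scan]
    split_ifs with h
    · exact .inr ⟨D.top - c, by omega, by omega, h.1, rfl⟩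
    · exact ih (by omega)

lemma value_le_new {i : ℕ} (hi : i < D.items) (s : ℕ) :
    D.value i s ≤ D.price + D.pack (D.value (i + 1)) i 1 s :=
  (D.value_eq hi s).trans_le (D.scan_le_new _ _ _ _)

/-- The index type of the bins is left open: the lower bound needs two virtual bins per item, a
current and a parked one. This is the reason for the base `2n + 1`. -/
lemma value_le_pack {i : ℕ} (hi : i < D.items) {ι : Type*} [Fintype ι]
    (hB : Fintype.card ι < D.base) (lev : ι → ℕ) {j : ι} {s : ℕ}
    (hs : s = ∑ j, D.wt (lev j)) (h1 : 1 ≤ lev j) (h2 : lev j ≤ D.top) :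
    D.value i s ≤ D.pack (D.value (i + 1)) i (lev j) (s - D.wt (lev j)) := by
  rw [D.value_eq hi]
  refine D.scan_le_pack _ _ _ _ _ h2 (by omega) ?_
  rw [hs]
  exact (weight_le_mod_iff h1 h2 hB lev).2 ⟨j, rfl⟩

lemma act_spec {i : ℕ} (hi : i < D.items) {ι : Type*} [Fintype ι]
    (hB : Fintype.card ι < D.base) (lev : ι → ℕ) {s : ℕ} (hs : s = ∑ j, D.wt (lev j)) :
    (D.act i s = 0 ∧ D.value i s = D.price + D.pack (D.value (i + 1)) i 1 s) ∨
    (1 ≤ D.act i s ∧ D.act i s ≤ D.top ∧ (∃ j, lev j = D.act i s) ∧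
      D.value i s = D.pack (D.value (i + 1)) i (D.act i s) (s - D.wt (D.act i s))) := by
  rw [D.value_eq hi, act]
  rcases D.scan_spec (D.value (i + 1)) i s D.top le_rfl with h | ⟨L, h1, h2, h3, h4⟩
  · left
    rw [h]
    exact ⟨rfl, rfl⟩
  · right
    rw [h4]
    refine ⟨h1, h2, ?_, rfl⟩
    rw [hs] at h3
    exact (weight_le_mod_iff h1 h2 hB lev).1 h3

/-- The cost after an item has been packed into a bin of level `L` and its size has been rounded to
`k`. -/
noncomputable def after (f : ℕ → ℝ) (L s k : ℕ) : ℝ :=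
  if L + k ≤ D.top then f (s + D.wt (L + k)) else D.penalty + f s

/-- All rounded sizes that lead beyond the top level cost the same, so `after` is constant from `top
+ 1 - L` on and the finite sum in `packVal` is a true expectation. -/
lemma integral_after {n : ℕ} (μ : Fin n → Measure ℝ≥0) [∀ i, IsProbabilityMeasure (μ i)]
    (hO : D.oracle = Oracle.ofLaws μ) (hN : 0 < D.res) (i : Fin n) (f : ℕ → ℝ) (L s : ℕ) :
    Integrable (fun z : ℝ≥0 => interp (D.after f L s) (D.res * z)) (μ i) ∧
    ∫ z : ℝ≥0, interp (D.after f L s) (D.res * z) ∂(μ i) = D.pack f i L s := by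
  obtain ⟨h1, h2⟩ := integral_interp_ofLaws μ hN i (g := D.after f L s) (G := D.penalty + f s)
    (m := D.top + 1 - L) (fun k hk => if_neg (by omega))
  refine ⟨h1, h2.trans ?_⟩
  rw [pack, packVal, hO]
  congr 1
  refine Finset.sum_congr rfl fun k hk => ?_
  rw [Finset.mem_range] at hk
  rw [after, if_pos (by omega)]

lemma after_nonneg {f : ℕ → ℝ} (hf : ∀ s, 0 ≤ f s) (hC : 0 ≤ D.penalty) (L s k : ℕ) :
    0 ≤ D.after f L s k := by
  rw [after]
  split_ifs
  · exact hf _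
  · exact add_nonneg hC (hf _)

lemma price_nonneg : 0 ≤ D.price := by
  rw [price]
  positivity

/-- The sign of `pack` is visible only after it has been written as an integral over an actual law.
It is needed for passing between Bochner and Lebesgue integrals. -/
lemma value_nonneg (μ : Fin D.items → Measure ℝ≥0) [∀ i, IsProbabilityMeasure (μ i)]
    (hO : D.oracle = Oracle.ofLaws μ) (hN : 0 < D.res) (hC : 0 ≤ D.penalty) (i s : ℕ) :
    0 ≤ D.value i s := by
  rw [value]
  have hr : D.items - i ≤ D.items := by omega
  generalize D.items - i = r at hr
  induction r generalizing s with
  | zero => exact le_rfl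
  | succ r ih =>
    have hp : ∀ L s, 0 ≤ D.pack (D.valueRem r) (D.items - (r + 1)) L s := by
      intro L s
      have := (D.integral_after μ hO hN ⟨D.items - (r + 1), by omega⟩ (D.valueRem r) L s).2
      rw [← this]
      exact integral_nonneg fun z => interp_nonneg
        (D.after_nonneg (fun s => ih s (by omega)) hC L s) (by positivity)
    change 0 ≤ (D.scan (D.valueRem r) (D.items - (r + 1)) s D.top).2
    rcases D.scan_spec (D.valueRem r) (D.items - (r + 1)) s D.top le_rfl with h | ⟨L, _, _, _, h⟩
    · rw [h]
      exact add_nonneg D.price_nonneg (hp _ _)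
    · rw [h]
      exact hp _ _

end Instance
end BinPacking

namespace BinPacking
namespace Policy
variable {n : ℕ} (P : Policy n)

/-! ## The cost of a policy, item after item -/

/-- The bins that are opened by the items `k < m`. -/
def openedBy (x : Fin n → ℝ≥0) (m : ℕ) : Finset (Fin n) :=
  (Finset.univ.filter fun k : Fin n => (k : ℕ) < m).image (P.bin x)

open Classical in
/-- The bins that are broken by the items `k < m`. -/
noncomputable def brokenBy (c : ℝ) (x : Fin n → ℝ≥0) (m : ℕ) : Finset (Fin n) :=
  Finset.univ.filter fun j => c < (P.usage x m j : ℝ)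

lemma mem_brokenBy {c : ℝ} {x : Fin n → ℝ≥0} {m : ℕ} {j : Fin n} :
    j ∈ P.brokenBy c x m ↔ c < (P.usage x m j : ℝ) := by simp [brokenBy]

/-- The cost in the scenario `x`. -/
noncomputable def totalCost (C : ℝ≥0) (c : ℝ) (x : Fin n → ℝ≥0) : ℝ≥0∞ :=
  (P.opened x).card + C * (P.broken c x).card

lemma openedBy_last (x : Fin n → ℝ≥0) : P.openedBy x n = P.opened x := by
  simp [openedBy, opened]

lemma brokenBy_last (c : ℝ) (x : Fin n → ℝ≥0) : P.brokenBy c x n = P.broken c x := rfl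

lemma measurable_bin (i : Fin n) : Measurable fun x => P.bin x i :=
  (P.measurable_choose i).comp (measurable_pi_lambda _ fun _ => measurable_pi_apply _)

lemma measurable_usage (m : ℕ) (j : Fin n) : Measurable fun x => P.usage x m j := by
  have h : (fun x => P.usage x m j) =
      fun x => ∑ k : Fin n, if (k : ℕ) < m ∧ P.bin x k = j then x k else 0 := by
    ext x
    rw [usage, Finset.sum_filter]
  rw [h]
  refine Finset.measurable_sum _ fun k _ => Measurable.ite ?_ (measurable_pi_apply k)
    measurable_const
  by_cases hk : (k : ℕ) < m
  · simp only [hk, true_and]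
    exact P.measurable_bin k (measurableSet_singleton j)
  · simp [hk]

lemma measurable_opened_card : Measurable fun x => ((P.opened x).card : ℝ≥0∞) := by
  have h : Measurable fun x : Fin n → ℝ≥0 => P.bin x := measurable_pi_lambda _ P.measurable_bin
  exact (measurable_of_countable
    fun f : Fin n → Fin n => ((Finset.univ.image f).card : ℝ≥0∞)).comp h

lemma measurable_broken_card (c : ℝ) : Measurable fun x => ((P.broken c x).card : ℝ≥0∞) := by
  have h : (fun x => ((P.broken c x).card : ℝ≥0∞)) =
      fun x => ∑ j : Fin n, Set.indicator {x | c < (P.usage x n j : ℝ)} (fun _ => 1) x := by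
    classical
    ext x
    rw [broken, Finset.card_filter]
    push_cast
    exact Finset.sum_congr rfl fun j _ => by simp [Set.indicator_apply]
  rw [h]
  refine Finset.measurable_sum _ fun j _ => measurable_const.indicator ?_
  exact measurableSet_lt measurable_const (P.measurable_usage n j).coe_nnreal_real

lemma measurable_totalCost (C : ℝ≥0) (c : ℝ) : Measurable (P.totalCost C c) :=
  P.measurable_opened_card.add ((P.measurable_broken_card c).const_mul _)

/-- The expected cost given the sizes of the items `k < m`. -/
noncomputable def condCost (μ : Fin n → Measure ℝ≥0) (C : ℝ≥0) (c : ℝ) (m : ℕ) :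
    (Fin n → ℝ≥0) → ℝ≥0∞ :=
  lmarginal μ (Finset.univ.filter fun k : Fin n => m ≤ k) (P.totalCost C c)

lemma condCost_last (μ : Fin n → Measure ℝ≥0) (C : ℝ≥0) (c : ℝ)
    (x : Fin n → ℝ≥0) :
    P.condCost μ C c n x = (P.openedBy x n).card + C * (P.brokenBy c x n).card := by
  have h : (Finset.univ.filter fun k : Fin n => n ≤ k) = ∅ := by
    ext k
    simp [k.2]
  rw [condCost, h, lmarginal_empty, totalCost, openedBy_last, brokenBy_last]

section
variable (μ : Fin n → Measure ℝ≥0) [∀ i, IsProbabilityMeasure (μ i)] (C : ℝ≥0) (c : ℝ)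

lemma condCost_zero (x : Fin n → ℝ≥0) : P.condCost μ C c 0 x = P.cost μ C c := by
  have h : (Finset.univ.filter fun k : Fin n => 0 ≤ (k : ℕ)) = Finset.univ := by simp
  rw [condCost, h, lmarginal_univ, cost, ← lintegral_const_mul _ (P.measurable_broken_card c),
    ← lintegral_add_left P.measurable_opened_card]
  rfl

/-- The tower property. With it, both comparisons become backward inductions over the items. -/
lemma condCost_step (i : Fin n) (x : Fin n → ℝ≥0) :
    P.condCost μ C c i x = ∫⁻ y, P.condCost μ C c (i + 1) (Function.update x i y) ∂(μ i) := by
  have h : (Finset.univ.filter fun k : Fin n => (i : ℕ) ≤ k) =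
      insert i (Finset.univ.filter fun k : Fin n => (i : ℕ) + 1 ≤ k) := by
    ext k
    simp only [Finset.mem_filter, Finset.mem_univ, true_and, Finset.mem_insert, Fin.ext_iff]
    omega
  rw [condCost, h, lmarginal_insert _ (P.measurable_totalCost C c) (by simp)]
  rfl

end

section
variable {x x' : Fin n → ℝ≥0} {m : ℕ}

lemma bin_congr (h : ∀ k : Fin n, (k : ℕ) < m → x k = x' k) {k : Fin n}
    (hk : (k : ℕ) ≤ m) : P.bin x k = P.bin x' k := by
  rw [bin, bin]
  congr 1
  ext l
  rw [h _ (lt_of_lt_of_le l.2 hk)]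

lemma usage_congr (h : ∀ k : Fin n, (k : ℕ) < m → x k = x' k) (j : Fin n) :
    P.usage x m j = P.usage x' m j := by
  rw [usage, usage, Finset.sum_filter, Finset.sum_filter]
  refine Finset.sum_congr rfl fun k _ => ?_
  by_cases hk : (k : ℕ) < m
  · rw [P.bin_congr h hk.le, h k hk]
  · simp [hk]

lemma openedBy_congr (h : ∀ k : Fin n, (k : ℕ) < m → x k = x' k) :
    P.openedBy x m = P.openedBy x' m := by
  rw [openedBy, openedBy]
  refine Finset.image_congr fun k hk => ?_
  have hk' : (k : ℕ) < m := by simpa using hk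
  exact P.bin_congr h hk'.le

end

lemma usage_succ (x : Fin n → ℝ≥0) (i : Fin n) (j : Fin n) :
    P.usage x (i + 1) j = P.usage x i j + if P.bin x i = j then x i else 0 := by
  have h : (Finset.univ.filter fun k : Fin n => (k : ℕ) < i + 1 ∧ P.bin x k = j) =
      (Finset.univ.filter fun k : Fin n => (k : ℕ) < i ∧ P.bin x k = j) ∪
        (Finset.univ.filter fun k : Fin n => k = i ∧ P.bin x k = j) := by
    ext k
    simp only [Finset.mem_filter, Finset.mem_univ, true_and, Finset.mem_union, Fin.ext_iff]
    rw [← or_and_right]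
    exact and_congr_left fun _ => by omega
  rw [usage, h, Finset.sum_union, usage]
  · congr 1
    rw [Finset.sum_filter]
    simp only [ite_and]
    simp
  · rw [Finset.disjoint_filter]
    rintro k _ ⟨h1, _⟩ ⟨rfl, _⟩
    omega

lemma openedBy_succ (x : Fin n → ℝ≥0) (i : Fin n) :
    P.openedBy x (i + 1) = insert (P.bin x i) (P.openedBy x i) := by
  rw [openedBy, openedBy, ← Finset.image_insert]
  congr 1
  ext k
  simp only [Finset.mem_filter, Finset.mem_univ, true_and, Finset.mem_insert, Fin.ext_iff]
  omega

lemma usage_eq_zero {x : Fin n → ℝ≥0} {m : ℕ} {j : Fin n} (h : j ∉ P.openedBy x m) :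
    P.usage x m j = 0 := by
  rw [usage, Finset.sum_eq_zero]
  intro k hk
  rw [Finset.mem_filter] at hk
  exact absurd (Finset.mem_image.2 ⟨k, by simpa using hk.2.1, hk.2.2⟩) h

lemma openedBy_zero (x : Fin n → ℝ≥0) : P.openedBy x 0 = ∅ := by simp [openedBy]

lemma usage_zero (x : Fin n → ℝ≥0) (j : Fin n) : P.usage x 0 j = 0 := by simp [usage]

lemma brokenBy_zero {c : ℝ} (hc : 0 ≤ c) (x : Fin n → ℝ≥0) : P.brokenBy c x 0 = ∅ := by
  ext j
  rw [mem_brokenBy, usage_zero]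
  simpa using hc

end Policy
end BinPacking

namespace BinPacking
namespace Policy
variable {n : ℕ} (P : Policy n)

section
variable (x : Fin n → ℝ≥0) (i : Fin n) (y : ℝ≥0)

lemma update_agree (k : Fin n) (hk : (k : ℕ) < i) : Function.update x i y k = x k :=
  Function.update_of_ne (by rintro rfl; omega) _ _

lemma bin_update : P.bin (Function.update x i y) i = P.bin x i :=
  P.bin_congr (update_agree x i y) le_rfl

lemma usage_update (j : Fin n) : P.usage (Function.update x i y) (i + 1) j =
    P.usage x i j + if P.bin x i = j then y else 0 := by
  rw [usage_succ, bin_update, P.usage_congr (update_agree x i y), Function.update_self]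

lemma openedBy_update : P.openedBy (Function.update x i y) (i + 1) =
    insert (P.bin x i) (P.openedBy x i) := by
  rw [openedBy_succ, bin_update, P.openedBy_congr (update_agree x i y)]

lemma card_brokenBy_update {c : ℝ} (h : (P.usage x i (P.bin x i) : ℝ) ≤ c) :
    (P.brokenBy c (Function.update x i y) (i + 1)).card =
      (P.brokenBy c x i).card + if c < P.usage x i (P.bin x i) + (y : ℝ) then 1 else 0 := by
  have hj : P.bin x i ∉ P.brokenBy c x i := by
    rw [mem_brokenBy]
    exact not_lt.2 h
  split_ifs with hb
  · rw [← Finset.card_insert_of_notMem hj]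
    congr 1
    ext l
    rw [mem_brokenBy, usage_update, Finset.mem_insert, mem_brokenBy]
    by_cases hl : P.bin x i = l
    · subst hl
      simpa using hb
    · simp [hl, Ne.symm hl]
  · rw [add_zero]
    congr 1
    ext l
    rw [mem_brokenBy, usage_update, mem_brokenBy]
    by_cases hl : P.bin x i = l
    · subst hl
      simpa [not_lt.2 h] using not_lt.1 hb
    · simp [hl]

end
end Policy

/-- The rounding error has mean zero and variance `p (1 - p) ≤ p ≤ t`, where `p` is the fractional
part of `t`. A bound by `t`, and not by a constant, makes the total variance in a bin depend on its
content and not on the number of its items. -/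
lemma interp_sq (d t : ℝ) (ht : 0 ≤ t) :
    interp (fun k => (d + (k - t)) ^ 2) t ≤ d ^ 2 + t := by
  have h1 := Nat.floor_le ht
  have h2 := Nat.lt_floor_add_one t
  rw [interp]
  push_cast
  have h3 : (0 : ℝ) ≤ ⌊t⌋₊ := Nat.cast_nonneg _
  nlinarith [sq_nonneg (t - ⌊t⌋₊)]

lemma interp_lin (g h : ℕ → ℝ) (u v : ℝ) (t : ℝ) :
    interp (fun k => u * g k + v * h k) t = u * interp g t + v * interp h t := by
  simp only [interp]
  ring

lemma interp_le_of {g : ℕ → ℝ} {c t : ℝ} (ht : 0 ≤ t) (h0 : g ⌊t⌋₊ ≤ c)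
    (h1 : g (⌊t⌋₊ + 1) ≤ c) : interp g t ≤ c := by
  have h3 := Nat.floor_le ht
  have h4 := Nat.lt_floor_add_one t
  rw [interp]
  nlinarith

lemma sum_weight_update {ι : Type*} [Fintype ι] [DecidableEq ι] (W : ℕ → ℕ) (hW : W 0 = 0)
    (lev : ι → ℕ) (j : ι) (m : ℕ) :
    ∑ l, W (Function.update lev j m l) = ∑ l, W (Function.update lev j 0 l) + W m := by
  rw [← Finset.add_sum_erase _ _ (Finset.mem_univ j),
    ← Finset.add_sum_erase _ (fun l => W (Function.update lev j 0 l)) (Finset.mem_univ j)]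
  simp only [Function.update_self, hW]
  rw [add_comm, zero_add]
  congr 1
  refine Finset.sum_congr rfl fun l hl => ?_
  rw [Function.update_of_ne (Finset.ne_of_mem_erase hl),
    Function.update_of_ne (Finset.ne_of_mem_erase hl)]

/-! ### Lower bound: virtual bins that imitate a policy for capacity `1`. -/

namespace Instance
variable (D : Instance) (Q : Policy D.items)

lemma wt_zero : D.wt 0 = 0 := by simp [wt, weight]

/-- The encoding of the virtual bins: `w j` is the level of the current substitute of bin `j`, and
`park` holds the levels of the former ones. -/
def virtualCode (w park : Fin D.items → ℕ) : ℕ := ∑ j, D.wt (w j) + ∑ j, D.wt (park j)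

/-- `w`, `park` and `d` may be the levels and the deviations of the virtual bins when the items
`k < i` have been packed. -/
structure Shadows (x : Fin D.items → ℝ≥0) (i : ℕ) (w park : Fin D.items → ℕ)
    (d : Fin D.items → ℝ) : Prop where
  park_eq : ∀ j : Fin D.items, i ≤ j → park j = 0
  opened : ∀ j ∈ Q.openedBy x i, (Q.usage x i j : ℝ) ≤ 1 →
    1 ≤ w j ∧ (w j : ℝ) - 1 ≤ d j + D.res * Q.usage x i j ∧ d j ≤ D.tol + 1
  unopened : ∀ j ∉ Q.openedBy x i, w j = 0

open Classical in
/-- The potential of bin `j`. -/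
noncomputable def shadowPot (x : Fin D.items → ℝ≥0) (i : ℕ) (d : Fin D.items → ℝ)
    (j : Fin D.items) : ℝ :=
  if j ∈ Q.openedBy x i ∧ (Q.usage x i j : ℝ) ≤ 1 then
    D.price * ((d j ^ 2 + D.res * (1 - Q.usage x i j)) / (D.tol : ℝ) ^ 2) else 0

lemma shadowPot_nonneg (x : Fin D.items → ℝ≥0) (i : ℕ) (d : Fin D.items → ℝ)
    (j : Fin D.items) : 0 ≤ D.shadowPot Q x i d j := by
  rw [shadowPot]
  split_ifs with h
  · have := D.price_nonneg
    have : (0 : ℝ) ≤ 1 - Q.usage x i j := by linarith [h.2]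
    positivity
  · exact le_rfl

/-- The factor that is lost by rounding the sizes. -/
noncomputable def loss : ℝ := D.price * (1 + D.res / (D.tol : ℝ) ^ 2)

lemma price_le_loss : D.price ≤ D.loss := by
  rw [loss]
  exact le_mul_of_one_le_right D.price_nonneg (by
    have : (0 : ℝ) ≤ D.res / (D.tol : ℝ) ^ 2 := by positivity
    linarith)

lemma one_le_price : 1 ≤ D.price := by
  rw [price]
  have : (0 : ℝ) ≤ D.top / (D.tol : ℝ) ^ 2 := by positivity
  linarith

variable {D Q}

/-- The virtual bin for item `i`: it has level `L`, deviation `d₀`, and `s` encodes the others. -/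
lemma Shadows.target {x : Fin D.items → ℝ≥0} {i : Fin D.items} {w park : Fin D.items → ℕ}
    {d : Fin D.items → ℝ} (h : D.Shadows Q x i w park d) (hQ : Q.Feasible 1) (hq : 0 < D.tol) :
    ∃ (L s : ℕ) (park' : Fin D.items → ℕ) (d₀ c : ℝ), 0 ≤ c ∧
      (∀ j : Fin D.items, (i : ℕ) + 1 ≤ j → park' j = 0) ∧
      (∀ m, s + D.wt m = D.virtualCode (Function.update w (Q.bin x i) m) park') ∧
      1 ≤ L ∧ (L : ℝ) - 1 ≤ d₀ + D.res * Q.usage x i (Q.bin x i) ∧ d₀ ≤ D.tol ∧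
      D.value i (D.virtualCode w park) ≤ c + D.pack (D.value (i + 1)) i L s ∧
      ((Q.bin x i ∈ Q.openedBy x i ∧
          c = D.price * ((d (Q.bin x i) ^ 2 - d₀ ^ 2) / (D.tol : ℝ) ^ 2)) ∨
        (Q.bin x i ∉ Q.openedBy x i ∧ c = D.price ∧ d₀ = 0)) := by
  set j := Q.bin x i with hj
  have hu : (Q.usage x i j : ℝ) ≤ 1 := hQ x i
  have hq' : (0 : ℝ) < D.tol := by exact_mod_cast hq
  have hcode : ∀ park' : Fin D.items → ℕ, ∀ m,
      D.virtualCode (Function.update w j 0) park' + D.wt m =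
        D.virtualCode (Function.update w j m) park' := by
    intro park' m
    rw [virtualCode, virtualCode, sum_weight_update D.wt D.wt_zero w j m]
    ring
  have hnn : (0 : ℝ) ≤ D.res * Q.usage x i j := by positivity
  by_cases ho : j ∈ Q.openedBy x i
  · obtain ⟨h1, h2, h3⟩ := h.opened j ho hu
    -- Within the tolerance the current substitute is used again, at no cost.
    by_cases hd : d j ≤ D.tol
    · refine ⟨w j, D.virtualCode (Function.update w j 0) park, park, d j, 0, le_rfl,
        fun l hl => h.park_eq l (by omega), hcode park, h1, h2, hd, ?_,
        .inl ⟨ho, by simp⟩⟩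
      have htop : w j ≤ D.top := by
        have : (w j : ℝ) ≤ (D.top : ℕ) := by
          rw [top]
          push_cast
          have : (D.res : ℝ) * Q.usage x i j ≤ D.res * 1 := by gcongr
          linarith
        exact_mod_cast this
      -- Current and parked bins together form one family of `2n` bins, fewer than the base.
      have e : D.virtualCode w park = ∑ l, D.wt (Sum.elim w park l) := by
        rw [Fintype.sum_sum_type]
        rfl
      have := D.value_le_pack i.2 (ι := Fin D.items ⊕ Fin D.items) (by simp [base]; omega)
        (Sum.elim w park) (j := Sum.inl j) e h1 htop
      have e2 : D.virtualCode w park - D.wt (w j) = D.virtualCode (Function.update w j 0) park := by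
        have := hcode park (w j)
        rw [Function.update_eq_self] at this
        omega
      rw [zero_add, ← e2]
      exact this
    -- The deviation is too large. The substitute is parked in slot `i`, which no earlier item has
    -- used, and a new virtual bin takes its place; since `d j > q`, its price is at most the
    -- quadratic part of the potential, which is released.
    · rw [not_le] at hd
      have e : D.virtualCode w park =
          D.virtualCode (Function.update w j 0) (Function.update park i (w j)) := by
        have h4 := hcode park (w j)
        rw [Function.update_eq_self] at h4
        have h5 := sum_weight_update D.wt D.wt_zero park i (w j)
        have h6 : Function.update park i 0 = park := by
          rw [← h.park_eq i le_rfl, Function.update_eq_self]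
        rw [h6] at h5
        rw [← h4, virtualCode, virtualCode, h5]
        ring
      refine ⟨1, D.virtualCode w park, Function.update park i (w j), 0,
        D.price * ((d j ^ 2 - 0 ^ 2) / (D.tol : ℝ) ^ 2), ?_, ?_, ?_, le_rfl, ?_, hq'.le, ?_,
        .inl ⟨ho, rfl⟩⟩
      · have := D.price_nonneg
        simp only [ne_eq, OfNat.ofNat_ne_zero, not_false_eq_true, zero_pow, sub_zero]
        positivity
      · intro l hl
        rw [Function.update_of_ne (by rintro rfl; omega)]
        exact h.park_eq l (by omega)
      · intro m
        rw [e]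
        exact hcode _ m
      · push_cast
        linarith
      · refine (D.value_le_new i.2 _).trans ?_
        have : D.price ≤ D.price * ((d j ^ 2 - 0 ^ 2) / (D.tol : ℝ) ^ 2) := by
          refine le_mul_of_one_le_right D.price_nonneg ?_
          rw [one_le_div (by positivity)]
          nlinarith
        linarith
  · have hw : w j = 0 := h.unopened j ho
    have e : D.virtualCode (Function.update w j 0) park = D.virtualCode w park := by
      rw [← hw, Function.update_eq_self]
    refine ⟨1, D.virtualCode w park, park, 0, D.price, D.price_nonneg,
      fun l hl => h.park_eq l (by omega), fun m => ?_, le_rfl, ?_, hq'.le,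
      D.value_le_new i.2 _, .inr ⟨ho, rfl, rfl⟩⟩
    · rw [← e]
      exact hcode park m
    · push_cast
      linarith

end Instance
end BinPacking

namespace BinPacking
namespace Instance
variable {D : Instance} {Q : Policy D.items}

/-- Only `m ≤ N y + 1` is used, so both roundings are covered. One item may carry the deviation past
the tolerance, but by at most `1`, which explains the bound `tol + 1` in `Shadows`. -/
lemma Shadows.update {x : Fin D.items → ℝ≥0} {i : Fin D.items} {w park park' : Fin D.items → ℕ}
    {d : Fin D.items → ℝ} (h : D.Shadows Q x i w park d)
    (hpark : ∀ j : Fin D.items, (i : ℕ) + 1 ≤ j → park' j = 0) {L : ℕ} {d₀ : ℝ} (hL : 1 ≤ L)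
    (hLd : (L : ℝ) - 1 ≤ d₀ + D.res * Q.usage x i (Q.bin x i)) (hd : d₀ ≤ D.tol)
    (y : ℝ≥0) {m : ℕ} (hm : (m : ℝ) ≤ D.res * y + 1) :
    D.Shadows Q (Function.update x i y) (i + 1) (Function.update w (Q.bin x i) (L + m)) park'
      (Function.update d (Q.bin x i) (d₀ + (m - D.res * y))) where
  park_eq := hpark
  opened l hl hu := by
    rw [Q.usage_update] at hu ⊢
    rw [Q.openedBy_update] at hl
    by_cases hlj : l = Q.bin x i
    · subst hlj
      simp only [Function.update_self, if_true]
      push_cast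
      refine ⟨by omega, ?_, by linarith⟩
      rw [mul_add]
      linarith
    · rw [Function.update_of_ne hlj, Function.update_of_ne hlj]
      rw [if_neg (Ne.symm hlj), add_zero] at hu ⊢
      exact h.opened l ((Finset.mem_insert.1 hl).resolve_left hlj) hu
  unopened l hl := by
    rw [Q.openedBy_update, Finset.mem_insert, not_or] at hl
    rw [Function.update_of_ne hl.1]
    exact h.unopened l hl.2

lemma sum_shadowPot (x : Fin D.items → ℝ≥0) (i : Fin D.items) (d : Fin D.items → ℝ) (y : ℝ≥0)
    (e : ℝ) :
    ∑ l, D.shadowPot Q (Function.update x i y) (i + 1) (Function.update d (Q.bin x i) e) l =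
      ∑ l, D.shadowPot Q x i d l - D.shadowPot Q x i d (Q.bin x i) +
      if (Q.usage x i (Q.bin x i) : ℝ) + y ≤ 1 then
        D.price * ((e ^ 2 + D.res * (1 - (Q.usage x i (Q.bin x i) + y))) / (D.tol : ℝ) ^ 2)
      else 0 := by
  rw [← Finset.add_sum_erase _ _ (Finset.mem_univ (Q.bin x i)),
    ← Finset.add_sum_erase _ (D.shadowPot Q x i d) (Finset.mem_univ (Q.bin x i))]
  have h : ∀ l ∈ Finset.univ.erase (Q.bin x i),
      D.shadowPot Q (Function.update x i y) (i + 1) (Function.update d (Q.bin x i) e) l =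
        D.shadowPot Q x i d l := by
    intro l hl
    have hl' := Finset.ne_of_mem_erase hl
    rw [shadowPot, shadowPot, Q.usage_update, Q.openedBy_update, Function.update_of_ne hl']
    simp [hl', Ne.symm hl']
  rw [Finset.sum_congr rfl h, shadowPot]
  simp only [Q.usage_update, Q.openedBy_update, Finset.mem_insert, true_or, true_and,
    if_true, Function.update_self]
  push_cast
  ring_nf

lemma real_le_of_ofReal_le {A B : ℝ} {T : ℝ≥0∞} (hT : T ≠ ⊤) (hB : 0 ≤ B)
    (h : ENNReal.ofReal A ≤ T + ENNReal.ofReal B) : A ≤ T.toReal + B := by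
  have := ENNReal.toReal_mono (by finiteness) h
  rw [ENNReal.toReal_add hT (by finiteness), ENNReal.toReal_ofReal hB] at this
  rw [ENNReal.toReal_ofReal'] at this
  exact (le_max_left _ _).trans this

lemma ofReal_le_of_real_le {A B : ℝ} {T : ℝ≥0∞} (hB : 0 ≤ B)
    (h : T ≠ ⊤ → A ≤ T.toReal + B) : ENNReal.ofReal A ≤ T + ENNReal.ofReal B := by
  by_cases hT : T = ⊤
  · simp [hT]
  · rw [ENNReal.ofReal_le_iff_le_toReal (by finiteness),
      ENNReal.toReal_add hT (by finiteness), ENNReal.toReal_ofReal hB]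
    exact h hT

variable (D Q) in
/-- The virtual bins can imitate the policy `Q` from item `i` on. -/
def Imitates (μ : Fin D.items → Measure ℝ≥0) (C : ℝ≥0) (x : Fin D.items → ℝ≥0) (i : ℕ) : Prop :=
  ∀ w park d, D.Shadows Q x i w park d →
    ENNReal.ofReal (D.value i (D.virtualCode w park) +
        D.loss * ((Q.openedBy x i).card + C * (Q.brokenBy 1 x i).card)) ≤
      ENNReal.ofReal D.loss * Q.condCost μ C 1 i x + ENNReal.ofReal (∑ j, D.shadowPot Q x i d j)

/-- The real size `y` is fixed here and only the rounding is averaged: the induction hypothesis is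
applied to both neighbours of `N y`. -/
lemma imitates_pointwise {μ : Fin D.items → Measure ℝ≥0} {C : ℝ≥0} (hC : D.penalty = C)
    (hQ : Q.Feasible 1) (hq : 0 < D.tol) {x : Fin D.items → ℝ≥0} {i : Fin D.items}
    {w park park' : Fin D.items → ℕ}
    {d : Fin D.items → ℝ} (h : D.Shadows Q x i w park d)
    (hpark : ∀ j : Fin D.items, (i : ℕ) + 1 ≤ j → park' j = 0) {L s : ℕ} {d₀ c : ℝ} (hL : 1 ≤ L)
    (hLd : (L : ℝ) - 1 ≤ d₀ + D.res * Q.usage x i (Q.bin x i)) (hd : d₀ ≤ D.tol)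
    (hs : ∀ m, s + D.wt m = D.virtualCode (Function.update w (Q.bin x i) m) park')
    (hc : (Q.bin x i ∈ Q.openedBy x i ∧
          c = D.price * ((d (Q.bin x i) ^ 2 - d₀ ^ 2) / (D.tol : ℝ) ^ 2)) ∨
        (Q.bin x i ∉ Q.openedBy x i ∧ c = D.price ∧ d₀ = 0))
    (y : ℝ≥0) (ih : D.Imitates Q μ C (Function.update x i y) (i + 1)) :
    ENNReal.ofReal (interp (D.after (D.value (i + 1)) L s) (D.res * y) + (c +
        D.loss * ((Q.openedBy x i).card + C * (Q.brokenBy 1 x i).card))) ≤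
      ENNReal.ofReal D.loss * Q.condCost μ C 1 (i + 1) (Function.update x i y) +
        ENNReal.ofReal (∑ j, D.shadowPot Q x i d j) := by
  have hu : (Q.usage x i (Q.bin x i) : ℝ) ≤ 1 := hQ x i
  have hu0 : (0 : ℝ) ≤ Q.usage x i (Q.bin x i) := NNReal.coe_nonneg _
  have hq' : (0 : ℝ) < D.tol := by exact_mod_cast hq
  have hN : (0 : ℝ) ≤ D.res := Nat.cast_nonneg _
  have ht : (0 : ℝ) ≤ D.res * y := by positivity
  have hpos : ∀ (x : Fin D.items → ℝ≥0) i d, 0 ≤ ∑ j, D.shadowPot Q x i d j :=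
    fun x i d => Finset.sum_nonneg fun j _ => D.shadowPot_nonneg Q x i d j
  refine ofReal_le_of_real_le (hpos _ _ _) fun hT => ?_
  set T := (ENNReal.ofReal D.loss *
    Q.condCost μ C 1 (i + 1) (Function.update x i y)).toReal with hTdef
  -- The induction hypothesis after the item, with the rounded size still open.
  have key : ∀ m : ℕ, (m : ℝ) ≤ D.res * y + 1 →
      D.value (i + 1) (s + D.wt (L + m)) + D.loss * ((insert (Q.bin x i) (Q.openedBy x i)).card +
        C * ((Q.brokenBy 1 x i).card +
          if 1 < (Q.usage x i (Q.bin x i) : ℝ) + y then 1 else 0)) ≤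
      T + (∑ l, D.shadowPot Q x i d l - D.shadowPot Q x i d (Q.bin x i) +
      if (Q.usage x i (Q.bin x i) : ℝ) + y ≤ 1 then
        D.price * (((d₀ + (m - D.res * y)) ^ 2 +
          D.res * (1 - (Q.usage x i (Q.bin x i) + y))) / (D.tol : ℝ) ^ 2)
      else 0) := by
    intro m hm
    have h1 := real_le_of_ofReal_le hT (hpos _ _ _)
      (ih _ _ _ (h.update hpark hL hLd hd y hm))
    rw [← hs, Q.openedBy_update, Q.card_brokenBy_update x i y hu, sum_shadowPot] at h1
    push_cast at h1
    exact h1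
  have hfl := Nat.floor_le ht
  have hfl2 := Nat.lt_floor_add_one (D.res * y : ℝ)
  have k0 := key ⌊(D.res * y : ℝ)⌋₊ (by linarith)
  have k1 := key (⌊(D.res * y : ℝ)⌋₊ + 1) (by push_cast; linarith)
  have hpr := D.price_nonneg
  have hpl := D.price_le_loss
  have hC0 : (0 : ℝ) ≤ C := C.2
  have hpot : D.shadowPot Q x i d (Q.bin x i) =
      if Q.bin x i ∈ Q.openedBy x i then
        D.price * ((d (Q.bin x i) ^ 2 + D.res * (1 - Q.usage x i (Q.bin x i))) / (D.tol : ℝ) ^ 2)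
      else 0 := by
    rw [shadowPot]
    simp [hu]
  -- The balance of prices and potential: for an open bin, `c` is exactly the potential released by
  -- resetting the deviation; for a new bin, `loss` is exactly the price plus the initial potential.
  have hpc : c + D.loss * (Q.openedBy x i).card +
      D.price * ((d₀ ^ 2 + D.res * (1 - Q.usage x i (Q.bin x i))) / (D.tol : ℝ) ^ 2) ≤
      D.loss * (insert (Q.bin x i) (Q.openedBy x i)).card + D.shadowPot Q x i d (Q.bin x i) := by
    rw [hpot]
    rcases hc with ⟨ho, rfl⟩ | ⟨ho, rfl, rfl⟩
    · rw [if_pos ho, Finset.insert_eq_of_mem ho]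
      apply le_of_eq
      ring
    · rw [if_neg ho, Finset.card_insert_of_notMem ho, Q.usage_eq_zero ho, loss]
      push_cast
      apply le_of_eq
      ring
  generalize D.shadowPot Q x i d (Q.bin x i) = pj at *
  generalize ∑ j, D.shadowPot Q x i d j = ps at *
  generalize ((insert (Q.bin x i) (Q.openedBy x i)).card : ℝ) = oc' at *
  generalize ((Q.openedBy x i).card : ℝ) = oc at *
  generalize ((Q.brokenBy 1 x i).card : ℝ) = br at *
  generalize (Q.usage x i (Q.bin x i) : ℝ) = u at *
  by_cases hb : u + y ≤ 1
  · simp only [if_pos hb, if_neg (not_lt.2 hb), add_zero] at k0 k1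
    -- The bin of `Q` survives, and so does its substitute: `L + m ≤ (q + N u + 1) + (N y + 1) ≤ N +
    -- q + 2`. This determines the value of `top`.
    have hin : ∀ m : ℕ, (m : ℝ) ≤ D.res * y + 1 →
        D.after (D.value (i + 1)) L s m = D.value (i + 1) (s + D.wt (L + m)) := by
      intro m hm
      rw [after, if_pos]
      have h1 : ((L + m : ℕ) : ℝ) ≤ (D.top : ℕ) := by
        rw [top]
        push_cast
        have : (D.res : ℝ) * (u + y) ≤ D.res * 1 := by gcongr
        linarith
      exact_mod_cast h1
    -- The square is moved to the left so that a bound independent of `m` remains. On averaging, the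
    -- square grows by at most `N y`, which is what the linear part of the potential loses.
    have h2 := interp_le_of (g := fun m : ℕ => 1 * D.after (D.value (i + 1)) L s m +
      (-(D.price / (D.tol : ℝ) ^ 2)) * (d₀ + (m - D.res * y)) ^ 2) (t := D.res * y)
      (c := T + ps - pj - D.loss * (oc' + C * br) +
        D.price * ((D.res * (1 - (u + y))) / (D.tol : ℝ) ^ 2)) ht
      (by
        rw [hin _ (by linarith)]
        have : D.price * (((d₀ + (⌊(D.res * y : ℝ)⌋₊ - D.res * y)) ^ 2 +
          D.res * (1 - (u + y))) / (D.tol : ℝ) ^ 2) = D.price / (D.tol : ℝ) ^ 2 *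
          (d₀ + (⌊(D.res * y : ℝ)⌋₊ - D.res * y)) ^ 2 +
          D.price * ((D.res * (1 - (u + y))) / (D.tol : ℝ) ^ 2) := by ring
        linarith)
      (by
        rw [hin _ (by push_cast; linarith)]
        have : D.price * (((d₀ + ((⌊(D.res * y : ℝ)⌋₊ + 1 : ℕ) - D.res * y)) ^ 2 +
          D.res * (1 - (u + y))) / (D.tol : ℝ) ^ 2) = D.price / (D.tol : ℝ) ^ 2 *
          (d₀ + ((⌊(D.res * y : ℝ)⌋₊ + 1 : ℕ) - D.res * y)) ^ 2 +
          D.price * ((D.res * (1 - (u + y))) / (D.tol : ℝ) ^ 2) := by ring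
        linarith)
    rw [interp_lin] at h2
    have h3 := mul_le_mul_of_nonneg_left (interp_sq d₀ (D.res * y) ht)
      (show 0 ≤ D.price / (D.tol : ℝ) ^ 2 by positivity)
    have e1 : D.price * ((d₀ ^ 2 + D.res * (1 - u)) / (D.tol : ℝ) ^ 2) =
      D.price / (D.tol : ℝ) ^ 2 * (d₀ ^ 2 + D.res * y) +
        D.price * ((D.res * (1 - (u + y))) / (D.tol : ℝ) ^ 2) := by ring
    linarith
  · rw [if_neg hb, if_pos (not_le.1 hb)] at k0 k1
    -- The bin of `Q` breaks. Its penalty, multiplied by `loss ≥ 1`, covers that of the substitute,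
    -- whether or not the substitute overflows too.
    have hle : ∀ m, D.after (D.value (i + 1)) L s m ≤ C + D.value (i + 1) (s + D.wt (L + m)) := by
      intro m
      rw [after]
      split_ifs with hm
      · linarith
      · rw [wt, weight_of_lt (by omega), add_zero, hC]
    have h1 : 1 ≤ D.loss := D.one_le_price.trans hpl
    have h2 : (C : ℝ) ≤ D.loss * C := le_mul_of_one_le_left hC0 h1
    have h3 : (0 : ℝ) ≤ D.price * ((d₀ ^ 2 + D.res * (1 - u)) / (D.tol : ℝ) ^ 2) := by
      have : (0 : ℝ) ≤ 1 - u := by linarith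
      positivity
    have h4 := interp_le_of (g := D.after (D.value (i + 1)) L s) (t := D.res * y)
      (c := T + ps - pj - D.loss * (oc' + C * (br + 1)) + C) ht
      (by linarith [hle ⌊(D.res * y : ℝ)⌋₊]) (by linarith [hle (⌊(D.res * y : ℝ)⌋₊ + 1)])
    linarith

/-- Backward induction over the items: `Shadows.target` selects an action for the virtual bins,
which bounds `value` from above, and `imitates_pointwise` is integrated over the size of the item.
-/
theorem imitates {μ : Fin D.items → Measure ℝ≥0} [∀ i, IsProbabilityMeasure (μ i)]
    (hO : D.oracle = Oracle.ofLaws μ) (hN : 0 < D.res) (hq : 0 < D.tol) {C : ℝ≥0}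
    (hC : D.penalty = C) (hQ : Q.Feasible 1) (r : ℕ) (hr : r ≤ D.items)
    (x : Fin D.items → ℝ≥0) : D.Imitates Q μ C x (D.items - r) := by
  have hl0 : 0 ≤ D.loss := D.price_nonneg.trans D.price_le_loss
  induction r generalizing x with
  | zero =>
    intro w park d h
    rw [Nat.sub_zero, value_last, zero_add, Q.condCost_last]
    refine le_add_right (le_of_eq ?_)
    rw [ENNReal.ofReal_mul hl0, ENNReal.ofReal_add (by positivity) (by positivity),
      ENNReal.ofReal_mul (NNReal.coe_nonneg C)]
    simp
  | succ r ih =>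
    intro w park d h
    obtain ⟨i, hi⟩ : ∃ i : Fin D.items, (i : ℕ) = D.items - (r + 1) := ⟨⟨_, by omega⟩, rfl⟩
    have hi' : D.items - r = i + 1 := by omega
    rw [← hi] at h ⊢
    rw [hi'] at ih
    obtain ⟨L, s, park', d₀, c, hc0, hpark, hs, hL, hLd, hd, hval, hc⟩ := h.target hQ hq
    have hpt := fun y => imitates_pointwise hC hQ hq h hpark hL hLd hd hs hc y (ih (by omega) _)
    obtain ⟨hint, hpack⟩ := D.integral_after μ hO hN i (D.value (i + 1)) L s
    have hA : 0 ≤ c + D.loss * ((Q.openedBy x i).card + C * (Q.brokenBy 1 x i).card) := by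
      positivity
    set A := c + D.loss * ((Q.openedBy x i).card + C * (Q.brokenBy 1 x i).card) with hAdef
    calc _ ≤ ENNReal.ofReal (D.pack (D.value (i + 1)) i L s + A) := by
          apply ENNReal.ofReal_le_ofReal
          rw [hAdef]
          linarith
      _ = ENNReal.ofReal (∫ y, (interp (D.after (D.value (i + 1)) L s) (D.res * y) + A) ∂(μ i)) := by
          rw [integral_add hint (integrable_const _), hpack]
          simp
      _ = ∫⁻ y, ENNReal.ofReal (interp (D.after (D.value (i + 1)) L s) (D.res * y) + A) ∂(μ i) := by
          refine ofReal_integral_eq_lintegral_ofReal (hint.add (integrable_const _))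
            (Filter.Eventually.of_forall fun y => ?_)
          refine add_nonneg (interp_nonneg (D.after_nonneg ?_ ?_ _ _) (by positivity)) hA
          · exact fun s => D.value_nonneg μ hO hN (by rw [hC]; exact C.2) _ s
          · rw [hC]
            exact C.2
      _ ≤ ∫⁻ y, (ENNReal.ofReal D.loss * Q.condCost μ C 1 (i + 1) (Function.update x i y) +
            ENNReal.ofReal (∑ j, D.shadowPot Q x i d j)) ∂(μ i) := lintegral_mono hpt
      _ = _ := by
          rw [lintegral_add_right _ measurable_const, lintegral_const_mul' _ _ (by finiteness),
            ← Q.condCost_step]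
          simp

/-- The value of the dynamic program is a lower bound for the optimal cost, up to the factor
`loss`. -/
theorem value_le_optCost (μ : Fin D.items → Measure ℝ≥0) [∀ i, IsProbabilityMeasure (μ i)]
    (hO : D.oracle = Oracle.ofLaws μ) (hN : 0 < D.res) (hq : 0 < D.tol) {C : ℝ≥0}
    (hC : D.penalty = C) :
    ENNReal.ofReal (D.value 0 0) ≤ ENNReal.ofReal D.loss * optCost μ C 1 := by
  rw [optCost, ENNReal.mul_iInf_of_ne (by
    have := D.one_le_price.trans D.price_le_loss
    simp; linarith) (by finiteness)]
  refine le_iInf fun Q => ?_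
  by_cases hQ : Q.Feasible 1
  · simp only [hQ, iInf_pos]
    have h := imitates hO hN hq hC hQ D.items le_rfl 0
    rw [Nat.sub_self] at h
    have := h (fun _ => 0) (fun _ => 0) (fun _ => 0)
      ⟨fun _ _ => rfl, fun j hj => by simp [Q.openedBy_zero] at hj, fun _ _ => rfl⟩
    rw [Q.condCost_zero, Q.openedBy_zero, Q.brokenBy_zero zero_le_one] at this
    simpa [virtualCode, wt_zero, shadowPot, Q.openedBy_zero] using this
  · have : ENNReal.ofReal D.loss ≠ 0 := by
      have := D.one_le_price.trans D.price_le_loss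
      simp; linarith
    simp [hQ, ENNReal.mul_top this]

end Instance
end BinPacking

namespace BinPacking

/-! ## The controller that evaluates a table of actions -/

/-- The tables from which a policy is evaluated. -/
structure Controller where
  top : ℕ
  res : ℕ
  tol : ℕ
  penalty : ℝ
  wt : ℕ → ℕ
  act : ℕ → ℕ → ℕ
  val : ℕ → ℕ → ℝ

/-- The levels of the bins, the encoding of the multiset of levels, and the deviations of the real
usages of the bins from the virtual ones. -/
abbrev Config (n : ℕ) := ((Fin n → ℕ) × ℕ) × (Fin n → ℝ)

/-- The last bin among the first `m` that has level `L`, or bin `i` if there is none. -/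
def search {n : ℕ} (lev : Fin n → ℕ) (L : ℕ) (i : Fin n) : ℕ → Fin n
  | 0 => i
  | m + 1 => if h : m < n then (if lev ⟨m, h⟩ = L then ⟨m, h⟩ else search lev L i m)
      else search lev L i m

lemma search_spec {n : ℕ} (lev : Fin n → ℕ) (L : ℕ) (i : Fin n) (m : ℕ) :
    lev (search lev L i m) = L ∨
      search lev L i m = i ∧ ∀ j : Fin n, (j : ℕ) < m → lev j ≠ L := by
  induction m with
  | zero => exact .inr ⟨rfl, fun j hj => absurd hj (Nat.not_lt_zero _)⟩
  | succ m ih =>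
    rw [search]
    split_ifs with h h'
    · exact .inl h'
    · refine ih.imp_right fun ⟨h1, h2⟩ => ⟨h1, fun j hj => ?_⟩
      rcases Nat.lt_succ_iff_lt_or_eq.1 hj with hj | hj
      · exact h2 j hj
      · rwa [show j = ⟨m, h⟩ from Fin.ext hj]
    · exact ih.imp_right fun ⟨h1, h2⟩ => ⟨h1, fun j _ => h2 j (by omega)⟩

namespace Controller
variable (K : Controller) {n : ℕ}

/-- The level of the bin into which item `i` is packed; `0` stands for a new bin. -/
def target (i : Fin n) (S : Config n) : ℕ := K.act i S.1.2

/-- A bin of the target level. -/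
def found (i : Fin n) (S : Config n) : Fin n := search S.1.1 (K.target i S) i i

open Classical in
/-- The bin into which item `i` is packed. -/
noncomputable def bin (i : Fin n) (S : Config n) : Fin n :=
  if S.2 (K.found i S) ≤ K.tol then K.found i S else i

open Classical in
/-- The levels after a bin with too large a deviation has been retired. -/
noncomputable def levels (i : Fin n) (S : Config n) : Fin n → ℕ :=
  if S.2 (K.found i S) ≤ K.tol then S.1.1 else Function.update S.1.1 (K.found i S) (K.top + 1)

/-- The encoding of the other bins. -/
def rest (i : Fin n) (S : Config n) : ℕ := S.1.2 - K.wt (K.target i S)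

/-- The level of the bin into which item `i` is packed, where a new bin has level `1`. -/
def level (i : Fin n) (S : Config n) : ℕ := K.target i S + (1 - K.target i S)

/-- The estimate for the cost if the level of the current bin rises from `L` to `L + m`. -/
noncomputable def estimate (i L s m : ℕ) : ℝ :=
  K.val i (s + K.wt (L + m)) + if L + m ≤ K.top then 0 else K.penalty

/-- The rounded size, before the choice between the two adjacent integers. -/
noncomputable def floor (x : ℝ≥0) : ℕ := min ⌊(K.res * x : ℝ)⌋₊ K.top

/-- The size of the current item is rounded down. -/
def Down (i L s : ℕ) (d : ℝ) (x : ℝ≥0) : Prop :=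
  K.estimate i L s (K.floor x) + (d + K.res * x - K.floor x) ^ 2 / (K.tol : ℝ) ^ 2 ≤
    K.estimate i L s (K.floor x + 1) +
      ((d + K.res * x - K.floor x - 1) ^ 2 - 1) / (K.tol : ℝ) ^ 2

open Classical in
/-- The rounded size. -/
noncomputable def round (i L s : ℕ) (d : ℝ) (x : ℝ≥0) : ℕ :=
  if K.Down i L s d x then K.floor x else K.floor x + 1

/-- The configuration after the size `x` of the item in bin `j` has been revealed. -/
noncomputable def settle (i : ℕ) (lev : Fin n → ℕ) (s : ℕ) (dev : Fin n → ℝ) (j : Fin n) (L : ℕ)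
    (x : ℝ≥0) : Config n :=
  ((Function.update lev j (L + K.round i L s (dev j) x),
    s + K.wt (L + K.round i L s (dev j) x)),
    Function.update dev j (dev j + K.res * x - K.round i L s (dev j) x))

/-- The configuration after item `i`. -/
noncomputable def step (i : Fin n) (S : Config n) (x : ℝ≥0) : Config n :=
  K.settle (i + 1) (K.levels i S) (K.rest i S) S.2 (K.bin i S) (K.level i S) x

variable (n) in
/-- The configuration after the items `k < m`. -/
noncomputable def config (x : ℕ → ℝ≥0) : ℕ → Config n
  | 0 => ((0, 0), 0)
  | m + 1 => if h : m < n then K.step ⟨m, h⟩ (config x m) (x m) else config x m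

lemma config_succ (x : ℕ → ℝ≥0) (i : Fin n) :
    K.config n x (i + 1) = K.step i (K.config n x i) (x i) := by
  rw [config, dif_pos i.2]

lemma config_congr {x x' : ℕ → ℝ≥0} {m : ℕ} (h : ∀ k < m, x k = x' k) :
    K.config n x m = K.config n x' m := by
  induction m with
  | zero => rfl
  | succ m ih =>
    rw [config, config, ih fun k hk => h k (by omega), h m (by omega)]

lemma measurable_round (i L s : ℕ) :
    Measurable fun p : ℝ × ℝ≥0 => K.round i L s p.1 p.2 := by
  have hf : Measurable fun p : ℝ × ℝ≥0 => K.floor p.2 := by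
    unfold floor
    exact (Nat.measurable_floor.comp (by fun_prop)).min measurable_const
  have he : ∀ j, Measurable fun p : ℝ × ℝ≥0 => K.estimate i L s (K.floor p.2 + j) := fun j =>
    (measurable_of_countable fun m => K.estimate i L s (m + j)).comp hf
  have hc : Measurable fun p : ℝ × ℝ≥0 => (K.floor p.2 : ℝ) :=
    (measurable_of_countable fun m : ℕ => (m : ℝ)).comp hf
  have hd : Measurable fun p : ℝ × ℝ≥0 => p.1 + K.res * (p.2 : ℝ) - K.floor p.2 :=
    Measurable.sub (by fun_prop) hc
  refine Measurable.ite ?_ hf (hf.add measurable_const)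
  exact measurableSet_le ((he 0).add ((hd.pow_const 2).div_const _))
    ((he 1).add ((((hd.sub_const 1).pow_const 2).sub_const 1).div_const _))

lemma measurable_settle (i : ℕ) (lev : Fin n → ℕ) (s : ℕ) (j : Fin n) (L : ℕ) :
    Measurable fun p : (Fin n → ℝ) × ℝ≥0 => K.settle i lev s p.1 j L p.2 := by
  have hr : Measurable fun p : (Fin n → ℝ) × ℝ≥0 => K.round i L s (p.1 j) p.2 :=
    (K.measurable_round i L s).comp (f := fun p : (Fin n → ℝ) × ℝ≥0 => (p.1 j, p.2))
      (by fun_prop)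
  have hc : Measurable fun p : (Fin n → ℝ) × ℝ≥0 => (K.round i L s (p.1 j) p.2 : ℝ) :=
    (measurable_of_countable fun m : ℕ => (m : ℝ)).comp hr
  refine Measurable.prodMk ?_ ?_
  · exact (measurable_of_countable fun m : ℕ =>
      ((Function.update lev j (L + m), s + K.wt (L + m)) : (Fin n → ℕ) × ℕ)).comp hr
  · refine measurable_pi_lambda _ fun l => ?_
    by_cases h : l = j
    · subst h
      simp only [Function.update_self]
      fun_prop
    · simp only [Function.update_of_ne h]
      fun_prop

/-- Levels and encoding range over a countable type. Once they are fixed, the step is a case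
distinction by one measurable condition on the deviations, followed by `settle`. -/
lemma measurable_step (i : Fin n) : Measurable fun p : Config n × ℝ≥0 => K.step i p.1 p.2 := by
  have h : Measurable fun p : ((Fin n → ℕ) × ℕ) × ((Fin n → ℝ) × ℝ≥0) =>
      K.step i (p.1, p.2.1) p.2.2 := by
    classical
    refine measurable_from_prod_countable_right fun a => ?_
    have e : (fun b : (Fin n → ℝ) × ℝ≥0 => K.step i (a, b.1) b.2) = fun b =>
        if b.1 (search a.1 (K.act i a.2) i i) ≤ (K.tol : ℝ) then
          K.settle (i + 1) a.1 (a.2 - K.wt (K.act i a.2)) b.1 (search a.1 (K.act i a.2) i i)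
            (K.act i a.2 + (1 - K.act i a.2)) b.2
        else
          K.settle (i + 1) (Function.update a.1 (search a.1 (K.act i a.2) i i) (K.top + 1))
            (a.2 - K.wt (K.act i a.2)) b.1 i (K.act i a.2 + (1 - K.act i a.2)) b.2 := by
      ext1 b
      by_cases hb : b.1 (search a.1 (K.act i a.2) i i) ≤ K.tol
      · have hb' : (a, b.1).2 (K.found i (a, b.1)) ≤ (K.tol : ℝ) := hb
        rw [if_pos hb, step, levels, bin, if_pos hb', if_pos hb']
        rfl
      · have hb' : ¬ (a, b.1).2 (K.found i (a, b.1)) ≤ (K.tol : ℝ) := hb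
        rw [if_neg hb, step, levels, bin, if_neg hb', if_neg hb']
        rfl
    refine Eq.mpr (congrArg Measurable e) ?_
    refine Measurable.ite (measurableSet_le (by fun_prop) measurable_const)
      (K.measurable_settle _ _ _ _ _) (K.measurable_settle _ _ _ _ _)
  exact h.comp (f := fun p : Config n × ℝ≥0 => (p.1.1, (p.1.2, p.2))) (by fun_prop)

lemma measurable_bin (i : Fin n) : Measurable (K.bin i) := by
  classical
  refine measurable_from_prod_countable_right fun a => ?_
  have h : Measurable fun b : Fin n → ℝ => if b (search a.1 (K.act i a.2) i i) ≤ (K.tol : ℝ)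
      then search a.1 (K.act i a.2) i i else i :=
    Measurable.ite (measurableSet_le (measurable_pi_apply _) measurable_const)
      measurable_const measurable_const
  convert h
  rfl

lemma measurable_config (m : ℕ) : Measurable fun x : ℕ → ℝ≥0 => K.config n x m := by
  induction m with
  | zero => exact measurable_const
  | succ m ih =>
    unfold config
    split_ifs with h
    · exact (K.measurable_step ⟨m, h⟩).comp (ih.prodMk (measurable_pi_apply m))
    · exact ih

/-- Continuation of a finite sequence by `0`. -/
def extend {m : ℕ} (x : Fin m → ℝ≥0) (k : ℕ) : ℝ≥0 := if h : k < m then x ⟨k, h⟩ else 0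

lemma measurable_extend (m : ℕ) : Measurable (extend : (Fin m → ℝ≥0) → ℕ → ℝ≥0) := by
  refine measurable_pi_lambda _ fun k => ?_
  unfold extend
  split_ifs
  · exact measurable_pi_apply _
  · exact measurable_const

variable (n) in
/-- The policy of the controller. -/
noncomputable def policy : Policy n where
  choose i x := K.bin i (K.config n (extend x) i)
  measurable_choose i :=
    (K.measurable_bin i).comp ((K.measurable_config i).comp (measurable_extend _))

lemma policy_bin (x : Fin n → ℝ≥0) (i : Fin n) :
    (K.policy n).bin x i = K.bin i (K.config n (extend x) i) := by
  rw [Policy.bin, policy]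
  dsimp only
  congr 1
  refine K.config_congr fun k hk => ?_
  rw [extend, extend, dif_pos hk, dif_pos (hk.trans i.2)]
  rfl

lemma config_update (x : Fin n → ℝ≥0) (i : Fin n) (y : ℝ≥0) :
    K.config n (extend (Function.update x i y)) (i + 1) =
      K.step i (K.config n (extend x) i) y := by
  rw [config_succ]
  congr 1
  · refine K.config_congr fun k hk => ?_
    rw [extend, extend, dif_pos (hk.trans i.2), dif_pos (hk.trans i.2)]
    exact Policy.update_agree x i y _ hk
  · simp [extend]

end Controller
end BinPacking

/-! ### Upper bound: the potential of the controller. -/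

namespace BinPacking

lemma le_interp_of {g : ℕ → ℝ} {c t : ℝ} (ht : 0 ≤ t) (h0 : c ≤ g ⌊t⌋₊)
    (h1 : c ≤ g (⌊t⌋₊ + 1)) : c ≤ interp g t := by
  have h3 := Nat.floor_le ht
  have h4 := Nat.lt_floor_add_one t
  rw [interp]
  nlinarith

lemma interp_cast (t : ℝ) : interp (fun k => (k : ℝ)) t = t := by
  simp only [interp]
  push_cast
  ring

open Controller (extend)

namespace Instance
variable (D : Instance)

/-- The controller with the tables of the dynamic program. -/
noncomputable def controller : Controller where
  top := D.top
  res := D.res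
  tol := D.tol
  penalty := D.penalty
  wt := D.wt
  act := D.act
  val := D.value

/-- The policy that is computed by the dynamic program. -/
noncomputable def policy : Policy D.items := D.controller.policy D.items

/-- The configuration of the bins before item `i`. -/
noncomputable def configAt (x : Fin D.items → ℝ≥0) (i : ℕ) : Config D.items :=
  D.controller.config D.items (extend x) i

lemma policy_bin (x : Fin D.items → ℝ≥0) (i : Fin D.items) :
    D.policy.bin x i = D.controller.bin i (D.configAt x i) := D.controller.policy_bin x i

/-- The configuration `S` describes the bins before item `i`. -/
structure Tracks (x : Fin D.items → ℝ≥0) (i : ℕ) (S : Config D.items) : Prop where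
  code : S.1.2 = ∑ j, D.wt (S.1.1 j)
  later : ∀ j : Fin D.items, i ≤ j → S.1.1 j = 0
  zero : ∀ j, S.1.1 j = 0 → S.2 j = 0 ∧ j ∉ D.policy.openedBy x i
  pos : ∀ j, S.1.1 j ≠ 0 → j ∈ D.policy.openedBy x i
  usage : ∀ j, 1 ≤ S.1.1 j → S.1.1 j ≤ D.top →
    (D.res : ℝ) * D.policy.usage x i j ≤ S.2 j + S.1.1 j - 1

open Classical in
/-- The potential of a bin of level `ℓ` with deviation `d`. -/
noncomputable def pot (ℓ : ℕ) (d : ℝ) : ℝ :=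
  if 1 ≤ ℓ ∧ ℓ ≤ D.top then (d ^ 2 + (D.top + 1 - ℓ)) / (D.tol : ℝ) ^ 2 else 0

lemma pot_nonneg (ℓ : ℕ) (d : ℝ) : 0 ≤ D.pot ℓ d := by
  rw [pot]
  split_ifs with h
  · have : (ℓ : ℝ) ≤ D.top := by exact_mod_cast h.2
    have : (0 : ℝ) ≤ D.top + 1 - ℓ := by linarith
    positivity
  · exact le_rfl

lemma pot_zero (d : ℝ) : D.pot 0 d = 0 := by simp [pot]

/-- What the controller knows about the bin into which item `i` is packed. -/
structure Chosen (x : Fin D.items → ℝ≥0) (i : Fin D.items) (S : Config D.items)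
    (lev : Fin D.items → ℕ) (s : ℕ) (j : Fin D.items) (L : ℕ) : Prop where
  code : ∀ m, s + D.wt m = ∑ l, D.wt (Function.update lev j m l)
  later : ∀ l : Fin D.items, (i : ℕ) + 1 ≤ l → lev l = 0 ∧ l ≠ j
  other : ∀ l, l ≠ j → lev l = S.1.1 l ∨ (S.1.1 l ≠ 0 ∧ lev l = D.top + 1)
  one_le : 1 ≤ L
  le_top : L ≤ D.top
  dev_le : S.2 j ≤ D.tol
  usage : (D.res : ℝ) * D.policy.usage x i j ≤ S.2 j + L - 1
  cost : (insert j (D.policy.openedBy x i)).card + D.pack (D.value (i + 1)) i L s +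
      (∑ l ∈ Finset.univ.erase j, D.pot (lev l) (S.2 l) + D.pot L (S.2 j)) ≤
    (D.policy.openedBy x i).card + D.value i S.1.2 + ∑ l, D.pot (S.1.1 l) (S.2 l)

variable {D}

lemma sum_wt_retire (lev : Fin D.items → ℕ) (j : Fin D.items) :
    ∑ l, D.wt (lev l) - D.wt (lev j) = ∑ l, D.wt (Function.update lev j (D.top + 1) l) := by
  rw [sum_weight_update D.wt D.wt_zero lev j (D.top + 1)]
  have h := sum_weight_update D.wt D.wt_zero lev j (lev j)
  rw [Function.update_eq_self] at h
  rw [h, Nat.add_sub_cancel, show D.wt (D.top + 1) = 0 from weight_of_lt (by omega), add_zero]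

/-- There are three cases. A new bin starts with potential `top / q²`, which is the surcharge in
`price`. A bin of the target level within the tolerance is simply used. Otherwise that bin is
retired, and the fresh bin `i` inherits its level with deviation `0`. -/
lemma Tracks.chosen {x : Fin D.items → ℝ≥0} {i : Fin D.items} {S : Config D.items}
    (h : D.Tracks x i S) (hq : 0 < D.tol) :
    D.Chosen x i S (D.controller.levels i S) (D.controller.rest i S) (D.controller.bin i S)
      (D.controller.level i S) := by
  have hq' : (0 : ℝ) < D.tol := by exact_mod_cast hq
  have hspec := D.act_spec i.2 (ι := Fin D.items) (by simp [base]; omega) S.1.1 h.code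
  -- The search can fall back to bin `i` only for target `0`, since a positive level in use belongs
  -- to some bin `j < i`; bin `i` itself is unopened and has level `0`.
  have hfound : S.1.1 (D.controller.found i S) = D.act i S.1.2 := by
    rcases search_spec S.1.1 (D.controller.target i S) i i with h1 | ⟨h1, h2⟩
    · exact h1
    · rcases hspec with ⟨h3, _⟩ | ⟨h3, _, ⟨j, hj⟩, _⟩
      · rw [Controller.found, h1, h.later i le_rfl, h3]
      · exfalso
        refine h2 j ?_ hj
        by_contra hji
        have := h.later j (not_lt.1 hji)
        omega
  set j := D.controller.found i S with hj
  have hji : (j : ℕ) ≤ i := by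
    by_contra hlt
    have h1 : j ≠ i := fun e => hlt (by rw [e])
    have h2 : ∀ m : ℕ, m ≤ i → (search S.1.1 (D.controller.target i S) i m : ℕ) ≤ i := by
      intro m hm
      induction m with
      | zero => exact le_rfl
      | succ m ih =>
        rw [search]
        split_ifs
        · exact (Nat.lt_of_succ_le hm).le
        · exact ih (by omega)
        · exact ih (by omega)
    exact hlt (h2 i le_rfl)
  have htop : 2 ≤ D.top := by
    rw [top]
    omega
  -- The level `top + 1` has weight `0`, so removing the bin from the encoding and retiring it have
  -- the same effect.
  have hrest : D.controller.rest i S = ∑ l, D.wt (Function.update S.1.1 j (D.top + 1) l) := by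
    rw [← sum_wt_retire, hfound, ← h.code]
    rfl
  have hcode : ∀ m, D.controller.rest i S + D.wt m = ∑ l, D.wt (Function.update S.1.1 j m l) := by
    intro m
    rw [hrest, sum_weight_update D.wt D.wt_zero S.1.1 j m,
      sum_weight_update D.wt D.wt_zero S.1.1 j (D.top + 1),
      show D.wt (D.top + 1) = 0 from weight_of_lt (by omega), add_zero]
  by_cases hd : S.2 j ≤ D.tol
  · have hb : D.controller.bin i S = j := if_pos hd
    have hlv : D.controller.levels i S = S.1.1 := if_pos hd
    rw [hb, hlv]
    rcases hspec with ⟨h0, hv⟩ | ⟨h1, h2, _, hv⟩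
    · have hL : D.controller.level i S = 1 := by
        rw [Controller.level, Controller.target, show D.controller.act = D.act from rfl, h0]
      have hs : D.controller.rest i S = S.1.2 := by
        rw [Controller.rest, Controller.target, show D.controller.act = D.act from rfl, h0,
          show D.controller.wt = D.wt from rfl, wt_zero, Nat.sub_zero]
      rw [hL]
      have hj0 : S.1.1 j = 0 := hfound.trans h0
      obtain ⟨hz1, hz2⟩ := h.zero j hj0
      refine ⟨hcode, fun l hl => ⟨h.later l (by omega), by rintro rfl; omega⟩,
        fun l _ => .inl rfl, le_rfl, by omega, hd, ?_, ?_⟩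
      · rw [D.policy.usage_eq_zero hz2, hz1]
        simp
      · rw [Finset.card_insert_of_notMem hz2, hv, hs, ← Finset.add_sum_erase _
          (fun l => D.pot (S.1.1 l) (S.2 l)) (Finset.mem_univ j), hj0, pot_zero, hz1, pot,
          if_pos ⟨le_rfl, by omega⟩, price]
        push_cast
        apply le_of_eq
        ring
    · have hL : D.controller.level i S = S.1.1 j := by
        rw [hfound, Controller.level, Controller.target, show D.controller.act = D.act from rfl]
        omega
      rw [hL]
      rw [← hfound] at h1 h2 hv
      have ho := h.pos j (by omega)
      refine ⟨hcode, fun l hl => ⟨h.later l (by omega), by rintro rfl; omega⟩,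
        fun l _ => .inl rfl, h1, h2, hd, h.usage j h1 h2, ?_⟩
      rw [Finset.insert_eq_of_mem ho, hv, ← Finset.add_sum_erase _
          (fun l => D.pot (S.1.1 l) (S.2 l)) (Finset.mem_univ j), hfound]
      apply le_of_eq
      rw [Controller.rest, Controller.target, show D.controller.act = D.act from rfl,
        show D.controller.wt = D.wt from rfl]
      ring
  · have hb : D.controller.bin i S = i := if_neg hd
    have hlv : D.controller.levels i S = Function.update S.1.1 j (D.top + 1) := if_neg hd
    rw [hb, hlv]
    have hj0 : S.1.1 j ≠ 0 := by
      intro h0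
      rw [(h.zero j h0).1] at hd
      exact hd hq'.le
    have hne : j ≠ i := fun e => hj0 (h.later j (by rw [e]))
    rcases hspec with ⟨h0, _⟩ | ⟨h1, h2, _, hv⟩
    · exact absurd (hfound.trans h0) hj0
    have hL : D.controller.level i S = S.1.1 j := by
      rw [hfound, Controller.level, Controller.target, show D.controller.act = D.act from rfl]
      omega
    rw [hL]
    rw [← hfound] at h1 h2 hv
    obtain ⟨hz1, hz2⟩ := h.zero i (h.later i le_rfl)
    have hi0 : Function.update S.1.1 j (D.top + 1) i = 0 := by
      rw [Function.update_of_ne hne.symm, h.later i le_rfl]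
    refine ⟨fun m => ?_, fun l hl => ⟨?_, by rintro rfl; omega⟩, fun l _ => ?_, h1, h2,
      ?_, ?_, ?_⟩
    · have e : Function.update (Function.update S.1.1 j (D.top + 1)) i 0 =
          Function.update S.1.1 j (D.top + 1) := by
        rw [← hi0, Function.update_eq_self]
      rw [hrest, sum_weight_update D.wt D.wt_zero _ i m, e]
    · rw [Function.update_of_ne (by rintro rfl; omega)]
      exact h.later l (by omega)
    · by_cases hl : l = j
      · subst hl
        exact .inr ⟨hj0, Function.update_self _ _ _⟩
      · exact .inl (Function.update_of_ne hl _ _)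
    · rw [hz1]
      exact hq'.le
    · rw [D.policy.usage_eq_zero hz2, hz1]
      have : (1 : ℝ) ≤ S.1.1 j := by exact_mod_cast h1
      simp
      linarith
    · rw [Finset.card_insert_of_notMem hz2, hv, hz1]
      have hjm : j ∈ Finset.univ.erase i := Finset.mem_erase.2 ⟨hne, Finset.mem_univ j⟩
      rw [← Finset.add_sum_erase _ (fun l => D.pot (S.1.1 l) (S.2 l)) (Finset.mem_univ i),
        ← Finset.add_sum_erase _ (fun l => D.pot (S.1.1 l) (S.2 l)) hjm,
        ← Finset.add_sum_erase _ _ hjm, h.later i le_rfl, pot_zero]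
      have e : ∑ l ∈ (Finset.univ.erase i).erase j,
          D.pot (Function.update S.1.1 j (D.top + 1) l) (S.2 l) =
          ∑ l ∈ (Finset.univ.erase i).erase j, D.pot (S.1.1 l) (S.2 l) := by
        refine Finset.sum_congr rfl fun l hl => ?_
        rw [Function.update_of_ne (Finset.ne_of_mem_erase hl)]
      rw [e, Function.update_self, pot, if_neg (by omega), pot, if_pos ⟨h1, h2⟩, pot,
        if_pos ⟨h1, h2⟩]
      have e2 : D.pack (D.value (i + 1)) i (S.1.1 j) (D.controller.rest i S) =
          D.pack (D.value (i + 1)) i (S.1.1 j) (S.1.2 - D.wt (S.1.1 j)) := by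
        rw [hfound, Controller.rest, Controller.target,
          show D.controller.act = D.act from rfl, show D.controller.wt = D.wt from rfl]
      -- The deviation exceeds `q`, so the square that is given up pays the unit cost of the fresh
      -- bin.
      have e3 : 1 + (0 ^ 2 + ((D.top : ℝ) + 1 - S.1.1 j)) / (D.tol : ℝ) ^ 2 ≤
          (S.2 j ^ 2 + ((D.top : ℝ) + 1 - S.1.1 j)) / (D.tol : ℝ) ^ 2 := by
        rw [← sub_nonneg, show (S.2 j ^ 2 + ((D.top : ℝ) + 1 - S.1.1 j)) / (D.tol : ℝ) ^ 2 -
          (1 + (0 ^ 2 + ((D.top : ℝ) + 1 - S.1.1 j)) / (D.tol : ℝ) ^ 2) =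
          (S.2 j ^ 2 - (D.tol : ℝ) ^ 2) / (D.tol : ℝ) ^ 2 by field_simp; ring]
        apply div_nonneg _ (by positivity)
        rw [not_le] at hd
        nlinarith
      rw [e2]
      push_cast
      linarith

end Instance
end BinPacking

namespace BinPacking
open Controller (extend)
namespace Instance
variable {D : Instance}

/-- The deviation absorbs the rounding error exactly: level plus deviation minus `N` times the usage
of the chosen bin does not change. -/
lemma Tracks.step {x : Fin D.items → ℝ≥0} {i : Fin D.items} {S : Config D.items}
    (h : D.Tracks x i S) (hS : S = D.configAt x i) (hq : 0 < D.tol) (y : ℝ≥0) :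
    D.Tracks (Function.update x i y) (i + 1) (D.controller.step i S y) := by
  obtain ⟨hcode, hlater, hother, h1, h2, hdev, husage, -⟩ := h.chosen hq
  have hbin : D.policy.bin x i = D.controller.bin i S := by rw [hS, D.policy_bin]
  rw [Controller.step, Controller.settle]
  set m := D.controller.round (i + 1) (D.controller.level i S) (D.controller.rest i S)
    (S.2 (D.controller.bin i S)) y
  set j := D.controller.bin i S
  set L := D.controller.level i S
  constructor
  · exact hcode _
  · intro l hl
    obtain ⟨h3, h4⟩ := hlater l hl
    dsimp only
    rw [Function.update_of_ne h4, h3]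
  · intro l hl
    dsimp only at hl ⊢
    have hlj : l ≠ j := by
      rintro rfl
      rw [Function.update_self] at hl
      omega
    rw [Function.update_of_ne hlj] at hl ⊢
    rw [D.policy.openedBy_update, Finset.mem_insert, not_or, hbin]
    have h0 : S.1.1 l = 0 := by
      rcases hother l hlj with h3 | ⟨_, h3⟩ <;> omega
    exact ⟨(h.zero l h0).1, hlj, (h.zero l h0).2⟩
  · intro l hl
    dsimp only at hl
    rw [D.policy.openedBy_update, Finset.mem_insert, hbin]
    by_cases hlj : l = j
    · exact .inl hlj
    · rw [Function.update_of_ne hlj] at hl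
      right
      apply h.pos
      rcases hother l hlj with h3 | ⟨h3, _⟩ <;> omega
  · intro l hl1 hl2
    dsimp only at hl1 hl2 ⊢
    rw [D.policy.usage_update, hbin]
    by_cases hlj : l = j
    · subst hlj
      rw [Function.update_self, Function.update_self, if_pos rfl]
      push_cast
      rw [show (D.controller.res : ℝ) = D.res from rfl]
      linarith
    · rw [Function.update_of_ne hlj] at hl1 hl2 ⊢
      rw [Function.update_of_ne hlj, if_neg (Ne.symm hlj), add_zero]
      rcases hother l hlj with h3 | ⟨_, h3⟩
      · rw [h3] at hl1 hl2 ⊢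
        exact h.usage l hl1 hl2
      · omega

lemma tracks (hq : 0 < D.tol) (x : Fin D.items → ℝ≥0) (i : ℕ) (hi : i ≤ D.items) :
    D.Tracks x i (D.configAt x i) := by
  induction i with
  | zero =>
    constructor
    · simp [configAt, Controller.config, wt_zero]
    · intro j _
      rfl
    · intro j _
      exact ⟨rfl, by simp [D.policy.openedBy_zero]⟩
    · intro j hj
      exact absurd rfl hj
    · intro j hj
      simp [configAt, Controller.config] at hj
  | succ i ih =>
    have h := (ih (by omega)).step (i := ⟨i, hi⟩) rfl hq (x ⟨i, hi⟩)
    rw [Function.update_eq_self] at h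
    have e := D.controller.config_update x ⟨i, hi⟩ (x ⟨i, hi⟩)
    rw [Function.update_eq_self] at e
    rw [configAt, e]
    exact h

variable (D) in
/-- The policy is feasible for bins whose capacity leaves room for the deviations. -/
lemma policy_feasible (hN : 0 < D.res) (hq : 0 < D.tol) {c : ℝ}
    (hc : (D.top : ℝ) + D.tol ≤ D.res * c) : D.policy.Feasible c := by
  intro x i
  obtain ⟨-, -, -, h1, h2, hdev, husage, -⟩ := (tracks hq x i i.2.le).chosen hq
  rw [D.policy_bin]
  have h2' : (D.controller.level i (D.configAt x i) : ℝ) ≤ D.top := by exact_mod_cast h2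
  have hN' : (0 : ℝ) < D.res := by exact_mod_cast hN
  refine le_of_mul_le_mul_left ?_ hN'
  linarith

/-- The cost of packing an item of size `y` by the controller. -/
lemma Tracks.cost_le {x : Fin D.items → ℝ≥0} {i : Fin D.items} {S : Config D.items}
    (h : D.Tracks x i S) (hq : 0 < D.tol) {c : ℝ} (hC : 0 ≤ D.penalty)
    (hc : (D.top : ℝ) + D.tol ≤ D.res * c) (y : ℝ≥0) {j : Fin D.items} {s L m : ℕ}
    (hj : j = D.controller.bin i S)
    (hL : L = D.controller.level i S)
    (hm : m = D.controller.round (i + 1) L s (S.2 j) y) :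
    D.penalty * (if c < D.policy.usage x i j + (y : ℝ) then 1 else 0) +
      D.value (i + 1) (s + D.wt (L + m)) + D.pot (L + m) (S.2 j + D.res * y - m) ≤
    interp (D.after (D.value (i + 1)) L s) (D.res * y) + D.pot L (S.2 j) := by
  obtain ⟨-, -, -, h1, h2, hdev, husage, -⟩ := h.chosen hq
  rw [← hj, ← hL] at *
  have hq' : (0 : ℝ) < D.tol := by exact_mod_cast hq
  have ht : (0 : ℝ) ≤ D.res * y := by positivity
  have hfl := Nat.floor_le ht
  have hfl2 := Nat.lt_floor_add_one (D.res * y : ℝ)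
  have hKf : D.controller.floor y = min ⌊(D.res * y : ℝ)⌋₊ D.top := rfl
  have hmf : m = D.controller.floor y ∨ m = D.controller.floor y + 1 := by
    rw [hm, Controller.round]
    split_ifs
    · exact .inl rfl
    · exact .inr rfl
  by_cases hbig : D.top < L + ⌊(D.res * y : ℝ)⌋₊
  · have hLm : D.top < L + m := by omega
    have ha : ∀ k, ⌊(D.res * y : ℝ)⌋₊ ≤ k →
        D.after (D.value (i + 1)) L s k = D.penalty + D.value (i + 1) s :=
      fun k hk => by rw [after, if_neg (by omega)]
    have h3 := le_interp_of (g := D.after (D.value (i + 1)) L s)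
      (c := D.penalty + D.value (i + 1) s) ht (ha _ le_rfl).ge (ha _ (Nat.le_succ _)).ge
    have h4 := D.pot_nonneg L (S.2 j)
    have h5 : D.penalty * (if c < D.policy.usage x i j + (y : ℝ) then 1 else 0) ≤ D.penalty := by
      split_ifs <;> simp [hC]
    have h6 : D.pot (L + m) (S.2 j + D.res * y - m) = 0 := by rw [pot, if_neg (by omega)]
    rw [wt, weight_of_lt hLm, add_zero, h6]
    linarith
  · rw [not_lt] at hbig
    have hKf' : D.controller.floor y = ⌊(D.res * y : ℝ)⌋₊ := by
      rw [hKf]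
      omega
    rw [hKf'] at hmf
    have hbr : D.penalty * (if c < D.policy.usage x i j + (y : ℝ) then 1 else 0) ≤
        if L + m ≤ D.top then 0 else D.penalty := by
      -- If the level stays in range, the real bin is intact: `N (u + y) ≤ (q + L - 1) + (m + 1) ≤
      -- top + q ≤ N c`.
      by_cases hLm : L + m ≤ D.top
      · rw [if_pos hLm, if_neg, mul_zero]
        rw [not_lt]
        have hN' : (0 : ℝ) < D.res := by
          rcases Nat.eq_zero_or_pos D.res with h0 | h0
          · exfalso
            rw [h0] at hc
            have : (0 : ℝ) ≤ D.top := Nat.cast_nonneg _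
            push_cast at hc
            linarith
          · exact_mod_cast h0
        refine le_of_mul_le_mul_left ?_ hN'
        have h3 : (L : ℝ) + m ≤ D.top := by exact_mod_cast hLm
        have h4 : (⌊(D.res * y : ℝ)⌋₊ : ℝ) ≤ m := by
          have : ⌊(D.res * y : ℝ)⌋₊ ≤ m := by omega
          exact_mod_cast this
        linarith
      · rw [if_neg hLm]
        split_ifs <;> simp [hC]
    -- Future cost plus potential if the size is rounded to `k`. The sign of the deviation is
    -- opposite to that in the lower bound, hence `-S.2 j`.
    set F : ℕ → ℝ := fun k => 1 * D.after (D.value (i + 1)) L s k +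
      1 * (((-S.2 j + (k - D.res * y)) ^ 2 + (D.top + 1 - L - k)) / (D.tol : ℝ) ^ 2) with hF
    have hafter : ∀ k, D.after (D.value (i + 1)) L s k =
        D.controller.estimate (i + 1) L s k := by
      intro k
      rw [after, Controller.estimate]
      by_cases hk : L + k ≤ D.top
      · rw [if_pos hk, if_pos (show L + k ≤ D.controller.top from hk), add_zero]
        rfl
      · rw [if_neg hk, if_neg (show ¬ L + k ≤ D.controller.top from hk),
          show D.controller.wt (L + k) = 0 from weight_of_lt (by omega), add_zero, add_comm]
        rfl
    -- The slack `1` in the potential keeps its linear part nonnegative even when rounding up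
    -- overshoots the top level by one.
    have hL' : (L : ℝ) + m ≤ D.top + 1 := by
      have : L + m ≤ D.top + 1 := by omega
      exact_mod_cast this
    have hLHS : D.penalty * (if c < D.policy.usage x i j + (y : ℝ) then 1 else 0) +
        D.value (i + 1) (s + D.wt (L + m)) + D.pot (L + m) (S.2 j + D.res * y - m) ≤ F m := by
      have h3 : D.pot (L + m) (S.2 j + D.res * y - m) ≤
          ((-S.2 j + (m - D.res * y)) ^ 2 + (D.top + 1 - L - m)) / (D.tol : ℝ) ^ 2 := by
        rw [pot]
        split_ifs with hh
        · apply le_of_eq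
          push_cast
          ring
        · have : (0 : ℝ) ≤ D.top + 1 - L - m := by linarith
          positivity
      have h4 : D.after (D.value (i + 1)) L s m = D.value (i + 1) (s + D.wt (L + m)) +
          if L + m ≤ D.top then 0 else D.penalty := hafter m
      simp only [hF, h4]
      linarith
    -- Derandomization: the minimum of `F` over the two neighbours is at most its average. The `- 1`
    -- in `Down` is the change of the linear part of the potential.
    have hmin : F m ≤ F ⌊(D.res * y : ℝ)⌋₊ ∧ F m ≤ F (⌊(D.res * y : ℝ)⌋₊ + 1) := by
      have hiff : D.controller.Down (i + 1) L s (S.2 j) y ↔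
          F ⌊(D.res * y : ℝ)⌋₊ ≤ F (⌊(D.res * y : ℝ)⌋₊ + 1) := by
        rw [Controller.Down, hKf', hF]
        dsimp only
        rw [hafter, hafter, show (D.controller.res : ℝ) = D.res from rfl,
          show (D.controller.tol : ℝ) = D.tol from rfl, ← sub_nonneg, ← sub_nonneg (b := _ + _)]
        apply iff_of_eq
        congr 1
        push_cast
        ring
      rw [Controller.round] at hm
      split_ifs at hm with hdn
      · rw [hm, hKf']
        exact ⟨le_rfl, hiff.1 hdn⟩
      · rw [hm, hKf']
        rw [hiff, not_le] at hdn
        exact ⟨hdn.le, le_rfl⟩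
    have h5 := le_interp_of (g := F) ht hmin.1 hmin.2
    have h6 : interp F (D.res * y) ≤ interp (D.after (D.value (i + 1)) L s) (D.res * y) +
        D.pot L (S.2 j) := by
      rw [hF, interp_lin, one_mul, one_mul]
      -- Rounding preserves the mean, so the linear part falls by exactly `N y` on average,
      -- compensating the growth of the square.
      have e : interp (fun k : ℕ => ((-S.2 j + (k - D.res * y)) ^ 2 + (D.top + 1 - L - k)) /
          (D.tol : ℝ) ^ 2) (D.res * y) =
          (interp (fun k : ℕ => (-S.2 j + (k - D.res * y)) ^ 2) (D.res * y) +
            (D.top + 1 - L - D.res * y)) / (D.tol : ℝ) ^ 2 := by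
        have h7 := interp_cast (D.res * y : ℝ)
        simp only [interp] at h7 ⊢
        push_cast at h7 ⊢
        ring
      rw [e, pot, if_pos ⟨h1, h2⟩]
      have h8 := interp_sq (-S.2 j) (D.res * y) ht
      rw [neg_sq] at h8
      refine add_le_add le_rfl (div_le_div_of_nonneg_right ?_ (sq_nonneg _))
      linarith
    linarith

/-- The counterpart of `imitates`: cost so far, `value` and potential together dominate the
conditional cost, by backward induction with `Tracks.chosen` before and `Tracks.cost_le` after the
size is revealed. -/
theorem condCost_policy_le (μ : Fin D.items → Measure ℝ≥0) [∀ i, IsProbabilityMeasure (μ i)]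
    (hO : D.oracle = Oracle.ofLaws μ) (hN : 0 < D.res) (hq : 0 < D.tol) {C : ℝ≥0}
    (hC : D.penalty = C) {c : ℝ} (hc : (D.top : ℝ) + D.tol ≤ D.res * c) (r : ℕ)
    (hr : r ≤ D.items) (x : Fin D.items → ℝ≥0) :
    D.policy.condCost μ C c (D.items - r) x ≤
      ENNReal.ofReal ((D.policy.openedBy x (D.items - r)).card +
        C * (D.policy.brokenBy c x (D.items - r)).card +
        D.value (D.items - r) (D.configAt x (D.items - r)).1.2 +
        ∑ l, D.pot ((D.configAt x (D.items - r)).1.1 l) ((D.configAt x (D.items - r)).2 l)) := by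
  have hC0 : 0 ≤ D.penalty := by rw [hC]; exact C.2
  have hfeas := D.policy_feasible hN hq hc
  induction r generalizing x with
  | zero =>
    rw [Nat.sub_zero, value_last, add_zero, Policy.condCost_last,
      ENNReal.ofReal_add (by positivity) (Finset.sum_nonneg fun l _ => D.pot_nonneg _ _),
      ENNReal.ofReal_add (by positivity) (by positivity), ENNReal.ofReal_mul (NNReal.coe_nonneg C)]
    refine le_add_right (le_of_eq ?_)
    simp
  | succ r ih =>
    obtain ⟨i, hi⟩ : ∃ i : Fin D.items, (i : ℕ) = D.items - (r + 1) := ⟨⟨_, by omega⟩, rfl⟩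
    have hi' : D.items - r = i + 1 := by omega
    rw [← hi]
    rw [hi'] at ih
    have htr := tracks hq x i i.2.le
    set S := D.configAt x i with hS
    obtain ⟨-, -, -, h1, h2, -, -, hcost⟩ := htr.chosen hq
    have hbin : D.policy.bin x i = D.controller.bin i S := D.policy_bin x i
    set j := D.controller.bin i S with hj
    set L := D.controller.level i S with hL
    set s := D.controller.rest i S with hs
    obtain ⟨hint, hpack⟩ := D.integral_after μ hO hN i (D.value (i + 1)) L s
    set A : ℝ := (insert j (D.policy.openedBy x i)).card + C * (D.policy.brokenBy c x i).card +
      (∑ l ∈ Finset.univ.erase j, D.pot (D.controller.levels i S l) (S.2 l) + D.pot L (S.2 j))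
      with hA
    have hA0 : 0 ≤ A := by
      have := D.pot_nonneg L (S.2 j)
      have : 0 ≤ ∑ l ∈ Finset.univ.erase j, D.pot (D.controller.levels i S l) (S.2 l) :=
        Finset.sum_nonneg fun l _ => D.pot_nonneg _ _
      positivity
    have hpt : ∀ y, D.policy.condCost μ C c (i + 1) (Function.update x i y) ≤
        ENNReal.ofReal (interp (D.after (D.value (i + 1)) L s) (D.res * y) + A) := by
      intro y
      refine (ih (by omega) _).trans (ENNReal.ofReal_le_ofReal ?_)
      have e : D.configAt (Function.update x i y) (i + 1) = D.controller.step i S y :=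
        D.controller.config_update x i y
      have hcl := htr.cost_le (s := s) hq hC0 hc y hj hL rfl
      rw [e, D.policy.openedBy_update, D.policy.card_brokenBy_update x i y (hfeas x i), hbin,
        Controller.step, Controller.settle, ← hj, ← hL, ← hs]
      set m := D.controller.round (i + 1) L s (S.2 j) y
      dsimp only
      rw [← Finset.add_sum_erase _ _ (Finset.mem_univ j), Function.update_self,
        Function.update_self]
      have e2 : ∑ l ∈ Finset.univ.erase j,
          D.pot (Function.update (D.controller.levels i S) j (L + m) l)
            (Function.update S.2 j (S.2 j + D.controller.res * y - m) l) =
          ∑ l ∈ Finset.univ.erase j, D.pot (D.controller.levels i S l) (S.2 l) := by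
        refine Finset.sum_congr rfl fun l hl => ?_
        rw [Function.update_of_ne (Finset.ne_of_mem_erase hl),
          Function.update_of_ne (Finset.ne_of_mem_erase hl)]
      rw [e2, hA, show (D.controller.res : ℝ) = D.res from rfl,
        show D.controller.wt = D.wt from rfl, ← hC]
      push_cast
      linarith
    calc D.policy.condCost μ C c i x
        = ∫⁻ y, D.policy.condCost μ C c (i + 1) (Function.update x i y) ∂(μ i) :=
          D.policy.condCost_step μ C c i x
      _ ≤ ∫⁻ y, ENNReal.ofReal (interp (D.after (D.value (i + 1)) L s) (D.res * y) + A) ∂(μ i) :=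
          lintegral_mono hpt
      _ = ENNReal.ofReal (∫ y, (interp (D.after (D.value (i + 1)) L s) (D.res * y) + A) ∂(μ i)) := by
          refine (ofReal_integral_eq_lintegral_ofReal (hint.add (integrable_const _))
            (Filter.Eventually.of_forall fun y => ?_)).symm
          refine add_nonneg (interp_nonneg (D.after_nonneg ?_ hC0 _ _) (by positivity)) hA0
          exact fun s => D.value_nonneg μ hO hN hC0 _ s
      _ = ENNReal.ofReal (D.pack (D.value (i + 1)) i L s + A) := by
          rw [integral_add hint (integrable_const _), hpack]
          simp
      _ ≤ _ := by
          apply ENNReal.ofReal_le_ofReal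
          rw [hA]
          linarith

variable (D) in
/-- The policy costs at most the value of the dynamic program. -/
theorem cost_policy_le (μ : Fin D.items → Measure ℝ≥0) [∀ i, IsProbabilityMeasure (μ i)]
    (hO : D.oracle = Oracle.ofLaws μ) (hN : 0 < D.res) (hq : 0 < D.tol) {C : ℝ≥0}
    (hC : D.penalty = C) {c : ℝ} (hc : (D.top : ℝ) + D.tol ≤ D.res * c) :
    D.policy.cost μ C c ≤ ENNReal.ofReal (D.value 0 0) := by
  have hc0 : 0 ≤ c := by
    have hN' : (0 : ℝ) < D.res := by exact_mod_cast hN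
    have : (0 : ℝ) ≤ D.res * c := le_trans (by positivity) hc
    exact nonneg_of_mul_nonneg_right this hN'
  have h := condCost_policy_le μ hO hN hq hC hc D.items le_rfl 0
  rw [Nat.sub_self, Policy.condCost_zero, Policy.openedBy_zero, Policy.brokenBy_zero _ hc0] at h
  refine h.trans_eq ?_
  simp [configAt, Controller.config, pot_zero]

end Instance
end BinPacking

namespace BinPacking

/-! ## Reasoning about programs -/

instance : Add NatExp := ⟨.add⟩
instance : Sub NatExp := ⟨.sub⟩
instance : Add RealExp := ⟨.add⟩
instance : Sub RealExp := ⟨.sub⟩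
instance : Mul RealExp := ⟨.mul⟩
instance : Div RealExp := ⟨.div⟩

/-- The natural number cell with address `a`. -/
def reg (a : ℕ) : NatExp := .cell (.lit a)

/-- The real cell with address `a`. -/
def rreg (a : ℕ) : RealExp := .cell (.lit a)

namespace NatExp
variable (σ : Mem) (a b : NatExp) (k : ℕ)

@[simp] lemma eval_lit : (lit k).eval σ = k := rfl
@[simp] lemma eval_cell : (cell a).eval σ = σ.nat (a.eval σ) := rfl
@[simp] lemma eval_add : (a + b).eval σ = a.eval σ + b.eval σ := rfl
@[simp] lemma eval_sub : (a - b).eval σ = a.eval σ - b.eval σ := rfl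
@[simp] lemma eval_reg : (reg k).eval σ = σ.nat k := rfl
@[simp] lemma time_lit : (lit k).time = 1 := rfl
@[simp] lemma time_cell : (cell a).time = a.time + 1 := rfl
@[simp] lemma time_add : (a + b).time = a.time + b.time + 1 := rfl
@[simp] lemma time_sub : (a - b).time = a.time + b.time + 1 := rfl
@[simp] lemma time_reg : (reg k).time = 2 := rfl

end NatExp

namespace RealExp
variable (σ : Mem) (a b : RealExp) (c : NatExp) (k : ℕ)

@[simp] lemma eval_lit : (lit k).eval σ = k := rfl
@[simp] lemma eval_cell : (cell c).eval σ = σ.real (c.eval σ) := rfl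
@[simp] lemma eval_add : (a + b).eval σ = a.eval σ + b.eval σ := rfl
@[simp] lemma eval_sub : (a - b).eval σ = a.eval σ - b.eval σ := rfl
@[simp] lemma eval_mul : (a * b).eval σ = a.eval σ * b.eval σ := rfl
@[simp] lemma eval_div : (a / b).eval σ = a.eval σ / b.eval σ := rfl
@[simp] lemma eval_rreg : (rreg k).eval σ = σ.real k := rfl
@[simp] lemma time_lit : (lit k).time = 1 := rfl
@[simp] lemma time_cell : (cell c).time = c.time + 1 := rfl
@[simp] lemma time_add : (a + b).time = a.time + b.time + 1 := rfl
@[simp] lemma time_sub : (a - b).time = a.time + b.time + 1 := rfl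
@[simp] lemma time_mul : (a * b).time = a.time + b.time + 1 := rfl
@[simp] lemma time_div : (a / b).time = a.time + b.time + 1 := rfl
@[simp] lemma time_rreg : (rreg k).time = 2 := rfl

end RealExp

namespace Test
variable (σ : Mem)

@[simp] lemma holds_natLe (a b : NatExp) : (natLe a b).Holds σ ↔ a.eval σ ≤ b.eval σ := Iff.rfl
@[simp] lemma holds_realLe (a b : RealExp) : (realLe a b).Holds σ ↔ a.eval σ ≤ b.eval σ := Iff.rfl
@[simp] lemma time_natLe (a b : NatExp) : (natLe a b).time = a.time + b.time + 1 := rfl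
@[simp] lemma time_realLe (a b : RealExp) : (realLe a b).time = a.time + b.time + 1 := rfl

end Test

namespace Mem
variable (σ : Mem) (a b v : ℕ) (w : ℝ)

/-- Store `v` in the natural number cell `a`. -/
def setN : Mem := { σ with nat := Function.update σ.nat a v }

/-- Store `w` in the real cell `a`. -/
noncomputable def setR : Mem := { σ with real := Function.update σ.real a w }

@[simp] lemma setN_nat : (σ.setN a v).nat b = if b = a then v else σ.nat b :=
  Function.update_apply _ _ _ _
@[simp] lemma setN_real : (σ.setN a v).real = σ.real := rfl
@[simp] lemma setR_real : (σ.setR a w).real b = if b = a then w else σ.real b :=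
  Function.update_apply _ _ _ _
@[simp] lemma setR_nat : (σ.setR a w).nat = σ.nat := rfl

end Mem

/-- Started with memory `σ`, the program `p` stops within `T` time units with a memory that
satisfies `Q`. -/
def Run (O : Oracle) (p : Program) (σ : Mem) (T : ℕ) (Q : Mem → Prop) : Prop :=
  ∃ t τ, Exec O p σ t τ ∧ t ≤ T ∧ Q τ

namespace Run
variable {O : Oracle} {σ : Mem} {Q Q' : Mem → Prop} {T T' : ℕ} {p q : Program} {b : Test}

lemma mono (h : Run O p σ T Q) (hT : T ≤ T') (hQ : ∀ τ, Q τ → Q' τ) : Run O p σ T' Q' := by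
  obtain ⟨t, τ, h1, h2, h3⟩ := h
  exact ⟨t, τ, h1, h2.trans hT, hQ _ h3⟩

lemma skip (h : Q σ) : Run O .skip σ 1 Q := ⟨_, _, .skip σ, le_rfl, h⟩

lemma setNat {a e : NatExp} (h : Q (σ.setN (a.eval σ) (e.eval σ))) :
    Run O (.setNat a e) σ (a.time + e.time + 1) Q := ⟨_, _, .setNat σ a e, le_rfl, h⟩

lemma setReal {a : NatExp} {e : RealExp} (h : Q (σ.setR (a.eval σ) (e.eval σ))) :
    Run O (.setReal a e) σ (a.time + e.time + 1) Q := ⟨_, _, .setReal σ a e, le_rfl, h⟩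

lemma askCdf {a i : NatExp} {y : RealExp} (h : Q (σ.setR (a.eval σ) (O.cdf (i.eval σ) (y.eval σ)))) :
    Run O (.askCdf a i y) σ (a.time + i.time + y.time + 1) Q :=
  ⟨_, _, .askCdf σ a i y, le_rfl, h⟩

lemma askPartialMean {a i : NatExp} {y : RealExp}
    (h : Q (σ.setR (a.eval σ) (O.partialMean (i.eval σ) (y.eval σ)))) :
    Run O (.askPartialMean a i y) σ (a.time + i.time + y.time + 1) Q :=
  ⟨_, _, .askPartialMean σ a i y, le_rfl, h⟩

lemma seq (h : Run O p σ T (fun τ => Run O q τ T' Q)) : Run O (.seq p q) σ (T + T') Q := by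
  obtain ⟨t, τ, h1, h2, t', τ', h3, h4, h5⟩ := h
  exact ⟨_, _, .seq h1 h3, by omega, h5⟩

lemma cond (h : b.Holds σ → Run O p σ T Q) (h' : ¬ b.Holds σ → Run O q σ T' Q) :
    Run O (.cond b p q) σ (b.time + (T + T')) Q := by
  by_cases hb : b.Holds σ
  · obtain ⟨t, τ, h1, h2, h3⟩ := h hb
    exact ⟨_, _, .cond_true hb h1, by omega, h3⟩
  · obtain ⟨t, τ, h1, h2, h3⟩ := h' hb
    exact ⟨_, _, .cond_false hb h1, by omega, h3⟩

/-- A loop with `m` iterations and the invariant `I`. -/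
lemma loop {m : ℕ} (I : ℕ → Mem → Prop)
    (hstep : ∀ k σ, k < m → I k σ → b.Holds σ ∧ Run O p σ T (I (k + 1)))
    (hend : ∀ σ, I m σ → ¬ b.Holds σ) (h0 : I 0 σ) :
    Run O (.loop b p) σ (m * (T + b.time) + b.time) (I m) := by
  suffices h : ∀ r k σ, k + r = m → I k σ →
      Run O (.loop b p) σ (r * (T + b.time) + b.time) (I m) from h m 0 σ (by omega) h0
  intro r
  induction r with
  | zero =>
    intro k σ hk hI
    obtain rfl : k = m := by omega
    exact ⟨_, _, .loop_false (hend σ hI), by omega, hI⟩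
  | succ r ih =>
    intro k σ hk hI
    obtain ⟨hb, t, τ, h1, h2, h3⟩ := hstep k σ (by omega) hI
    obtain ⟨t', τ', h4, h5, h6⟩ := ih (k + 1) τ (by omega) h3
    exact ⟨_, _, .loop_true hb h1 h4, by rw [Nat.succ_mul]; omega, h6⟩

end Run

namespace Program

/-- Programs in succession. -/
def block : List Program → Program
  | [] => .skip
  | p :: l => .seq p (block l)

/-- Programs without loops. -/
def Straight : Program → Prop
  | seq p q => p.Straight ∧ q.Straight
  | cond _ p q => p.Straight ∧ q.Straight
  | loop _ _ => False
  | _ => True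

/-- A bound for the running time of a program without loops. -/
def steps : Program → ℕ
  | skip => 1
  | setNat a e => a.time + e.time + 1
  | setReal a e => a.time + e.time + 1
  | askCdf a i y => a.time + i.time + y.time + 1
  | askPartialMean a i y => a.time + i.time + y.time + 1
  | seq p q => p.steps + q.steps
  | cond b p q => b.time + (p.steps + q.steps)
  | loop _ _ => 0

open Classical in
/-- The effect of a program without loops. -/
noncomputable def result (O : Oracle) : Program → Mem → Mem
  | skip, σ => σ
  | setNat a e, σ => σ.setN (a.eval σ) (e.eval σ)
  | setReal a e, σ => σ.setR (a.eval σ) (e.eval σ)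
  | askCdf a i y, σ => σ.setR (a.eval σ) (O.cdf (i.eval σ) (y.eval σ))
  | askPartialMean a i y, σ => σ.setR (a.eval σ) (O.partialMean (i.eval σ) (y.eval σ))
  | seq p q, σ => q.result O (p.result O σ)
  | cond b p q, σ => if b.Holds σ then p.result O σ else q.result O σ
  | loop _ _, σ => σ

end Program

/-- Programs without loops are executed symbolically: `result` and `steps` can be unfolded by
`simp`, so that only loops need invariants. -/
lemma Run.straight {O : Oracle} {p : Program} (hp : p.Straight) {σ : Mem} {Q : Mem → Prop}
    (h : Q (p.result O σ)) : Run O p σ p.steps Q := by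
  suffices h' : Run O p σ p.steps (· = p.result O σ) from h'.mono le_rfl fun τ hτ => hτ ▸ h
  clear h
  induction p generalizing σ with
  | skip => exact Run.skip rfl
  | setNat => exact Run.setNat rfl
  | setReal => exact Run.setReal rfl
  | askCdf => exact Run.askCdf rfl
  | askPartialMean => exact Run.askPartialMean rfl
  | seq p q ihp ihq =>
    exact Run.seq ((ihp hp.1).mono le_rfl fun τ hτ => hτ ▸ ihq hp.2)
  | cond b p q ihp ihq =>
    refine Run.cond (fun hb => ?_) (fun hb => ?_)
    · rw [Program.result, if_pos hb]
      exact ihp hp.1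
    · rw [Program.result, if_neg hb]
      exact ihq hp.2
  | loop => exact hp.elim

lemma Run.straight_le {O : Oracle} {p : Program} (hp : p.Straight) {T : ℕ} (hT : p.steps ≤ T)
    {σ : Mem} {Q : Mem → Prop} (h : Q (p.result O σ)) : Run O p σ T Q :=
  (Run.straight hp h).mono hT fun _ h => h

lemma Run.cons {O : Oracle} {p : Program} {l : List Program} {σ : Mem} {Q : Mem → Prop}
    {T : ℕ} (T₁ T₂ : ℕ) (hT : T₁ + T₂ ≤ T)
    (h : Run O p σ T₁ (fun τ => Run O (.block l) τ T₂ Q)) : Run O (.block (p :: l)) σ T Q :=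
  (Run.seq h).mono hT fun _ h => h

lemma Run.singleton {O : Oracle} {p : Program} {σ : Mem} {Q : Mem → Prop} {T : ℕ}
    (h : Run O p σ T Q) : Run O (.block [p]) σ (T + 1) Q :=
  Run.seq (h.mono le_rfl fun _ h => Run.skip h)

lemma Run.loop_le {O : Oracle} {b : Test} {p : Program} {σ : Mem} {T : ℕ} (T₁ m : ℕ) {m' : ℕ}
    (hm : m ≤ m') (hT : m' * (T₁ + b.time) + b.time ≤ T) (I : ℕ → Mem → Prop)
    (hstep : ∀ k σ, k < m → I k σ → b.Holds σ ∧ Run O p σ T₁ (I (k + 1)))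
    (hend : ∀ σ, I m σ → ¬ b.Holds σ) (h0 : I 0 σ) : Run O (.loop b p) σ T (I m) :=
  (Run.loop I hstep hend h0).mono
    ((Nat.add_le_add_right (Nat.mul_le_mul_right _ hm) _).trans hT) fun _ h => h

/-- A program uses at most as many new cells as it takes time. -/
lemma Exec.size_le {O : Oracle} {p : Program} {σ τ : Mem} {t : ℕ} (h : Exec O p σ t τ) :
    τ.size ≤ σ.size + t := by
  have upN : ∀ (f : ℕ → ℕ) (a v : ℕ),
      {b | Function.update f a v b ≠ 0}.encard ≤ {b | f b ≠ 0}.encard + 1 := by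
    intro f a v
    refine (Set.encard_le_encard (t := insert a {b | f b ≠ 0}) fun b hb => ?_).trans
      (Set.encard_insert_le _ _)
    by_cases hba : b = a
    · exact .inl hba
    · right
      simpa [Function.update_of_ne hba] using hb
  have upR : ∀ (f : ℕ → ℝ) (a : ℕ) (v : ℝ),
      {b | Function.update f a v b ≠ 0}.encard ≤ {b | f b ≠ 0}.encard + 1 := by
    intro f a v
    refine (Set.encard_le_encard (t := insert a {b | f b ≠ 0}) fun b hb => ?_).trans
      (Set.encard_insert_le _ _)
    by_cases hba : b = a
    · exact .inl hba
    · right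
      simpa [Function.update_of_ne hba] using hb
  have one : ∀ m : ℕ, (1 : ℕ∞) ≤ (m + 1 : ℕ) := fun m => by exact_mod_cast Nat.le_add_left 1 m
  induction h with
  | skip σ => exact le_self_add
  | setNat σ a e =>
    refine (add_le_add_left (upN σ.nat _ _) _).trans ?_
    rw [add_right_comm]
    exact add_le_add_right (one _) _
  | setReal σ a e =>
    refine (add_le_add_right (upR σ.real _ _) _).trans ?_
    rw [← add_assoc]
    exact add_le_add_right (one _) _
  | askCdf σ a i y =>
    refine (add_le_add_right (upR σ.real _ _) _).trans ?_
    rw [← add_assoc]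
    exact add_le_add_right (one _) _
  | askPartialMean σ a i y =>
    refine (add_le_add_right (upR σ.real _ _) _).trans ?_
    rw [← add_assoc]
    exact add_le_add_right (one _) _
  | seq _ _ h1 h2 =>
    refine h2.trans ((add_le_add_left h1 _).trans ?_)
    push_cast
    rw [add_assoc]
  | cond_true _ _ h =>
    refine h.trans (add_le_add_right ?_ _)
    exact_mod_cast Nat.le_add_left _ _
  | cond_false _ _ h =>
    refine h.trans (add_le_add_right ?_ _)
    exact_mod_cast Nat.le_add_left _ _
  | loop_true _ _ _ h1 h2 =>
    refine h2.trans ((add_le_add_left h1 _).trans ?_)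
    rw [add_assoc]
    refine add_le_add_right ?_ _
    norm_cast
    omega
  | loop_false _ => exact le_self_add

end BinPacking

namespace BinPacking
namespace Code
open Program

/-! ## The preprocessing program

Natural number cells: `1` number of items, `2` base of the encoding, `3` item, `4` encoding,
`5` current row of the table, `6` length of a row, `30 + ℓ` weight of level `ℓ`. Real cells: `2`
penalty, `30 + k` probability of the rounded size `k`. -/

/-- The expected cost of packing into a bin of the level in cell `7`, where cell `8` encodes the
other bins; the result is in real cell `3`. -/
def pack (M : ℕ) : Program := block [
  block [.setReal (.lit 4) (rreg 2 + .cell (reg 5 + reg 6 + reg 8)),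
    .setReal (.lit 3) (rreg 4),
    .setNat (.lit 9) (.lit 0)],
  .loop (.natLe (reg 7 + reg 9) (.lit M)) (block [
    .setReal (.lit 3) (rreg 3 + (.cell (reg 5 + reg 6 + reg 8 + .cell (.lit 30 + (reg 7 + reg 9)))
      - rreg 4) * .cell (.lit 30 + reg 9)),
    .setNat (.lit 9) (reg 9 + .lit 1)])]

lemma run_pack {O : Oracle} {M : ℕ} {σ : Mem} (h5 : 30 ≤ σ.nat 5) :
    Run O (pack M) σ (100 * (M + 2)) fun τ =>
      (∀ a, a ≠ 9 → τ.nat a = σ.nat a) ∧ (∀ a, a ≠ 3 → a ≠ 4 → τ.real a = σ.real a) ∧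
      τ.real 3 = packVal (fun ℓ => σ.nat (30 + ℓ)) M (σ.real 2)
        (fun t => σ.real (σ.nat 5 + σ.nat 6 + t)) (fun k => σ.real (30 + k))
        (σ.nat 7) (σ.nat 8) := by
  set g := σ.real 2 + σ.real (σ.nat 5 + σ.nat 6 + σ.nat 8) with hg
  set I : ℕ → Mem → Prop := fun k τ =>
    (∀ a, a ≠ 9 → τ.nat a = σ.nat a) ∧ (∀ a, a ≠ 3 → a ≠ 4 → τ.real a = σ.real a) ∧
    τ.nat 9 = k ∧ τ.real 4 = g ∧ τ.real 3 = g + ∑ k ∈ Finset.range k,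
      (σ.real (σ.nat 5 + σ.nat 6 + (σ.nat 8 + σ.nat (30 + (σ.nat 7 + k)))) - g) *
        σ.real (30 + k) with hI
  refine Run.cons 30 (100 * M + 150) (by omega) (Run.straight_le (by simp [block, Straight])
    (by simp [block, steps]) (Run.singleton (T := 100 * M + 149)
    (Run.mono (Run.loop_le 60 (M + 1 - σ.nat 7) (Nat.sub_le _ _) (by simp; omega)
      I ?_ ?_ ?_) le_rfl fun τ h => ?_)))
  · rintro k τ hk ⟨h1, h2, h3, h4, h6⟩
    refine ⟨?_, Run.straight_le (by simp [block, Straight]) (by simp [block, steps]) ?_⟩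
    · simp only [Test.holds_natLe, NatExp.eval_add, NatExp.eval_reg, NatExp.eval_lit, h3, h1 7 (by decide)]
      omega
    · simp only [hI, block, result, NatExp.eval_lit, NatExp.eval_add, NatExp.eval_reg,
        NatExp.eval_cell, RealExp.eval_add, RealExp.eval_sub, RealExp.eval_mul,
        RealExp.eval_cell, RealExp.eval_rreg, Mem.setN_nat, Mem.setN_real, Mem.setR_nat,
        Mem.setR_real, if_true]
      refine ⟨fun a ha => ?_, fun a h3 h4 => ?_, ?_, ?_, ?_⟩
      · rw [if_neg ha, h1 a ha]
      · rw [if_neg h3, h2 a h3 h4]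
      · rw [h3]
      · rw [if_neg (by decide), h4]
      · rw [h6, h4, h3, h1 5 (by decide), h1 6 (by decide), h1 8 (by decide), h1 7 (by decide),
          h1 _ (by omega), h2 _ (by omega) (by omega), h2 _ (by omega) (by omega),
          Finset.sum_range_succ]
        ring_nf
  · rintro τ ⟨h1, -, h3, -⟩
    simp only [Test.holds_natLe, NatExp.eval_add, NatExp.eval_reg, NatExp.eval_lit, h3, h1 7 (by decide)]
    omega
  · simp [hI, block, result, hg]
    refine ⟨fun a ha hne => absurd hne ha, fun a h3 h4 => by simp [h3, h4]⟩
  · obtain ⟨h1, h2, -, -, h6⟩ := h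
    refine ⟨h1, h2, h6.trans ?_⟩
    rw [packVal]

end Code
end BinPacking

/-! ### Computation of one table entry. -/

namespace BinPacking

lemma packVal_congr {W W' : ℕ → ℕ} {M : ℕ} {C : ℝ} {f f' π π' : ℕ → ℝ} {L s b : ℕ}
    (hL : L ≤ M) (hW : ∀ ℓ ≤ M, W ℓ = W' ℓ) (hπ : ∀ k ≤ M, π k = π' k) (hb : ∀ ℓ, W' ℓ ≤ b)
    (hf : ∀ t ≤ s + b, f t = f' t) : packVal W M C f π L s = packVal W' M C f' π' L s := by
  rw [packVal, packVal, hf s (by omega)]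
  congr 1
  refine Finset.sum_congr rfl fun k hk => ?_
  rw [Finset.mem_range] at hk
  rw [hW _ (by omega), hπ _ (by omega), hf _ (Nat.add_le_add_left (hb _) _)]

lemma Instance.wt_le (D : Instance) (ℓ : ℕ) : D.wt ℓ ≤ D.base ^ (D.top - 1) :=
  weight_le (by simp [base]) ℓ

/-- An entry at `s` looks at the next row only up to `s` plus the largest weight, so a finite table
suffices although `value` is defined for all encodings. -/
lemma Instance.scan_congr (D : Instance) {f f' : ℕ → ℝ} {i s : ℕ}
    (hf : ∀ t ≤ s + D.base ^ (D.top - 1), f t = f' t) (c : ℕ) :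
    D.scan f i s c = D.scan f' i s c := by
  have hp : ∀ L ≤ D.top, ∀ s' ≤ s, D.pack f i L s' = D.pack f' i L s' := fun L hL s' hs =>
    packVal_congr hL (fun _ _ => rfl) (fun _ _ => rfl) D.wt_le fun t ht => hf t (by omega)
  have htop : 1 ≤ D.top := by simp only [top]; omega
  induction c with
  | zero => rw [scan, scan, hp 1 htop s le_rfl]
  | succ c ih => rw [scan, scan, ih, hp _ (Nat.sub_le _ _) _ (Nat.sub_le _ _)]

lemma Instance.scan_fst_le (D : Instance) (f : ℕ → ℝ) (i s c : ℕ) :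
    (D.scan f i s c).1 ≤ D.top := by
  induction c with
  | zero => exact Nat.zero_le _
  | succ c ih =>
    rw [scan]
    split_ifs
    · exact Nat.sub_le _ _
    · exact ih

namespace Code
open Program

/-- Reduce cell `11` modulo the weight of the level in cell `10`. -/
def reduce : Program :=
  .loop (.natLe (.cell (.lit 30 + reg 10)) (reg 11))
    (.setNat (.lit 11) (reg 11 - .cell (.lit 30 + reg 10)))

/-- Remainders are found by repeated subtraction. Since consecutive weights differ by the factor
`base`, few subtractions are needed if the levels are visited in descending order. -/
lemma run_reduce {O : Oracle} {σ : Mem} {B : ℕ} (h0 : 0 < σ.nat (30 + σ.nat 10))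
    (hB : σ.nat 11 < (B + 1) * σ.nat (30 + σ.nat 10)) :
    Run O reduce σ (20 * (B + 1)) fun τ => (∀ a, a ≠ 11 → τ.nat a = σ.nat a) ∧
      τ.real = σ.real ∧ τ.nat 11 = σ.nat 11 % σ.nat (30 + σ.nat 10) := by
  set w := σ.nat (30 + σ.nat 10) with hw
  refine Run.mono (Run.loop_le 10 (σ.nat 11 / w) (m' := B) ?_ ?_
    (fun k τ => (∀ a, a ≠ 11 → τ.nat a = σ.nat a) ∧ τ.real = σ.real ∧
      τ.nat 11 = σ.nat 11 - k * w) ?_ ?_ ?_) le_rfl ?_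
  · exact Nat.lt_succ_iff.1 ((Nat.div_lt_iff_lt_mul h0).2 hB)
  · simp
    omega
  · rintro k τ hk ⟨h1, h2, h3⟩
    have hk' : (k + 1) * w ≤ σ.nat 11 := (Nat.le_div_iff_mul_le h0).1 hk
    rw [Nat.succ_mul] at hk'
    refine ⟨?_, Run.straight_le (by simp [Straight]) (by simp [steps]) ?_⟩
    · simp only [Test.holds_natLe, NatExp.eval_cell, NatExp.eval_add, NatExp.eval_reg,
        NatExp.eval_lit, h1 10 (by decide), h3]
      rw [h1 _ (by omega)]
      omega
    · simp only [result, NatExp.eval_cell, NatExp.eval_add, NatExp.eval_reg, NatExp.eval_sub,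
        NatExp.eval_lit, Mem.setN_nat, Mem.setN_real, if_true, h1 10 (by decide), h3]
      refine ⟨fun a ha => by rw [if_neg ha, h1 a ha], h2, ?_⟩
      rw [h1 _ (by omega), Nat.succ_mul]
      omega
  · rintro τ ⟨h1, -, h3⟩
    simp only [Test.holds_natLe, NatExp.eval_cell, NatExp.eval_add, NatExp.eval_reg,
      NatExp.eval_lit, h1 10 (by decide), h3]
    rw [h1 _ (by omega), ← Nat.mod_eq_sub_div_mul]
    exact not_le.2 (Nat.mod_lt _ h0)
  · simp
  · rintro τ ⟨h1, h2, h3⟩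
    exact ⟨h1, h2, h3.trans Nat.mod_eq_sub_div_mul.symm⟩

/-- Take the level in cell `10` into account. -/
def tryLevel (M : ℕ) : Program := .cond (.natLe (.cell (.lit 30 + reg 10)) (reg 11))
  (block [
    block [.setNat (.lit 7) (reg 10),
      .setNat (.lit 8) (reg 4 - .cell (.lit 30 + reg 10))],
    pack M,
    .cond (.realLe (rreg 3) (rreg 5))
      (block [.setReal (.lit 5) (rreg 3), .setNat (.lit 12) (reg 10)]) .skip,
    reduce])
  .skip

/-- Fill in the entry for the encoding in cell `4` in the current row of the tables. -/
def stage (M q : ℕ) : Program := block [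
  block [.setNat (.lit 7) (.lit 1), .setNat (.lit 8) (reg 4)],
  pack M,
  block [.setReal (.lit 5) (.lit 1 + .lit M / (.lit q * .lit q) + rreg 3),
    .setNat (.lit 12) (.lit 0), .setNat (.lit 11) (reg 4), .setNat (.lit 10) (.lit M)],
  .loop (.natLe (.lit 1) (reg 10)) (block [
    tryLevel M,
    .setNat (.lit 10) (reg 10 - .lit 1)]),
  block [.setReal (reg 5 + reg 4) (rreg 5), .setNat (reg 5 + reg 4) (reg 12)]]

/-- The memory for the computation of the entry for item `i` and encoding `s`. -/
structure StageReady (D : Instance) (i s : ℕ) (f : ℕ → ℝ) (σ : Mem) : Prop where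
  weight : ∀ ℓ ≤ D.top, σ.nat (30 + ℓ) = D.wt ℓ
  prob : ∀ k ≤ D.top, σ.real (30 + k) = D.oracle.prob D.res i k
  penalty : σ.real 2 = D.penalty
  row : 30 ≤ σ.nat 5
  code : σ.nat 4 = s
  next : ∀ t ≤ s + D.base ^ (D.top - 1), σ.real (σ.nat 5 + σ.nat 6 + t) = f t

/-- The scratch cells of `stage` are the only ones in which `τ` differs from `σ`. -/
def Scratch (σ τ : Mem) : Prop :=
  (∀ a, a < 7 ∨ 12 < a → τ.nat a = σ.nat a) ∧ (∀ a, a < 3 ∨ 5 < a → τ.real a = σ.real a)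

lemma Scratch.trans {σ τ ρ : Mem} (h : Scratch σ τ) (h' : Scratch τ ρ) : Scratch σ ρ :=
  ⟨fun a ha => (h'.1 a ha).trans (h.1 a ha), fun a ha => (h'.2 a ha).trans (h.2 a ha)⟩

lemma StageReady.of_scratch {D : Instance} {i s : ℕ} {f : ℕ → ℝ} {σ τ : Mem}
    (h : StageReady D i s f σ) (hs : Scratch σ τ) : StageReady D i s f τ where
  weight ℓ hℓ := by rw [hs.1 _ (by omega), h.weight ℓ hℓ]
  prob k hk := by rw [hs.2 _ (by omega), h.prob k hk]
  penalty := by rw [hs.2 _ (by omega), h.penalty]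
  row := by rw [hs.1 _ (by omega)]; exact h.row
  code := by rw [hs.1 _ (by omega), h.code]
  next t ht := by
    have := h.row
    rw [hs.1 _ (by omega), hs.1 _ (by omega), hs.2 _ (by omega), h.next t ht]

lemma StageReady.run_pack {O : Oracle} {D : Instance} {i s : ℕ} {f : ℕ → ℝ} {σ : Mem}
    (h : StageReady D i s f σ) {L s' : ℕ} (hL : L ≤ D.top) (hs : s' ≤ s)
    (h7 : σ.nat 7 = L) (h8 : σ.nat 8 = s') :
    Run O (pack D.top) σ (100 * (D.top + 2)) fun τ => Scratch σ τ ∧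
      (∀ a, a ≠ 9 → τ.nat a = σ.nat a) ∧
      (∀ a, a ≠ 3 → a ≠ 4 → τ.real a = σ.real a) ∧ τ.real 3 = D.pack f i L s' := by
  refine (Code.run_pack h.row).mono le_rfl fun τ ⟨h1, h2, h3⟩ =>
    ⟨⟨fun a ha => h1 a (by omega), fun a ha => h2 a (by omega) (by omega)⟩, h1, h2, h3.trans ?_⟩
  rw [h7, h8, h.penalty]
  exact packVal_congr hL h.weight h.prob D.wt_le fun t ht => h.next t (by omega)

lemma run_tryLevel {O : Oracle} {D : Instance} {i s c : ℕ} {f : ℕ → ℝ} {σ : Mem}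
    (h : StageReady D i s f σ) (hc : c < D.top)
    (h10 : σ.nat 10 = D.top - c) (h11 : σ.nat 11 = s % D.base ^ (D.top - c))
    (h12 : σ.nat 12 = (D.scan f i s c).1) (h5 : σ.real 5 = (D.scan f i s c).2) :
    Run O (tryLevel D.top) σ (100 * (D.top + D.base + 6)) fun τ => Scratch σ τ ∧
      τ.nat 10 = D.top - c ∧ τ.nat 11 = s % D.base ^ (D.top - (c + 1)) ∧
      τ.nat 12 = (D.scan f i s (c + 1)).1 ∧ τ.real 5 = (D.scan f i s (c + 1)).2 := by
  have hw : σ.nat (30 + (D.top - c)) = D.base ^ (D.top - (c + 1)) := by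
    rw [h.weight _ (by omega), Instance.wt, weight, if_pos (by omega)]
    congr 1
  have hwt : D.wt (D.top - c) = D.base ^ (D.top - (c + 1)) := by
    rw [← hw, h.weight _ (by omega)]
  have hB : 0 < D.base := by simp [Instance.base]
  have hpow : D.base ^ (D.top - c) = D.base * D.base ^ (D.top - (c + 1)) := by
    rw [← pow_succ', show D.top - c = D.top - (c + 1) + 1 by omega]
  have hmod : s % D.base ^ (D.top - c) % D.base ^ (D.top - (c + 1)) =
      s % D.base ^ (D.top - (c + 1)) :=
    Nat.mod_mod_of_dvd _ (pow_dvd_pow _ (by omega))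
  refine (Run.cond (T := 100 * (D.top + D.base) + 500) (T' := 1) (fun hb => ?_)
    (fun hb => ?_)).mono (by simp; omega) fun _ h => h
  · simp only [Test.holds_natLe, NatExp.eval_cell, NatExp.eval_add, NatExp.eval_reg,
      NatExp.eval_lit, h10, hw, h11] at hb
    refine Run.cons 30 (100 * (D.top + D.base) + 470) (by omega)
      (Run.straight_le (by simp [block, Straight]) (by simp [block, steps]) ?_)
    set σ₁ := (block [.setNat (.lit 7) (reg 10),
      .setNat (.lit 8) (reg 4 - .cell (.lit 30 + reg 10))]).result O σ with hσ₁
    have e1 : ∀ a, a ≠ 7 → a ≠ 8 → σ₁.nat a = σ.nat a := by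
      intro a h7 h8
      simp [hσ₁, block, result, h7, h8]
    have e2 : σ₁.real = σ.real := by simp [hσ₁, block, result]
    have e7 : σ₁.nat 7 = D.top - c := by simp [hσ₁, block, result, h10]
    have e8 : σ₁.nat 8 = s - D.wt (D.top - c) := by
      simp only [hσ₁, block, result, NatExp.eval_lit, NatExp.eval_sub, NatExp.eval_add,
        NatExp.eval_cell, NatExp.eval_reg, Mem.setN_nat, if_true]
      simp only [show (10 : ℕ) ≠ 7 by decide, show (4 : ℕ) ≠ 7 by decide, if_false, h10]
      rw [if_neg (by omega), hw, hwt, h.code]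
    have hs1 : Scratch σ σ₁ := ⟨fun a ha => e1 a (by omega) (by omega), fun a _ => by rw [e2]⟩
    clear_value σ₁
    refine Run.cons (100 * (D.top + 2)) (100 * D.base + 270) (by omega)
      (((h.of_scratch hs1).run_pack (Nat.sub_le _ _) (Nat.sub_le _ _) e7 e8).mono le_rfl ?_)
    rintro σ₂ ⟨hs2, g1, g2, g3⟩
    refine Run.cons 50 (100 * D.base + 220) (by omega)
      (Run.straight_le (by simp [block, Straight]) (by simp [block, steps]) ?_)
    set σ₃ := (Program.cond (.realLe (rreg 3) (rreg 5))
      (block [.setReal (.lit 5) (rreg 3), .setNat (.lit 12) (reg 10)]) .skip).result O σ₂ with hσ₃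
    have k1 : ∀ a, a ≠ 12 → σ₃.nat a = σ₂.nat a := by
      intro a h12
      rw [hσ₃, result]
      split_ifs <;> simp [block, result, h12]
    have k2 : ∀ a, a ≠ 5 → σ₃.real a = σ₂.real a := by
      intro a h5
      rw [hσ₃, result]
      split_ifs <;> simp [block, result, h5]
    have k3 : σ₃.nat 12 = (D.scan f i s (c + 1)).1 ∧ σ₃.real 5 = (D.scan f i s (c + 1)).2 := by
      have q1 : σ₂.real 5 = (D.scan f i s c).2 := by rw [g2 5 (by decide) (by decide), e2, h5]
      have q2 : σ₂.nat 12 = (D.scan f i s c).1 := by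
        rw [g1 12 (by decide), e1 12 (by decide) (by decide), h12]
      have q3 : σ₂.nat 10 = D.top - c := by
        rw [g1 10 (by decide), e1 10 (by decide) (by decide), h10]
      rw [hσ₃, result, Instance.scan]
      simp only [Test.holds_realLe, RealExp.eval_rreg, g3, q1, hwt, hb, true_and]
      rw [hwt] at g3
      split_ifs with hle
      · simp [block, result, g3, q3]
      · simp [result, q1, q2]
    have hs3 : Scratch σ₂ σ₃ := ⟨fun a ha => k1 a (by omega), fun a ha => k2 a (by omega)⟩
    clear_value σ₃
    have q10 : σ₃.nat 10 = D.top - c := by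
      rw [k1 10 (by decide), g1 10 (by decide), e1 10 (by decide) (by decide), h10]
    have q11 : σ₃.nat 11 = s % D.base ^ (D.top - c) := by
      rw [k1 11 (by decide), g1 11 (by decide), e1 11 (by decide) (by decide), h11]
    have qw : σ₃.nat (30 + (D.top - c)) = D.base ^ (D.top - (c + 1)) := by
      rw [k1 _ (by omega), g1 _ (by omega), e1 _ (by omega) (by omega), hw]
    refine (Run.singleton ((run_reduce (B := D.base) ?_ ?_).mono le_rfl ?_)).mono
      (T := 20 * (D.base + 1) + 1) (by omega) fun _ h => h
    · rw [q10, qw]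
      exact Nat.pow_pos hB
    · rw [q10, qw, q11]
      refine (Nat.mod_lt _ (Nat.pow_pos hB)).trans_le ?_
      rw [hpow]
      exact Nat.mul_le_mul_right _ (Nat.le_succ _)
    · rintro τ ⟨r1, r2, r3⟩
      refine ⟨hs1.trans (hs2.trans (hs3.trans ⟨fun a ha => r1 a (by omega), fun a _ => by rw [r2]⟩)),
        ?_, ?_, ?_, ?_⟩
      · rw [r1 10 (by decide), q10]
      · rw [r3, q10, qw, q11, hmod]
      · rw [r1 12 (by decide), k3.1]
      · rw [r2, k3.2]
  · simp only [Test.holds_natLe, NatExp.eval_cell, NatExp.eval_add, NatExp.eval_reg,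
      NatExp.eval_lit, h10, hw, h11] at hb
    refine Run.skip ⟨⟨fun _ _ => rfl, fun _ _ => rfl⟩, h10, ?_, ?_, ?_⟩
    -- The weight does not fit, so the remainder is already reduced for the next level.
    · rw [h11, ← hmod, Nat.mod_eq_of_lt (not_le.1 hb)]
    · rw [h12, Instance.scan, if_neg]
      rw [hwt]
      tauto
    · rw [h5, Instance.scan, if_neg]
      rw [hwt]
      tauto

lemma run_stage {O : Oracle} {D : Instance} {i s : ℕ} {f : ℕ → ℝ} {σ : Mem}
    (h : StageReady D i s f σ) (hs : s < D.base ^ D.top) :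
    Run O (stage D.top D.tol) σ (200 * (D.top + 1) * (D.top + D.base + 7)) fun τ =>
      (∀ a, a < 7 ∨ 12 < a → a ≠ σ.nat 5 + s → τ.nat a = σ.nat a) ∧
      (∀ a, a < 3 ∨ 5 < a → a ≠ σ.nat 5 + s → τ.real a = σ.real a) ∧
      τ.nat (σ.nat 5 + s) = (D.scan f i s D.top).1 ∧
      τ.real (σ.nat 5 + s) = (D.scan f i s D.top).2 := by
  have hrow := h.row
  refine Run.cons 30 (100 * (D.top + 2) + 50 + (D.top * (100 * (D.top + D.base + 6) + 20) + 60)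
    + 70) ?_ (Run.straight_le (by simp [block, Straight]) (by simp [block, steps]) ?_)
  · nlinarith [Nat.zero_le (D.top * D.top), Nat.zero_le (D.top * D.base)]
  set σ₁ := (block [.setNat (.lit 7) (.lit 1), .setNat (.lit 8) (reg 4)]).result O σ with hσ₁
  have e1 : ∀ a, a ≠ 7 → a ≠ 8 → σ₁.nat a = σ.nat a := by
    intro a h7 h8
    simp [hσ₁, block, result, h7, h8]
  have e2 : σ₁.real = σ.real := by simp [hσ₁, block, result]
  have e7 : σ₁.nat 7 = 1 := by simp [hσ₁, block, result]
  have e8 : σ₁.nat 8 = s := by simp [hσ₁, block, result, h.code]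
  have hs1 : Scratch σ σ₁ := ⟨fun a ha => e1 a (by omega) (by omega), fun a _ => by rw [e2]⟩
  clear_value σ₁
  refine Run.cons (100 * (D.top + 2))
    (50 + (D.top * (100 * (D.top + D.base + 6) + 20) + 60) + 70) (by omega)
    (((h.of_scratch hs1).run_pack (by simp only [Instance.top]; omega) le_rfl e7 e8).mono
      le_rfl ?_)
  rintro σ₂ ⟨hs2, g1, g2, g3⟩
  refine Run.cons 50 ((D.top * (100 * (D.top + D.base + 6) + 20) + 60) + 70) (by omega)
    (Run.straight_le (by simp [block, Straight]) (by simp [block, steps]) ?_)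
  set σ₃ := (block [.setReal (.lit 5) (.lit 1 + .lit D.top / (.lit D.tol * .lit D.tol) + rreg 3),
    .setNat (.lit 12) (.lit 0), .setNat (.lit 11) (reg 4),
    .setNat (.lit 10) (.lit D.top)]).result O σ₂ with hσ₃
  have hs3 : Scratch σ₂ σ₃ := by
    refine ⟨fun a ha => ?_, fun a ha => ?_⟩
    · simp only [hσ₃, block, result, NatExp.eval_lit, Mem.setN_nat, Mem.setR_nat]
      rw [if_neg (by omega), if_neg (by omega), if_neg (by omega)]
    · simp only [hσ₃, block, result, NatExp.eval_lit, Mem.setN_real, Mem.setR_real]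
      rw [if_neg (by omega)]
  have k5 : σ₃.real 5 = D.price + D.pack f i 1 s := by
    simp only [hσ₃, block, result, NatExp.eval_lit, Mem.setN_real, Mem.setR_real, if_true,
      RealExp.eval_add, RealExp.eval_div, RealExp.eval_mul, RealExp.eval_lit, RealExp.eval_rreg,
      g3, Instance.price]
    push_cast
    ring
  have k10 : σ₃.nat 10 = D.top := by simp [hσ₃, block, result]
  have k11 : σ₃.nat 11 = s := by simp [hσ₃, block, result, g1, e1, h.code]
  have k12 : σ₃.nat 12 = 0 := by simp [hσ₃, block, result]
  have hsc := hs1.trans (hs2.trans hs3)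
  clear_value σ₃
  refine Run.cons (D.top * (100 * (D.top + D.base + 6) + 20) + 60) 70 (by omega)
    ((Run.loop_le (100 * (D.top + D.base + 6) + 11) D.top le_rfl (by simp; nlinarith)
      (fun c τ => Scratch σ τ ∧ τ.nat 10 = D.top - c ∧ τ.nat 11 = s % D.base ^ (D.top - c) ∧
        τ.nat 12 = (D.scan f i s c).1 ∧ τ.real 5 = (D.scan f i s c).2) ?_ ?_ ?_).mono le_rfl ?_)
  · rintro c τ hc ⟨t1, t2, t3, t4, t5⟩
    refine ⟨?_, Run.cons (100 * (D.top + D.base + 6)) 11 le_rfl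
      ((run_tryLevel (h.of_scratch t1) hc t2 t3 t4 t5).mono le_rfl ?_)⟩
    · simp only [Test.holds_natLe, NatExp.eval_lit, NatExp.eval_reg, t2]
      omega
    · rintro ρ ⟨u1, u2, u3, u4, u5⟩
      refine Run.straight_le (by simp [block, Straight]) (by simp [block, steps]) ?_
      simp only [block, result, NatExp.eval_lit, NatExp.eval_reg, NatExp.eval_sub, Mem.setN_nat,
        Mem.setN_real, if_true, u2]
      refine ⟨t1.trans (u1.trans ⟨fun a ha => ?_, fun a _ => rfl⟩), by omega, ?_, ?_, u5⟩
      · rw [Mem.setN_nat, if_neg (by omega)]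
      · rw [if_neg (by decide), u3]
      · rw [if_neg (by decide), u4]
  · rintro τ ⟨-, t2, -⟩
    simp only [Test.holds_natLe, NatExp.eval_lit, NatExp.eval_reg, t2]
    omega
  · refine ⟨hsc, k10, ?_, k12, k5⟩
    rw [k11, Nat.sub_zero, Nat.mod_eq_of_lt hs]
  · rintro τ ⟨t1, -, -, t4, t5⟩
    refine Run.straight_le (by simp [block, Straight]) (by simp [block, steps]) ?_
    have q5 : τ.nat 5 = σ.nat 5 := t1.1 5 (by omega)
    have q4 : τ.nat 4 = s := (t1.1 4 (by omega)).trans h.code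
    simp only [block, result, NatExp.eval_reg, NatExp.eval_add, Mem.setN_nat,
      Mem.setN_real, Mem.setR_nat, Mem.setR_real, if_true, q4, q5, RealExp.eval_rreg]
    refine ⟨fun a ha hne => ?_, fun a ha hne => ?_, t4, t5⟩
    · rw [if_neg hne, t1.1 a ha]
    · rw [if_neg hne, t1.2 a ha]

end Code
end BinPacking

/-! ### Computation of the weights and of the rounding probabilities. -/

namespace BinPacking
namespace Code
open Program

/-- Add the content of cell `c` to cell `a`, as many times as cell `m` says. -/
def addTimes (a c m : ℕ) : Program := block [
  .setNat (.lit 14) (.lit 0),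
  .loop (.natLe (reg 14 + .lit 1) (reg m)) (block [
    .setNat (.lit a) (reg a + reg c),
    .setNat (.lit 14) (reg 14 + .lit 1)])]

/-- Natural numbers can only be added and subtracted, so products are formed by repeated addition.
-/
lemma run_addTimes {O : Oracle} {a c m : ℕ} {σ : Mem} (hac : c ≠ a) (ham : m ≠ a) (ha : a ≠ 14)
    (hc : c ≠ 14) (hm : m ≠ 14) :
    Run O (addTimes a c m) σ (30 * (σ.nat m + 1)) fun τ =>
      (∀ b, b ≠ a → b ≠ 14 → τ.nat b = σ.nat b) ∧ τ.real = σ.real ∧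
      τ.nat a = σ.nat a + σ.nat m * σ.nat c := by
  refine Run.cons 3 (30 * σ.nat m + 20) (by omega) (Run.straight_le (by simp [Straight]) (by simp [steps])
    (Run.singleton (T := 30 * σ.nat m + 19) (Run.mono (Run.loop_le 15 (σ.nat m) le_rfl (by simp; omega)
      (fun k τ => (∀ b, b ≠ a → b ≠ 14 → τ.nat b = σ.nat b) ∧ τ.real = σ.real ∧
        τ.nat 14 = k ∧ τ.nat a = σ.nat a + k * σ.nat c) ?_ ?_ ?_) le_rfl fun τ h => ?_)))
  · rintro k τ hk ⟨h1, h2, h3, h4⟩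
    refine ⟨?_, Run.straight_le (by simp [block, Straight]) (by simp [block, steps]) ?_⟩
    · simp only [Test.holds_natLe, NatExp.eval_add, NatExp.eval_reg, NatExp.eval_lit, h3,
        h1 m ham hm]
      omega
    · simp only [block, result, NatExp.eval_lit, NatExp.eval_add, NatExp.eval_reg, Mem.setN_nat,
        Mem.setN_real, if_true, if_neg ha, if_neg ha.symm, h3, h4, h1 c hac hc]
      refine ⟨fun b hb hb' => ?_, h2, trivial, by ring⟩
      rw [if_neg hb', if_neg hb, h1 b hb hb']
  · rintro τ ⟨h1, -, h3, -⟩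
    simp only [Test.holds_natLe, NatExp.eval_add, NatExp.eval_reg, NatExp.eval_lit, h3, h1 m ham hm]
    omega
  · simp only [result, NatExp.eval_lit, Mem.setN_nat, Mem.setN_real, if_true, if_neg ha]
    exact ⟨fun b _ hb => if_neg hb, trivial, trivial, by ring⟩
  · exact ⟨h.1, h.2.1, h.2.2.2⟩

/-- Compute the weights of the levels and the length of a row. -/
def powers (M : ℕ) : Program := block [
  block [.setNat (.lit 6) (.lit 1), .setNat (.lit 9) (.lit 0)],
  .loop (.natLe (reg 9 + .lit 1) (.lit M)) (block [
    block [.setNat (.lit 31 + reg 9) (reg 6), .setNat (.lit 13) (reg 6),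
      .setNat (.lit 6) (.lit 0)],
    addTimes 6 13 2,
    .setNat (.lit 9) (reg 9 + .lit 1)])]

lemma run_powers {O : Oracle} {M : ℕ} {σ : Mem} :
    Run O (powers M) σ (60 * (M + 1) * (σ.nat 2 + 2)) fun τ =>
      (∀ a, a < 6 ∨ 14 < a → (a < 31 ∨ 30 + M < a) → τ.nat a = σ.nat a) ∧ τ.real = σ.real ∧
      τ.nat 6 = σ.nat 2 ^ M ∧ ∀ k < M, τ.nat (31 + k) = σ.nat 2 ^ k := by
  refine Run.cons 7 (M * (30 * (σ.nat 2 + 1) + 30 + 6) + 10) ?_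
    (Run.straight_le (by simp [block, Straight]) (by simp [block, steps])
    (Run.singleton (T := M * (30 * (σ.nat 2 + 1) + 30 + 6) + 9)
    (Run.mono (Run.loop_le (30 * (σ.nat 2 + 1) + 30) M le_rfl (by simp)
      (fun k τ => (∀ a, a < 6 ∨ 14 < a → (a < 31 ∨ 30 + M < a) → τ.nat a = σ.nat a) ∧
        τ.real = σ.real ∧ τ.nat 9 = k ∧ τ.nat 6 = σ.nat 2 ^ k ∧
        ∀ l < k, τ.nat (31 + l) = σ.nat 2 ^ l) ?_ ?_ ?_) le_rfl fun τ h => ?_)))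
  · nlinarith [Nat.zero_le (M * σ.nat 2)]
  · rintro k τ hk ⟨h1, h2, h3, h4, h5⟩
    refine ⟨?_, Run.cons 20 (30 * (σ.nat 2 + 1) + 10) (by omega)
      (Run.straight_le (by simp [block, Straight]) (by simp [block, steps]) ?_)⟩
    · simp only [Test.holds_natLe, NatExp.eval_add, NatExp.eval_reg, NatExp.eval_lit, h3]
      omega
    set τ₁ := (block [.setNat (.lit 31 + reg 9) (reg 6), .setNat (.lit 13) (reg 6),
      .setNat (.lit 6) (.lit 0)]).result O τ with hτ₁
    have e : ∀ a, τ₁.nat a = if a = 6 then 0 else if a = 13 then σ.nat 2 ^ k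
        else if a = 31 + k then σ.nat 2 ^ k else τ.nat a := by
      intro a
      simp only [hτ₁, block, result, NatExp.eval_lit, NatExp.eval_add, NatExp.eval_reg,
        Mem.setN_nat, h3, h4]
      rw [if_neg (show 6 ≠ 31 + k by omega)]
    have e2 : τ₁.real = σ.real := h2
    clear_value τ₁
    have e22 : τ₁.nat 2 = σ.nat 2 := by
      rw [e, if_neg (by decide), if_neg (by decide), if_neg (by omega), h1 2 (by omega) (by omega)]
    refine Run.cons (30 * (σ.nat 2 + 1)) 10 (by omega) ((run_addTimes (by decide) (by decide)
      (by decide) (by decide) (by decide)).mono (by rw [e22]) ?_)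
    rintro τ₂ ⟨g1, g2, g3⟩
    refine Run.straight_le (by simp [block, Straight]) (by simp [block, steps]) ?_
    have g6 : τ₂.nat 6 = σ.nat 2 ^ (k + 1) := by
      rw [g3, e22, e, if_pos rfl, e, if_neg (by decide), if_pos rfl, zero_add, pow_succ']
    simp only [block, result, NatExp.eval_lit, NatExp.eval_add, NatExp.eval_reg, Mem.setN_nat,
      Mem.setN_real]
    refine ⟨fun a ha ha' => ?_, by rw [g2, e2], ?_, ?_, fun l hl => ?_⟩
    · rw [if_neg (by omega), g1 a (by omega) (by omega), e, if_neg (by omega), if_neg (by omega),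
        if_neg (by omega), h1 a ha ha']
    · rw [if_pos trivial, g1 9 (by decide) (by decide), e, if_neg (by decide), if_neg (by decide),
        if_neg (by omega), h3]
    · rw [if_neg (by decide), g6]
    · rw [if_neg (by omega), g1 _ (by omega) (by omega), e, if_neg (by omega), if_neg (by omega)]
      split_ifs with hlk
      · rw [show l = k by omega]
      · exact h5 l (by omega)
  · rintro τ ⟨-, -, h3, -⟩
    simp only [Test.holds_natLe, NatExp.eval_add, NatExp.eval_reg, NatExp.eval_lit, h3]
    omega
  · simp only [block, result, NatExp.eval_lit, Mem.setN_nat, Mem.setN_real]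
    refine ⟨fun a ha _ => ?_, trivial, if_pos trivial, by simp, by omega⟩
    rw [if_neg (by omega), if_neg (by omega)]
  · exact ⟨h.1, h.2.1, h.2.2.2⟩

/-- Compute the distribution of the rounded size of the item in cell `3`. -/
def rounding (N M : ℕ) : Program := block [
  block [.setReal (.lit 6) (.lit 0), .setNat (.lit 9) (.lit 0)],
  .loop (.natLe (reg 9) (.lit M)) (block [
    .askCdf (.lit 7) (reg 3) ((rreg 6 + .lit 1) / .lit N),
    .askPartialMean (.lit 8) (reg 3) ((rreg 6 + .lit 1) / .lit N),
    .askCdf (.lit 9) (reg 3) (rreg 6 / .lit N),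
    .askPartialMean (.lit 10) (reg 3) (rreg 6 / .lit N),
    .askCdf (.lit 11) (reg 3) ((rreg 6 - .lit 1) / .lit N),
    .askPartialMean (.lit 12) (reg 3) ((rreg 6 - .lit 1) / .lit N),
    .setReal (.lit 30 + reg 9) (.lit N * (((rreg 6 + .lit 1) / .lit N * rreg 7 - rreg 8) -
      .lit 2 * (rreg 6 / .lit N * rreg 9 - rreg 10) +
      ((rreg 6 - .lit 1) / .lit N * rreg 11 - rreg 12))),
    .setReal (.lit 6) (rreg 6 + .lit 1),
    .setNat (.lit 9) (reg 9 + .lit 1)])]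

lemma run_rounding {O : Oracle} {N M : ℕ} {σ : Mem} :
    Run O (rounding N M) σ (200 * (M + 2)) fun τ =>
      (∀ a, a ≠ 9 → τ.nat a = σ.nat a) ∧
      (∀ a, a < 6 ∨ 12 < a → (a < 30 ∨ 30 + M < a) → τ.real a = σ.real a) ∧
      ∀ k ≤ M, τ.real (30 + k) = O.prob N (σ.nat 3) k := by
  refine Run.cons 7 (200 * (M + 1) + 20) (by omega)
    (Run.straight_le (by simp [block, Straight]) (by simp [block, steps])
    (Run.singleton (T := 200 * (M + 1) + 19)
    (Run.mono (Run.loop_le 150 (M + 1) le_rfl (by simp; omega)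
      (fun k τ => (∀ a, a ≠ 9 → τ.nat a = σ.nat a) ∧
        (∀ a, a < 6 ∨ 12 < a → (a < 30 ∨ 30 + M < a) → τ.real a = σ.real a) ∧
        τ.nat 9 = k ∧ τ.real 6 = k ∧
        ∀ l < k, τ.real (30 + l) = O.prob N (σ.nat 3) l) ?_ ?_ ?_) le_rfl fun τ h => ?_)))
  · rintro k τ hk ⟨h1, h2, h3, h4, h5⟩
    refine ⟨?_, Run.straight_le (by simp [block, Straight]) (by simp [block, steps]) ?_⟩
    · simp only [Test.holds_natLe, NatExp.eval_reg, NatExp.eval_lit, h3]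
      omega
    · simp only [block, result, NatExp.eval_lit, NatExp.eval_add, NatExp.eval_reg,
        RealExp.eval_add, RealExp.eval_sub, RealExp.eval_mul, RealExp.eval_div, RealExp.eval_lit,
        RealExp.eval_rreg, Mem.setN_nat, Mem.setN_real, Mem.setR_nat,
        Mem.setR_real, if_true, h3, h4, h1 3 (by decide)]
      refine ⟨fun a ha => ?_, fun a ha ha' => ?_, trivial, ?_, fun l hl => ?_⟩
      · rw [if_neg ha, h1 a ha]
      · rw [if_neg (by omega), if_neg (by omega), if_neg (by omega), if_neg (by omega),
          if_neg (by omega), if_neg (by omega), if_neg (by omega), if_neg (by omega), h2 a ha ha']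
      · rw [if_neg (by omega)]
        simp
      · rw [if_neg (by omega)]
        by_cases hlk : l = k
        · subst hlk
          rw [if_pos rfl]
          simp [Oracle.prob, Oracle.excess]
        · rw [if_neg (by omega), if_neg (by omega), if_neg (by omega), if_neg (by omega),
            if_neg (by omega), if_neg (by omega), if_neg (by omega), h5 l (by omega)]
  · rintro τ ⟨-, -, h3, -⟩
    simp only [Test.holds_natLe, NatExp.eval_reg, NatExp.eval_lit, h3]
    omega
  · simp only [block, result, NatExp.eval_lit, Mem.setN_nat, Mem.setN_real, Mem.setR_nat,
      Mem.setR_real, RealExp.eval_lit]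
    refine ⟨fun a ha => if_neg ha, fun a ha _ => if_neg (by omega), if_pos trivial, by simp,
      by omega⟩
  · exact ⟨h.1, h.2.1, fun k hk => h.2.2.2.2 k (by omega)⟩

end Code
end BinPacking

/-! ### Filling in the rows of the tables, from the last item to the first. -/

namespace BinPacking

/-- The lists of `n` items start in cell `lists M`. -/
def lists (M : ℕ) : ℕ := 32 + 2 * M

/-- The memory holds the tables of the controller `K` for `n` items, with rows of length `len`, up
to the encoding `i * b` in row `i`, from row `lo` on. -/
structure Tables (K : Controller) (n len b lo : ℕ) (σ : Mem) : Prop where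
  weight : ∀ ℓ ≤ 2 * K.top + 1, σ.nat (30 + ℓ) = K.wt ℓ
  penalty : σ.real 2 = K.penalty
  length : σ.nat 6 = len
  act : ∀ i s, lo ≤ i → i < n → s ≤ i * b →
    σ.nat (lists K.top + n + i * len + s) = K.act i s
  val : ∀ i s, lo ≤ i → i ≤ n → s ≤ i * b →
    σ.real (lists K.top + n + i * len + s) = K.val i s

namespace Code
open Program

/-- Fill in one row of the tables. -/
def fillRow (M q : ℕ) : Program := block [
  .setNat (.lit 4) (.lit 0),
  .loop (.natLe (reg 4 + .lit 1) (reg 6)) (block [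
    stage M q,
    .setNat (.lit 4) (reg 4 + .lit 1)])]

/-- The whole row is written, but only the entries with `s ≤ i * b` are asserted to be correct: they
refer to encodings up to `(i + 1) * b`, the correct part of the next row. Before item `i` at most
`i` bins are open, so larger encodings never occur. -/
lemma run_fillRow {D : Instance} {i b : ℕ} {σ : Mem} (hi : i < D.items)
    (hb : b = D.base ^ (D.top - 1))
    (hw : ∀ ℓ ≤ D.top, σ.nat (30 + ℓ) = D.wt ℓ)
    (hp : ∀ k ≤ D.top, σ.real (30 + k) = D.oracle.prob D.res i k)
    (hC : σ.real 2 = D.penalty) (h5 : 31 + D.top ≤ σ.nat 5) (h6 : σ.nat 6 = D.base ^ D.top)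
    (hv : ∀ t ≤ (i + 1) * b, σ.real (σ.nat 5 + σ.nat 6 + t) = D.value (i + 1) t) :
    Run D.oracle (fillRow D.top D.tol) σ
      (300 * (D.base ^ D.top + 1) * (D.top + 1) * (D.top + D.base + 7)) fun τ =>
      (∀ a, a < 4 ∨ 4 < a → a < 7 ∨ 12 < a → a < σ.nat 5 ∨ σ.nat 5 + σ.nat 6 ≤ a →
        τ.nat a = σ.nat a) ∧
      (∀ a, a < 3 ∨ 5 < a → a < σ.nat 5 ∨ σ.nat 5 + σ.nat 6 ≤ a → τ.real a = σ.real a) ∧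
      (∀ s ≤ i * b, τ.nat (σ.nat 5 + s) = D.act i s ∧ τ.real (σ.nat 5 + s) = D.value i s) := by
  set S := D.base ^ D.top with hS
  set T := 200 * (D.top + 1) * (D.top + D.base + 7) with hT
  have hTS : 300 * (S + 1) * (D.top + 1) * (D.top + D.base + 7) = (S + 1) * T +
      100 * (S + 1) * ((D.top + 1) * (D.top + D.base + 7)) := by
    rw [hT]
    ring
  have hTT : 7 ≤ (D.top + 1) * (D.top + D.base + 7) := by nlinarith
  refine Run.cons 3 (S * (T + 14 + 7) + 20) ?_ (Run.straight_le (by simp [Straight])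
    (by simp [steps]) (Run.singleton (T := S * (T + 14 + 7) + 19)
    (Run.mono (Run.loop_le (T + 14) S le_rfl (by simp)
      (fun k τ => (∀ a, a < 4 ∨ 4 < a → a < 7 ∨ 12 < a → a < σ.nat 5 ∨ σ.nat 5 + S ≤ a →
          τ.nat a = σ.nat a) ∧
        (∀ a, a < 3 ∨ 5 < a → a < σ.nat 5 ∨ σ.nat 5 + S ≤ a → τ.real a = σ.real a) ∧
        τ.nat 4 = k ∧
        (∀ s < k, s ≤ i * b → τ.nat (σ.nat 5 + s) = D.act i s ∧
          τ.real (σ.nat 5 + s) = D.value i s)) ?_ ?_ ?_) le_rfl fun τ h => ?_)))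
  · rw [hTS]
    nlinarith
  · rintro k τ hk ⟨h1, h2, h3, h4⟩
    have t5 : τ.nat 5 = σ.nat 5 := h1 5 (by omega) (by omega) (by omega)
    have t6 : τ.nat 6 = S := by rw [h1 6 (by omega) (by omega) (by omega), h6]
    -- For `f` the actual content of the memory is taken, meaningful or not; correctness of the next
    -- row enters only in `hscan`.
    have hready : StageReady D i k (fun t => τ.real (σ.nat 5 + S + t)) τ := by
      refine ⟨fun ℓ hℓ => ?_, fun l hl => ?_, ?_, by omega, h3, fun t _ => by rw [t5, t6]⟩
      · rw [h1 _ (by omega) (by omega) (by omega), hw ℓ hℓ]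
      · rw [h2 _ (by omega) (by omega), hp l hl]
      · rw [h2 _ (by omega) (by omega), hC]
    refine ⟨?_, Run.cons T 14 (by omega) ((run_stage hready hk).mono le_rfl ?_)⟩
    · simp only [Test.holds_natLe, NatExp.eval_add, NatExp.eval_reg, NatExp.eval_lit, h3, t6]
      omega
    rintro ρ ⟨g1, g2, g3, g4⟩
    rw [t5] at g1 g2 g3 g4
    refine Run.straight_le (by simp [block, Straight]) (by simp [block, steps]) ?_
    simp only [block, result, NatExp.eval_lit, NatExp.eval_add, NatExp.eval_reg, Mem.setN_nat,
      Mem.setN_real]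
    refine ⟨fun a ha ha' ha'' => ?_, fun a ha ha' => ?_, ?_, fun s hs hsb => ?_⟩
    · rw [if_neg (by omega), g1 a ha' (by omega), h1 a ha ha' ha'']
    · rw [g2 a ha (by omega), h2 a ha ha']
    · rw [if_pos trivial, g1 4 (by omega) (by omega), h3]
    · rw [if_neg (by omega)]
      by_cases hsk : s = k
      · subst hsk
        have hscan : D.scan (fun t => τ.real (σ.nat 5 + S + t)) i s D.top =
            D.scan (D.value (i + 1)) i s D.top := by
          refine D.scan_congr (fun t ht => ?_) _
          rw [← hb] at ht
          rw [h2 _ (by omega) (by omega), ← h6, hv t (by rw [Nat.succ_mul]; omega)]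
        rw [g3, g4, hscan, D.value_eq hi]
        exact ⟨rfl, rfl⟩
      · rw [g1 _ (by omega) (by omega), g2 _ (by omega) (by omega)]
        exact h4 s (by omega) hsb
  · rintro τ ⟨h1, -, h3, -⟩
    simp only [Test.holds_natLe, NatExp.eval_add, NatExp.eval_reg, NatExp.eval_lit, h3,
      h1 6 (by omega) (by omega) (by omega), h6]
    omega
  · simp only [result, NatExp.eval_lit, Mem.setN_nat, Mem.setN_real]
    exact ⟨fun a ha _ _ => if_neg (by omega), fun a _ _ => trivial, if_pos trivial, by omega⟩
  · rw [h6]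
    refine ⟨h.1, h.2.1, fun s hs => h.2.2.2 s ?_ hs⟩
    refine hs.trans_lt ?_
    have : 0 < D.base ^ (D.top - 1) := Nat.pow_pos (by simp [Instance.base])
    -- The correct entries fit into a row, because `i < base`.
    calc i * b < D.base * D.base ^ (D.top - 1) := by
          rw [hb]
          refine Nat.mul_lt_mul_of_pos_right ?_ this
          simp only [Instance.base]
          omega
      _ = S := by
          rw [← pow_succ', hS]
          congr 1

/-- A bound for the time it takes to fill in the tables. -/
def fillTime (n B M : ℕ) : ℕ := 1000 * (n + 1) * (B ^ M + 1) * (M + 2) * (M + B + 7)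

/-- The tables have been filled in from row `i` on. -/
structure Filling (D : Instance) (i : ℕ) (σ : Mem) : Prop where
  tables : Tables D.controller D.items (D.base ^ D.top) (D.base ^ (D.top - 1)) i σ
  items : σ.nat 1 = D.items
  item : σ.nat 3 = i
  row : σ.nat 5 = lists D.top + D.items + i * D.base ^ D.top
  lists : ∀ a, lists D.top ≤ a → a < BinPacking.lists D.top + D.items →
    σ.nat a = 0 ∧ σ.real a = 0

/-- A frame argument: rows do not overlap, and everything outside the new row that matters later is
untouched. -/
lemma Filling.of_next {D : Instance} {i : ℕ} {σ τ : Mem} (h : Filling D (i + 1) σ)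
    (h3 : τ.nat 3 = i) (h5 : τ.nat 5 = BinPacking.lists D.top + D.items + i * D.base ^ D.top)
    (hn : ∀ a, a = 1 ∨ a = 6 ∨ 13 ≤ a → a < τ.nat 5 ∨ τ.nat 5 + D.base ^ D.top ≤ a →
      τ.nat a = σ.nat a)
    (hr : ∀ a, a = 2 ∨ 31 + D.top ≤ a → a < τ.nat 5 ∨ τ.nat 5 + D.base ^ D.top ≤ a →
      τ.real a = σ.real a)
    (hrow : ∀ s ≤ i * D.base ^ (D.top - 1),
      τ.nat (τ.nat 5 + s) = D.act i s ∧ τ.real (τ.nat 5 + s) = D.value i s) : Filling D i τ := by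
  have hlists : BinPacking.lists D.top = 32 + 2 * D.top := rfl
  obtain ⟨⟨t1, t2, t3, t4, t5⟩, h1, -, -, h0⟩ := h
  rw [h5] at hn hr hrow
  rw [show D.controller.top = D.top from rfl] at t1 t4 t5
  set S := D.base ^ D.top
  have hS : ∀ i', i + 1 ≤ i' → i * S + S ≤ i' * S := fun i' h => by
    rw [← Nat.succ_mul]
    exact Nat.mul_le_mul_right _ h
  refine ⟨⟨?_, ?_, ?_, ?_, ?_⟩, ?_, h3, h5, ?_⟩
  · intro ℓ hℓ
    have hℓ' : ℓ ≤ 2 * D.top + 1 := hℓ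
    rw [hn _ (by omega) (by omega), t1 ℓ hℓ']
  · rw [hr _ (by omega) (by omega), t2]
  · rw [hn _ (by omega) (by omega), t3]
  · intro i' s hi' hn' hs
    change τ.nat (BinPacking.lists D.top + D.items + i' * S + s) = _
    rcases Nat.lt_or_ge i i' with hlt | hge
    · have := hS i' hlt
      rw [hn _ (by omega) (by omega), t4 i' s hlt hn' hs]
    · obtain rfl : i' = i := by omega
      exact (hrow s hs).1
  · intro i' s hi' hn' hs
    change τ.real (BinPacking.lists D.top + D.items + i' * S + s) = _
    rcases Nat.lt_or_ge i i' with hlt | hge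
    · have := hS i' hlt
      rw [hr _ (by omega) (by omega), t5 i' s hlt hn' hs]
    · obtain rfl : i' = i := by omega
      exact (hrow s hs).2
  · rw [hn _ (by omega) (by omega), h1]
  · intro a ha ha'
    rw [hn _ (by omega) (by omega), hr _ (by omega) (by omega)]
    exact h0 a ha ha'

/-- Proceed to the previous item and fill in its row of the tables. -/
def fillPrevious (N q M : ℕ) : Program := block [
  block [.setNat (.lit 3) (reg 3 - .lit 1), .setNat (.lit 5) (reg 5 - reg 6)],
  rounding N M,
  fillRow M q]

lemma run_fillPrevious {D : Instance} {i : ℕ} {σ : Mem} (h : Filling D (i + 1) σ)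
    (hi : i < D.items) :
    Run D.oracle (fillPrevious D.res D.tol D.top) σ
      (300 * (D.base ^ D.top + 1) * (D.top + 1) * (D.top + D.base + 7) + 200 * (D.top + 2) + 30)
      (Filling D i) := by
  have hlists : lists D.top = 32 + 2 * D.top := rfl
  have htw : ∀ ℓ ≤ 2 * D.top + 1, σ.nat (30 + ℓ) = D.wt ℓ := h.tables.weight
  have h6 : σ.nat 6 = D.base ^ D.top := h.tables.length
  have htv : ∀ s ≤ (i + 1) * D.base ^ (D.top - 1),
      σ.real (lists D.top + D.items + (i + 1) * D.base ^ D.top + s) = D.value (i + 1) s :=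
    fun s hs => h.tables.val (i + 1) s le_rfl hi hs
  have h5 := h.row
  rw [add_mul, one_mul] at h5
  have h5' : σ.nat 5 - σ.nat 6 = lists D.top + D.items + i * D.base ^ D.top := by omega
  refine Run.cons 20 (300 * (D.base ^ D.top + 1) * (D.top + 1) * (D.top + D.base + 7) +
    200 * (D.top + 2) + 10) (by omega)
    (Run.straight_le (by simp [block, Straight]) (by simp [block, steps]) ?_)
  set τ₁ := (block [.setNat (.lit 3) (reg 3 - .lit 1),
    .setNat (.lit 5) (reg 5 - reg 6)]).result D.oracle σ with hτ₁
  have c1 : ∀ a, a ≠ 3 → a ≠ 5 → τ₁.nat a = σ.nat a := by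
    intro a h3 h5
    simp [hτ₁, block, result, h3, h5]
  have c3 : τ₁.nat 3 = i := by simp [hτ₁, block, result, h.item]
  have c5 : τ₁.nat 5 = lists D.top + D.items + i * D.base ^ D.top := by
    rw [← h5']
    simp [hτ₁, block, result]
  have cr : τ₁.real = σ.real := by simp [hτ₁, block, result]
  clear_value τ₁
  refine Run.cons (200 * (D.top + 2))
    (300 * (D.base ^ D.top + 1) * (D.top + 1) * (D.top + D.base + 7) + 10) (by omega)
    (run_rounding.mono le_rfl ?_)
  rintro τ₂ ⟨d1, d2, d3⟩
  rw [c3] at d3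
  have d5 : τ₂.nat 5 = lists D.top + D.items + i * D.base ^ D.top := by rw [d1 5 (by decide), c5]
  have d6 : τ₂.nat 6 = D.base ^ D.top := by
    rw [d1 6 (by decide), c1 6 (by decide) (by decide), h6]
  refine (Run.singleton ((run_fillRow (i := i) hi rfl ?_ d3 ?_ (by omega) d6
    ?_).mono le_rfl ?_)).mono
    (T := 300 * (D.base ^ D.top + 1) * (D.top + 1) * (D.top + D.base + 7) + 1) (by omega)
    fun _ h => h
  · intro ℓ hℓ
    rw [d1 _ (by omega), c1 _ (by omega) (by omega), htw ℓ (by omega)]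
  · rw [d2 _ (by omega) (by omega), cr]
    exact h.tables.penalty
  · intro t ht
    rw [d2 _ (by omega) (by omega), cr, d5, d6, ← htv t ht, add_mul i 1 (D.base ^ D.top), one_mul]
    ring_nf
  rintro τ₃ ⟨f1, f2, f3⟩
  have f5 : τ₃.nat 5 = τ₂.nat 5 := f1 5 (by omega) (by omega) (by omega)
  rw [← f5] at f1 f2 f3
  rw [d6] at f1 f2
  have h35 : 32 ≤ τ₃.nat 5 := by omega
  refine h.of_next ?_ (f5.trans d5) (fun a ha ha' => ?_) (fun a ha ha' => ?_) f3
  · rw [f1 _ (by omega) (by omega) (by omega), d1 _ (by omega), c3]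
  · rw [f1 _ (by omega) (by omega) ha', d1 _ (by omega), c1 _ (by omega) (by omega)]
  · rw [f2 _ (by omega) ha', d2 _ (by omega) (by omega), cr]

/-- Fill in the tables, where cell `1` holds the number of items. -/
def fill (N q M : ℕ) : Program := block [
  .setNat (.lit 2) (reg 1 + reg 1 + .lit 1),
  powers M,
  addTimes 5 6 1,
  .setNat (.lit 3) (reg 1),
  .loop (.natLe (.lit 1) (reg 3)) (fillPrevious N q M),
  .setNat (.lit 4) (.lit 0)]

/-- All terms are compared with the monomials `n S P`, `n P`, `S P` and `P`, so that the final
inequality is linear in them. -/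
lemma fillTime_spec (n B M : ℕ) (hn : n ≤ B) : 10 + (60 * (M + 1) * (B + 2) + 30 * (n + 1) + 10 +
    (n * (300 * (B ^ M + 1) * (M + 1) * (M + B + 7) + 200 * (M + 2) + 30 + 4) + 20) + 10) ≤
    fillTime n B M := by
  set S := B ^ M
  set P := (M + 2) * (M + B + 7) with hP
  have e1 : fillTime n B M = 1000 * (n * (S * P)) + 1000 * (n * P) + 1000 * (S * P) + 1000 * P := by
    rw [fillTime, hP]
    ring
  have e2 : (M + 1) * (M + B + 7) ≤ P := by
    rw [hP]
    gcongr
    omega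
  have e3 : M + 2 ≤ P := Nat.le_mul_of_pos_right _ (by omega)
  have e4 : (M + 1) * (B + 2) ≤ P := by
    rw [hP]
    gcongr <;> omega
  have e5 : n + 1 ≤ P := (show n + 1 ≤ M + B + 7 by omega).trans (Nat.le_mul_of_pos_left _ (by omega))
  have e6 : n * (300 * (S + 1) * (M + 1) * (M + B + 7) + 200 * (M + 2) + 30 + 4) ≤
      n * (300 * (S + 1) * P + 220 * P) := by
    refine Nat.mul_le_mul_left _ ?_
    rw [mul_assoc (300 * (S + 1))]
    have := Nat.mul_le_mul_left (300 * (S + 1)) e2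
    have e9 : 2 ≤ M + 2 := by omega
    linarith
  have e7 : n * (300 * (S + 1) * P + 220 * P) = 300 * (n * (S * P)) + 520 * (n * P) := by ring
  have e8 : 60 * (M + 1) * (B + 2) = 60 * ((M + 1) * (B + 2)) := by ring
  rw [e1, e8]
  omega

lemma run_fill {D : Instance} {σ : Mem}
    (h0 : ∀ a, 1 < a → a ≠ 5 → σ.nat a = 0) (h1 : σ.nat 1 = D.items)
    (h5 : σ.nat 5 = lists D.top + D.items) (hC : σ.real 2 = D.penalty)
    (hr : ∀ a, 2 < a → σ.real a = 0) :
    Run D.oracle (fill D.res D.tol D.top) σ (fillTime D.items D.base D.top) fun τ =>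
      Filling D 0 τ ∧ τ.nat 4 = 0 := by
  set S := D.base ^ D.top with hS
  have hlists : lists D.top = 32 + 2 * D.top := rfl
  have hT := fillTime_spec D.items D.base D.top (by simp only [Instance.base]; omega)
  rw [← hS] at hT
  set T := 300 * (S + 1) * (D.top + 1) * (D.top + D.base + 7) + 200 * (D.top + 2) + 30
  refine Run.cons 10 (60 * (D.top + 1) * (D.base + 2) + 30 * (D.items + 1) + 10 +
    (D.items * (T + 4) + 20) + 10) hT
    (Run.straight_le (by simp [Straight]) (by simp [steps]) ?_)
  set σ₁ := (Program.setNat (.lit 2) (reg 1 + reg 1 + .lit 1)).result D.oracle σ with hσ₁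
  have e1 : ∀ a, σ₁.nat a = if a = 2 then D.base else σ.nat a := by
    intro a
    simp only [hσ₁, result, NatExp.eval_lit, NatExp.eval_add, NatExp.eval_reg, Mem.setN_nat, h1,
      Instance.base]
    congr 1
    omega
  have e1r : σ₁.real = σ.real := rfl
  clear_value σ₁
  have e12 : σ₁.nat 2 = D.base := e1 2
  refine Run.cons (60 * (D.top + 1) * (D.base + 2)) (30 * (D.items + 1) + 10 +
    (D.items * (T + 4) + 20) + 10) (by omega)
    (run_powers.mono (by rw [e12]) ?_)
  rintro σ₂ ⟨p1, p2, p3, p4⟩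
  have p11 : σ₂.nat 1 = D.items := by
    rw [p1 1 (by omega) (by omega), e1, if_neg (by decide), h1]
  have p15 : σ₂.nat 5 = lists D.top + D.items := by
    rw [p1 5 (by omega) (by omega), e1, if_neg (by decide), h5]
  refine Run.cons (30 * (D.items + 1)) (10 + (D.items * (T + 4) + 20) + 10) (by omega)
    ((run_addTimes (by decide) (by decide)
      (by decide) (by decide) (by decide)).mono (by rw [p11]) ?_)
  rintro σ₃ ⟨a1, a2, a3⟩
  rw [p11, p3, p15, e12] at a3
  refine Run.cons 5 (5 + (D.items * (T + 4) + 20) + 10) (by omega)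
    (Run.straight_le (by simp [Straight]) (by simp [steps]) ?_)
  set σ₄ := (Program.setNat (.lit 3) (reg 1)).result D.oracle σ₃ with hσ₄
  have b1 : ∀ a, a ≠ 3 → σ₄.nat a = σ₃.nat a := by
    intro a ha
    simp [hσ₄, result, ha]
  have b3 : σ₄.nat 3 = D.items := by simp [hσ₄, result, a1, p11]
  have br : σ₄.real = σ.real := by
    rw [show σ₄.real = σ₃.real from rfl, a2, p2, e1r]
  clear_value σ₄
  have b0 : ∀ a, 15 ≤ a → a < 31 ∨ 30 + D.top < a → σ₄.nat a = 0 := by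
    intro a ha ha'
    rw [b1 a (by omega), a1 a (by omega) (by omega), p1 a (by omega) ha', e1, if_neg (by omega),
      h0 a (by omega) (by omega)]
  refine Run.cons (D.items * (T + 4) + 20) 10 (by omega)
    ((Run.loop_le T D.items le_rfl (by simp) (fun k => Filling D (D.items - k)) ?_ ?_ ?_).mono
      le_rfl ?_)
  · intro k τ hk h
    have e : D.items - k = D.items - (k + 1) + 1 := by omega
    refine ⟨?_, run_fillPrevious (e ▸ h) (by omega)⟩
    simp only [Test.holds_natLe, NatExp.eval_reg, NatExp.eval_lit, h.item]
    omega
  · intro τ h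
    simp only [Test.holds_natLe, NatExp.eval_reg, NatExp.eval_lit, h.item]
    omega
  · rw [Nat.sub_zero]
    refine ⟨⟨fun ℓ hℓ => ?_, ?_, ?_, fun i s h h' => by omega, fun i s h h' hs => ?_⟩, ?_, b3,
      ?_, fun a ha ha' => ⟨?_, ?_⟩⟩
    -- The cells of level `0` and of the levels above `top` have never been written and hold the
    -- required weight `0`.
    · change σ₄.nat (30 + ℓ) = weight D.base D.top ℓ
      rw [weight]
      split_ifs with hl
      · rw [b1 _ (by omega), a1 _ (by omega) (by omega), show 30 + ℓ = 31 + (ℓ - 1) by omega,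
          p4 _ (by omega), e12]
      · exact b0 _ (by omega) (by omega)
    · rw [br, hC]
      rfl
    · rw [b1 _ (by omega), a1 _ (by omega) (by omega), p3, e12]
    · change σ₄.real (lists D.top + D.items + i * S + s) = D.value i s
      obtain rfl : i = D.items := by omega
      -- The row behind the last item need not be written: it is identically zero, like the initial
      -- memory.
      rw [br, hr _ (by omega), D.value_last]
    · rw [b1 _ (by omega), a1 _ (by omega) (by omega), p11]
    · rw [b1 _ (by omega), a3]
    · exact b0 _ (by omega) (by omega)
    · rw [br, hr _ (by omega)]
  · intro τ h
    rw [Nat.sub_self] at h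
    refine Run.straight_le (by simp [block, Straight]) (by simp [block, steps]) ?_
    simp only [block, result, NatExp.eval_lit]
    have hne : ∀ a, a ≠ 4 → (τ.setN 4 0).nat a = τ.nat a := fun a ha => by
      rw [Mem.setN_nat, if_neg ha]
    obtain ⟨ht, t1, t3, t5, t0⟩ := h
    refine ⟨⟨⟨fun ℓ hℓ => ?_, ht.penalty, ?_, fun i s h h' hs => ?_, ht.val⟩, ?_, ?_, ?_,
      fun a ha ha' => ⟨?_, (t0 a ha ha').2⟩⟩, by simp⟩
    · rw [hne _ (by omega), ht.weight ℓ hℓ]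
    · rw [hne _ (by omega), ht.length]
    · rw [hne _ (by rw [lists]; omega), ht.act i s h h' hs]
    · rw [hne _ (by omega), t1]
    · rw [hne _ (by omega), t3]
    · rw [hne _ (by omega), t5]
    · rw [hne _ (by omega), (t0 a ha ha').1]

end Code
end BinPacking

/-! ### Evaluation of the policy: the choice of a bin. -/

namespace BinPacking

lemma Tables.congr {K : Controller} {n len b lo : ℕ} {σ τ : Mem} (h : Tables K n len b lo σ)
    (hn : ∀ a, a = 6 ∨ 30 ≤ a → a < lists K.top ∨ lists K.top + n ≤ a → τ.nat a = σ.nat a)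
    (hr : ∀ a, a = 2 ∨ lists K.top + n ≤ a → τ.real a = σ.real a) : Tables K n len b lo τ := by
  have hlists : lists K.top = 32 + 2 * K.top := rfl
  refine ⟨fun ℓ hℓ => ?_, ?_, ?_, fun i s h1 h2 h3 => ?_, fun i s h1 h2 h3 => ?_⟩
  · rw [hn _ (by omega) (by omega), h.weight ℓ hℓ]
  · rw [hr _ (by omega), h.penalty]
  · rw [hn _ (by omega) (by omega), h.length]
  · rw [hn _ (by omega) (by omega), h.act i s h1 h2 h3]
  · rw [hr _ (by omega), h.val i s h1 h2 h3]

/-- The memory before the bin of item `i` is chosen. -/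
structure Awaits (K : Controller) (n len b i : ℕ) (S : Config n) (σ : Mem) : Prop where
  tables : Tables K n len b 0 σ
  item : σ.nat 3 = i
  code : σ.nat 4 = S.1.2
  row : σ.nat 5 = lists K.top + n + i * len
  lev : ∀ j : Fin n, σ.nat (lists K.top + j) = S.1.1 j
  dev : ∀ j : Fin n, σ.real (lists K.top + j) = S.2 j

lemma Awaits.congr {K : Controller} {n len b i : ℕ} {S : Config n} {σ τ : Mem}
    (h : Awaits K n len b i S σ) (hn : ∀ a, a < 7 ∨ 30 ≤ a → 0 < a → τ.nat a = σ.nat a)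
    (hr : ∀ a, a = 2 ∨ 30 ≤ a → τ.real a = σ.real a) : Awaits K n len b i S τ := by
  have hlists : lists K.top = 32 + 2 * K.top := rfl
  refine ⟨h.tables.congr (fun a ha _ => hn a (by omega) (by omega)) fun a ha => hr a (by omega),
    ?_, ?_, ?_, fun j => ?_, fun j => ?_⟩
  · rw [hn _ (by omega) (by omega), h.item]
  · rw [hn _ (by omega) (by omega), h.code]
  · rw [hn _ (by omega) (by omega), h.row]
  · rw [hn _ (by omega) (by omega), h.lev]
  · rw [hr _ (by omega), h.dev]

/-- The memory after the bin of item `i` has been chosen. -/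
structure Packed (K : Controller) (n len b : ℕ) (i : Fin n) (S : Config n) (σ : Mem) : Prop where
  awaits : Awaits K n len b (i + 1) ((K.levels i S, K.rest i S), S.2) σ
  bin : σ.nat 15 = K.bin i S
  level : σ.nat 7 = K.level i S

namespace Code
open Program

/-- Search for a bin of the level in cell `7`. -/
def searchBin (M : ℕ) : Program := block [
  block [.setNat (.lit 15) (reg 3), .setNat (.lit 14) (.lit 0)],
  .loop (.natLe (reg 14 + .lit 1) (reg 3)) (block [
    .cond (.natLe (.cell (.lit (lists M) + reg 14)) (reg 7))
      (.cond (.natLe (reg 7) (.cell (.lit (lists M) + reg 14))) (.setNat (.lit 15) (reg 14)) .skip)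
      .skip,
    .setNat (.lit 14) (reg 14 + .lit 1)])]

lemma run_searchBin {O : Oracle} {n M : ℕ} {i : Fin n} {lev : Fin n → ℕ} {σ : Mem}
    (h3 : σ.nat 3 = i) (hlev : ∀ j : Fin n, σ.nat (lists M + j) = lev j) :
    Run O (searchBin M) σ (50 * (n + 1)) fun τ =>
      (∀ a, a ≠ 14 → a ≠ 15 → τ.nat a = σ.nat a) ∧ τ.real = σ.real ∧
      τ.nat 15 = search lev (σ.nat 7) i i := by
  have hM : 32 ≤ lists M := by rw [lists]; omega
  refine Run.cons 8 (n * 37 + 20) (by omega)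
    (Run.straight_le (by simp [block, Straight]) (by simp [block, steps])
    (Run.singleton (T := n * 37 + 19)
    (Run.mono (Run.loop_le 30 i i.2.le (by simp) (fun k τ =>
      (∀ a, a ≠ 14 → a ≠ 15 → τ.nat a = σ.nat a) ∧ τ.real = σ.real ∧ τ.nat 14 = k ∧
        τ.nat 15 = search lev (σ.nat 7) i k) ?_ ?_ ?_) le_rfl fun τ h => ?_)))
  · rintro k τ hk ⟨h1, h2, h4, h5⟩
    have hkn : k < n := hk.trans i.2
    have hl : τ.nat (lists M + k) = lev ⟨k, hkn⟩ := by
      rw [h1 _ (by omega) (by omega), ← hlev]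
    refine ⟨?_, Run.straight_le (by simp [block, Straight]) (by simp [block, steps]) ?_⟩
    · simp only [Test.holds_natLe, NatExp.eval_add, NatExp.eval_reg, NatExp.eval_lit, h4,
        h1 3 (by decide) (by decide), h3]
      omega
    · simp only [block, result, NatExp.eval_lit, NatExp.eval_add, NatExp.eval_reg,
        NatExp.eval_cell, Test.holds_natLe, h4, h1 7 (by decide) (by decide), hl]
      rw [search, dif_pos hkn]
      by_cases hle : lev ⟨k, hkn⟩ ≤ σ.nat 7 <;> by_cases hge : σ.nat 7 ≤ lev ⟨k, hkn⟩
      · rw [if_pos hle, if_pos hge, if_pos (le_antisymm hle hge)]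
        refine ⟨fun a ha ha' => ?_, h2, by simp [h4], by simp⟩
        simp [ha, ha', h1 a ha ha']
      · rw [if_pos hle, if_neg hge, if_neg (by omega)]
        refine ⟨fun a ha ha' => ?_, h2, by simp [h4], by simp [h5]⟩
        simp [ha, h1 a ha ha']
      · rw [if_neg hle, if_neg (by omega)]
        refine ⟨fun a ha ha' => ?_, h2, by simp [h4], by simp [h5]⟩
        simp [ha, h1 a ha ha']
      · omega
  · rintro τ ⟨h1, -, h4, -⟩
    simp only [Test.holds_natLe, NatExp.eval_add, NatExp.eval_reg, NatExp.eval_lit, h4,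
      h1 3 (by decide) (by decide), h3]
    omega
  · simp only [block, result, NatExp.eval_lit, NatExp.eval_reg, Mem.setN_nat, Mem.setN_real]
    refine ⟨fun a ha ha' => by rw [if_neg ha, if_neg ha'], trivial, if_pos trivial, ?_⟩
    simp [h3, search]
  · exact ⟨h.1, h.2.1, h.2.2.2⟩

/-- Choose the bin of the current item. -/
def choose (M q : ℕ) : Program := block [
  .setNat (.lit 7) (.cell (reg 5 + reg 4)),
  searchBin M,
  block [
    .setNat (.lit 4) (reg 4 - .cell (.lit 30 + reg 7)),
    .cond (.realLe (.cell (.lit (lists M) + reg 15)) (.lit q)) .skip (block [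
      .setNat (.lit (lists M) + reg 15) (.lit (M + 1)),
      .setNat (.lit 15) (reg 3)]),
    .setNat (.lit 7) (reg 7 + (.lit 1 - reg 7)),
    .setNat (.lit 3) (reg 3 + .lit 1),
    .setNat (.lit 5) (reg 5 + reg 6),
    .setNat (.lit 0) (reg 15)]]

/-- The item counter and the row pointer are advanced already here, because the observation of the
size needs the values of the next row. The bound on the encoding keeps the lookup in the correct
part of the table. -/
lemma run_choose {O : Oracle} {K : Controller} {n len b : ℕ} {i : Fin n} {S : Config n} {σ : Mem}
    (h : Awaits K n len b i S σ) (hact : K.target i S ≤ K.top) (hs : S.1.2 ≤ i * b) :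
    Run O (choose K.top K.tol) σ (50 * (n + 4)) fun τ =>
      Packed K n len b i S τ ∧ τ.nat 0 = K.bin i S := by
  have hlists : lists K.top = 32 + 2 * K.top := rfl
  refine Run.cons 10 (50 * (n + 3) + 20) (by omega) (Run.straight_le (by simp [Straight])
    (by simp [steps]) ?_)
  have hact' : σ.nat (σ.nat 5 + σ.nat 4) = K.target i S := by
    rw [h.row, h.code, h.tables.act i _ (Nat.zero_le _) i.2 hs]
    rfl
  simp only [result, NatExp.eval_lit, NatExp.eval_cell, NatExp.eval_add, NatExp.eval_reg, hact']
  have h' : Awaits K n len b i S (σ.setN 7 (K.target i S)) :=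
    h.congr (fun a ha _ => by rw [Mem.setN_nat, if_neg (by omega)]) fun a _ => rfl
  refine Run.cons (50 * (n + 1)) 120 (by omega) ((run_searchBin h'.item h'.lev).mono le_rfl ?_)
  rw [Mem.setN_nat, if_pos rfl]
  rintro σ₂ ⟨g1, g2, g3⟩
  have g3' : σ₂.nat 15 = K.found i S := g3
  have k7 : σ₂.nat 7 = K.target i S := by rw [g1 7 (by decide) (by decide)]; simp
  replace h' : Awaits K n len b i S σ₂ := h'.congr (fun a ha _ => g1 a (by omega) (by omega))
    fun a _ => by rw [g2]
  clear g1 g2 g3 hact' h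
  refine (Run.singleton (T := 119) (Run.straight_le (by simp [block, Straight])
    (by simp [block, steps]) ?_))
  have hw : σ₂.nat (30 + K.target i S) = K.wt (K.target i S) := h'.tables.weight _ (by omega)
  simp only [block, result, NatExp.eval_lit, NatExp.eval_cell, NatExp.eval_add, NatExp.eval_sub,
    NatExp.eval_reg, Test.holds_realLe, RealExp.eval_cell, RealExp.eval_lit, Mem.setN_real,
    Mem.setN_nat, k7, hw, h'.code, g3']
  simp only [show (15 : ℕ) ≠ 4 by decide, show (3 : ℕ) ≠ 4 by decide, if_false, h'.dev, h'.item]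
  by_cases hd : S.2 (K.found i S) ≤ K.tol
  · have hbin : K.bin i S = K.found i S := if_pos hd
    have hlev : K.levels i S = S.1.1 := if_pos hd
    rw [if_pos hd]
    refine ⟨⟨⟨h'.tables.congr (fun a ha ha' => ?_) fun a _ => rfl, ?_, ?_, ?_, fun j => ?_, h'.dev⟩,
      ?_, ?_⟩, ?_⟩
    · simp only [Mem.setN_nat]
      rw [if_neg (by omega), if_neg (by omega), if_neg (by omega), if_neg (by omega),
        if_neg (by omega)]
    · simp [h'.item]
    · simp [Controller.rest]
    · simp [h'.row, h'.tables.length]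
      ring
    · simp only [Mem.setN_nat]
      rw [if_neg (by omega), if_neg (by omega), if_neg (by omega), if_neg (by omega),
        if_neg (by omega), h'.lev, hlev]
    · simp [g3', hbin]
    · simp [k7, Controller.level]
    · simp [g3', hbin]
  · have hbin : K.bin i S = i := if_neg hd
    have hlev : K.levels i S = Function.update S.1.1 (K.found i S) (K.top + 1) := if_neg hd
    rw [if_neg hd]
    have hj : (K.found i S : ℕ) < n := (K.found i S).2
    set j := K.found i S
    have hne : ∀ a, a < 30 → a ≠ lists K.top + (j : ℕ) := fun a ha => by omega
    refine ⟨⟨⟨h'.tables.congr (fun a ha ha' => ?_) fun a _ => rfl, ?_, ?_, ?_, fun l => ?_, h'.dev⟩,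
      ?_, ?_⟩, ?_⟩
    · simp only [Mem.setN_nat]
      rw [if_neg (by omega), if_neg (by omega), if_neg (by omega), if_neg (by omega),
        if_neg (by omega), if_neg (by omega), if_neg (by omega)]
    · simp [h'.item, hne]
    · simp [Controller.rest, hne]
    · simp [h'.row, h'.tables.length, hne]
      ring
    · simp only [Mem.setN_nat]
      rw [if_neg (by omega), if_neg (by omega), if_neg (by omega), if_neg (by omega),
        if_neg (by omega), hlev, Function.update_apply]
      by_cases hlj : l = j
      · rw [if_pos hlj, if_pos (by rw [hlj])]
      · rw [if_neg hlj, if_neg fun e => hlj (Fin.ext (by omega)), if_neg (by omega), h'.lev]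
    · simp [hbin, hne]
    · simp [k7, Controller.level, hne]
    · simp [hbin, hne]

end Code
end BinPacking

/-! ### Evaluation of the policy: the observation of a size. -/

namespace BinPacking
namespace Code
open Program

/-- Compute the integer part of the size that has been revealed, up to the bound `M`. -/
def integerPart (N M : ℕ) : Program := block [
  block [.setReal (.lit 4) (.lit N * rreg 0),
    .setReal (.lit 3) (.cell (.lit (lists M) + reg 15) + rreg 4),
    .setReal (.lit 6) (.lit 0), .setNat (.lit 9) (.lit 0), .setNat (.lit 14) (.lit 0)],
  .loop (.natLe (reg 14 + .lit 1) (.lit M)) (block [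
    .cond (.realLe (rreg 6 + .lit 1) (rreg 4))
      (block [.setReal (.lit 6) (rreg 6 + .lit 1), .setNat (.lit 9) (reg 9 + .lit 1)]) .skip,
    .setNat (.lit 14) (reg 14 + .lit 1)])]

/-- Reals cannot be rounded by the machine, so the integer part is counted up. Stopping at `M`
bounds the time for arbitrarily large sizes. -/
lemma run_integerPart {O : Oracle} {N M : ℕ} {σ : Mem} {x : ℝ≥0} (h0 : σ.real 0 = x) :
    Run O (integerPart N M) σ (60 * (M + 1)) fun τ =>
      (∀ a, a ≠ 9 → a ≠ 14 → τ.nat a = σ.nat a) ∧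
      (∀ a, a ≠ 3 → a ≠ 4 → a ≠ 6 → τ.real a = σ.real a) ∧
      τ.real 3 = σ.real (lists M + σ.nat 15) + N * x ∧
      τ.nat 9 = min ⌊(N * x : ℝ)⌋₊ M ∧ τ.real 6 = (min ⌊(N * x : ℝ)⌋₊ M : ℕ) := by
  have ht : (0 : ℝ) ≤ N * x := by positivity
  have hM : 32 ≤ lists M := by rw [lists]; omega
  set t : ℝ := N * x with htdef
  refine Run.cons 40 (M * 40 + 20) (by omega)
    (Run.straight_le (by simp [block, Straight]) (by simp [block, steps])
    (Run.singleton (T := M * 40 + 19)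
    (Run.mono (Run.loop_le 34 M le_rfl (by simp) (fun k τ =>
      (∀ a, a ≠ 9 → a ≠ 14 → τ.nat a = σ.nat a) ∧
      (∀ a, a ≠ 3 → a ≠ 4 → a ≠ 6 → τ.real a = σ.real a) ∧ τ.nat 14 = k ∧ τ.real 4 = t ∧
      τ.real 3 = σ.real (lists M + σ.nat 15) + t ∧
      τ.nat 9 = min ⌊t⌋₊ k ∧ τ.real 6 = (min ⌊t⌋₊ k : ℕ)) ?_ ?_ ?_) le_rfl fun τ h => ?_)))
  · rintro k τ hk ⟨h1, h2, h3, h4, h5, h6, h7⟩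
    refine ⟨?_, Run.straight_le (by simp [block, Straight]) (by simp [block, steps]) ?_⟩
    · simp only [Test.holds_natLe, NatExp.eval_add, NatExp.eval_reg, NatExp.eval_lit, h3]
      omega
    · have hiff : (τ.real 6 + 1 ≤ t) ↔ min ⌊t⌋₊ k + 1 ≤ ⌊t⌋₊ := by
        rw [h7, Nat.le_floor_iff ht]
        push_cast
        rfl
      simp only [block, result, NatExp.eval_lit, NatExp.eval_add, NatExp.eval_reg,
        Test.holds_realLe, RealExp.eval_add, RealExp.eval_rreg, RealExp.eval_lit, Nat.cast_one, h4,
        hiff]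
      by_cases hc : min ⌊t⌋₊ k + 1 ≤ ⌊t⌋₊
      · have e : min ⌊t⌋₊ (k + 1) = min ⌊t⌋₊ k + 1 := by omega
        rw [if_pos hc, e]
        refine ⟨fun a ha ha' => ?_, fun a ha ha' ha'' => ?_, ?_, ?_, ?_, ?_, ?_⟩
        · simp [ha, ha', h1]
        · simp [ha'', h2, ha, ha']
        · simp [h3]
        · simp [h4]
        · simp [h5]
        · simp [h6]
        · simp [h7]
      · have e : min ⌊t⌋₊ (k + 1) = min ⌊t⌋₊ k := by omega
        rw [if_neg hc, e]
        refine ⟨fun a ha ha' => ?_, h2, ?_, h4, h5, ?_, h7⟩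
        · simp [ha, ha', h1]
        · simp [h3]
        · simp [h6]
  · rintro τ ⟨-, -, h3, -⟩
    simp only [Test.holds_natLe, NatExp.eval_add, NatExp.eval_reg, NatExp.eval_lit, h3]
    omega
  · simp only [block, result, NatExp.eval_lit, NatExp.eval_add, NatExp.eval_reg, RealExp.eval_add,
      RealExp.eval_mul, RealExp.eval_cell, RealExp.eval_rreg, RealExp.eval_lit, h0]
    refine ⟨fun a ha ha' => ?_, fun a ha ha' ha'' => ?_, ?_, ?_, ?_, ?_, ?_⟩
    · simp [ha, ha']
    · simp [ha, ha', ha'']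
    · simp
    · simp [htdef]
    · have : lists M + σ.nat 15 ≠ 4 := by omega
      simp [htdef, this]
    · simp
    · simp
  · exact ⟨h.1, h.2.1, h.2.2.2.2.1, h.2.2.2.2.2.1, h.2.2.2.2.2.2⟩

/-- Take the size of the last item, which has been revealed, into account. -/
def observe (N q M : ℕ) : Program := block [
  integerPart N M,
  block [
    .setReal (.lit 3) (rreg 3 - rreg 6),
    .setReal (.lit 7) (.cell (reg 5 + (reg 4 + .cell (.lit 30 + (reg 7 + reg 9))))),
    .cond (.natLe (reg 7 + reg 9) (.lit M)) .skip (.setReal (.lit 7) (rreg 7 + rreg 2)),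
    .setReal (.lit 8) (.cell (reg 5 + (reg 4 + .cell (.lit 30 + (reg 7 + (reg 9 + .lit 1)))))),
    .cond (.natLe (reg 7 + (reg 9 + .lit 1)) (.lit M)) .skip (.setReal (.lit 8) (rreg 8 + rreg 2))],
  .cond (.realLe (rreg 7 + rreg 3 * rreg 3 / (.lit q * .lit q))
      (rreg 8 + ((rreg 3 - .lit 1) * (rreg 3 - .lit 1) - .lit 1) / (.lit q * .lit q)))
    .skip (block [.setNat (.lit 9) (reg 9 + .lit 1), .setReal (.lit 3) (rreg 3 - .lit 1)]),
  block [
    .setNat (.lit (lists M) + reg 15) (reg 7 + reg 9),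
    .setReal (.lit (lists M) + reg 15) (rreg 3),
    .setNat (.lit 4) (reg 4 + .cell (.lit 30 + (reg 7 + reg 9)))]]

lemma run_observe {O : Oracle} {K : Controller} {n len b : ℕ} {i : Fin n} {S : Config n} {σ : Mem}
    {x : ℝ≥0} (h : Packed K n len b i S σ) (hx : σ.real 0 = x) (hact : K.target i S ≤ K.top)
    (htop : 1 ≤ K.top) (hs : S.1.2 ≤ i * b) (hb : ∀ ℓ, K.wt ℓ ≤ b) :
    Run O (observe K.res K.tol K.top) σ (60 * (K.top + 5)) (Awaits K n len b (i + 1) (K.step i S x)) := by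
  have hlists : lists K.top = 32 + 2 * K.top := rfl
  obtain ⟨h, h15, h7⟩ := h
  have hL : K.level i S ≤ K.top := by rw [Controller.level]; omega
  have hrest : K.rest i S ≤ i * b := (Nat.sub_le _ _).trans hs
  have hF : K.floor x ≤ K.top := Nat.min_le_right _ _
  have hstep : K.step i S x = K.settle (i + 1) (K.levels i S) (K.rest i S) S.2 (K.bin i S)
    (K.level i S) x := rfl
  set j := K.bin i S
  set L := K.level i S
  set s := K.rest i S
  set F := K.floor x with hFdef
  have hj : (j : ℕ) < n := j.2
  refine Run.cons (60 * (K.top + 1)) 220 (by omega) ((run_integerPart hx).mono le_rfl ?_)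
  rw [h15, h.dev j]
  rintro σ₁ ⟨g1, g2, g3, g4, g5⟩
  replace g4 : σ₁.nat 9 = F := g4
  replace g5 : σ₁.real 6 = F := g5
  replace h := h.congr (τ := σ₁) (fun a ha _ => g1 a (by omega) (by omega))
    fun a ha => g2 a (by omega) (by omega) (by omega)
  rw [← g1 15 (by decide) (by decide)] at h15
  rw [← g1 7 (by decide) (by decide)] at h7
  clear g1 g2 hx
  -- Both candidates are found in memory: `L + F + 1 ≤ 2 * top + 1` is the range of the stored
  -- weights, and the encoding is at most `(i + 1) * b`, in the correct part of the row.
  have hest : ∀ m ≤ F + 1, K.estimate (i + 1) L s m =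
      σ₁.real (σ₁.nat 5 + (σ₁.nat 4 + σ₁.nat (30 + (L + m)))) +
        if L + m ≤ K.top then 0 else σ₁.real 2 := by
    intro m hm
    have hc : s + K.wt (L + m) ≤ (i + 1) * b := by
      have := hb (L + m)
      rw [add_mul, one_mul]
      omega
    rw [h.tables.weight _ (by omega), h.row, h.code, h.tables.penalty,
      h.tables.val _ _ (Nat.zero_le _) i.2 hc]
    rfl
  refine Run.cons 90 130 (by omega) (Run.straight_le (by simp [block, Straight])
    (by simp [block, steps]) ?_)
  set σ₂ := (block [
    .setReal (.lit 3) (rreg 3 - rreg 6),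
    .setReal (.lit 7) (.cell (reg 5 + (reg 4 + .cell (.lit 30 + (reg 7 + reg 9))))),
    .cond (.natLe (reg 7 + reg 9) (.lit K.top)) .skip (.setReal (.lit 7) (rreg 7 + rreg 2)),
    .setReal (.lit 8) (.cell (reg 5 + (reg 4 + .cell (.lit 30 + (reg 7 + (reg 9 + .lit 1)))))),
    .cond (.natLe (reg 7 + (reg 9 + .lit 1)) (.lit K.top)) .skip
      (.setReal (.lit 8) (rreg 8 + rreg 2))]).result O σ₁ with hσ₂
  have h5 : 32 ≤ σ₁.nat 5 := by rw [h.row]; omega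
  have h53 : ∀ a, σ₁.nat 5 + a ≠ 3 := fun a => by omega
  have h57 : ∀ a, σ₁.nat 5 + a ≠ 7 := fun a => by omega
  have e : σ₂.nat = σ₁.nat ∧ (∀ a, a ≠ 3 → a ≠ 7 → a ≠ 8 → σ₂.real a = σ₁.real a) ∧
      σ₂.real 3 = S.2 j + K.res * x - F ∧ σ₂.real 7 = K.estimate (i + 1) L s F ∧
      σ₂.real 8 = K.estimate (i + 1) L s (F + 1) := by
    rw [hest F (Nat.le_succ _), hest (F + 1) le_rfl]
    simp only [hσ₂, block, result, NatExp.eval_lit, NatExp.eval_cell, NatExp.eval_add,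
      NatExp.eval_reg, Test.holds_natLe, RealExp.eval_cell, RealExp.eval_rreg, RealExp.eval_sub,
      RealExp.eval_add, Mem.setR_nat, h7, g4]
    by_cases c1 : L + F ≤ K.top <;> by_cases c2 : L + (F + 1) ≤ K.top <;>
      simp +contextual [h7, g4, g3, g5, h53, h57, c1, c2]
  clear_value σ₂
  obtain ⟨e1, e2, e3, e4, e5⟩ := e
  replace h := h.congr (τ := σ₂) (fun a _ _ => by rw [e1])
    fun a ha => e2 a (by omega) (by omega) (by omega)
  rw [← e1] at g4 h15 h7
  clear e1 e2 hest h5 h53 h57 g3 g5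
  refine Run.cons 60 70 (by omega) (Run.straight_le (by simp [block, Straight])
    (by simp [block, steps]) ?_)
  set σ₃ := (Program.cond (.realLe (rreg 7 + rreg 3 * rreg 3 / (.lit K.tol * .lit K.tol))
      (rreg 8 + ((rreg 3 - .lit 1) * (rreg 3 - .lit 1) - .lit 1) / (.lit K.tol * .lit K.tol)))
    .skip (block [.setNat (.lit 9) (reg 9 + .lit 1),
      .setReal (.lit 3) (rreg 3 - .lit 1)])).result O σ₂ with hσ₃
  have hround : K.round (i + 1) L s (S.2 j) x ≤ F + 1 := by
    rw [Controller.round]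
    split_ifs <;> omega
  have f : (∀ a, a ≠ 9 → σ₃.nat a = σ₂.nat a) ∧ (∀ a, a ≠ 3 → σ₃.real a = σ₂.real a) ∧
      σ₃.nat 9 = K.round (i + 1) L s (S.2 j) x ∧
      σ₃.real 3 = S.2 j + K.res * x - K.round (i + 1) L s (S.2 j) x := by
    have hdown : K.Down (i + 1) L s (S.2 j) x ↔ (Test.realLe
        (rreg 7 + rreg 3 * rreg 3 / (.lit K.tol * .lit K.tol))
        (rreg 8 + ((rreg 3 - .lit 1) * (rreg 3 - .lit 1) - .lit 1) /
          (.lit K.tol * .lit K.tol))).Holds σ₂ := by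
      simp only [Test.holds_realLe, RealExp.eval_rreg, RealExp.eval_add, RealExp.eval_sub,
        RealExp.eval_mul, RealExp.eval_div, RealExp.eval_lit, e3, e4, e5, Nat.cast_one,
        Controller.Down, ← sq, ← hFdef]
    rw [hσ₃, result, Controller.round]
    by_cases hd : K.Down (i + 1) L s (S.2 j) x
    · rw [if_pos (hdown.1 hd), if_pos hd]
      exact ⟨fun _ _ => rfl, fun _ _ => rfl, g4, e3⟩
    · rw [if_neg (fun hh => hd (hdown.2 hh)), if_neg hd]
      simp only [block, result, NatExp.eval_lit, NatExp.eval_add, NatExp.eval_reg,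
        RealExp.eval_sub, RealExp.eval_rreg, RealExp.eval_lit]
      refine ⟨fun a ha => by simp [ha], fun a ha => by simp [ha], by simp [g4, hFdef], ?_⟩
      simp [e3, hFdef]
      ring
  clear_value σ₃
  obtain ⟨f1, f2, f3, f4⟩ := f
  replace h := h.congr (τ := σ₃) (fun a ha _ => f1 a (by omega)) fun a ha => f2 a (by omega)
  rw [← f1 15 (by decide)] at h15
  rw [← f1 7 (by decide)] at h7
  clear f1 f2 e3 e4 e5 g4
  rw [hstep, Controller.settle]
  set m := K.round (i + 1) L s (S.2 j) x
  have hwt : σ₃.nat (30 + (L + m)) = K.wt (L + m) := h.tables.weight _ (by omega)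
  refine (Run.singleton (T := 69) (Run.straight_le (by simp [block, Straight])
    (by simp [block, steps]) ?_))
  simp only [block, result, NatExp.eval_lit, NatExp.eval_cell, NatExp.eval_add, NatExp.eval_reg,
    RealExp.eval_rreg, Mem.setR_nat, Mem.setN_nat, Mem.setN_real, h15, h7, f3]
  rw [if_neg (show (15 : ℕ) ≠ lists K.top + j by omega),
    if_neg (show (7 : ℕ) ≠ lists K.top + j by omega),
    if_neg (show (9 : ℕ) ≠ lists K.top + j by omega),
    if_neg (show (4 : ℕ) ≠ lists K.top + j by omega),
    if_neg (show 30 + (L + m) ≠ lists K.top + j by omega), f4, hwt, h.code]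
  refine ⟨h.tables.congr (fun a ha ha' => ?_) fun a ha => ?_, ?_, ?_, ?_, fun l => ?_, fun l => ?_⟩
  · simp only [Mem.setN_nat, Mem.setR_nat]
    rw [if_neg (by omega), if_neg (by omega)]
  · simp only [Mem.setN_real, Mem.setR_real]
    rw [if_neg (by omega)]
  · simp only [Mem.setN_nat, Mem.setR_nat]
    rw [if_neg (by omega), if_neg (by omega), h.item]
  · simp
  · simp only [Mem.setN_nat, Mem.setR_nat]
    rw [if_neg (by omega), if_neg (by omega), h.row]
  · simp only [Mem.setN_nat, Mem.setR_nat]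
    rw [if_neg (by omega), Function.update_apply]
    by_cases hlj : l = j
    · rw [if_pos hlj, if_pos (by rw [hlj])]
    · rw [if_neg hlj, if_neg fun e => hlj (Fin.ext (by omega)), h.lev]
  · simp only [Mem.setN_real, Mem.setR_real]
    rw [Function.update_apply]
    by_cases hlj : l = j
    · rw [if_pos hlj, if_pos (by rw [hlj])]
    · rw [if_neg hlj, if_neg fun e => hlj (Fin.ext (by omega)), h.dev]

end Code
end BinPacking

/-! ### The complete algorithm. -/

namespace BinPacking
namespace Code
open Program
open Controller (extend)

/-- Take the size of the last item into account, if there is one. -/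
def update (N q M : ℕ) : Program := .cond (.natLe (.lit 1) (reg 3)) (observe N q M) .skip

/-- The program that evaluates a policy. -/
def decide (N q M : ℕ) : Program := block [update N q M, choose M q]

/-- A bound for the time it takes to pack an item. -/
def decideTime (n M : ℕ) : ℕ := 60 * (n + M + 12)

/-- Each item adds at most one weight to the encoding. -/
lemma config_code_le {K : Controller} {b : ℕ} (hb : ∀ ℓ, K.wt ℓ ≤ b) {n : ℕ} (x : ℕ → ℝ≥0)
    {m : ℕ} (hm : m ≤ n) : (K.config n x m).1.2 ≤ m * b := by
  induction m with
  | zero => exact Nat.zero_le _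
  | succ m ih =>
    rw [K.config_succ x ⟨m, hm⟩, Nat.succ_mul]
    exact Nat.add_le_add ((Nat.sub_le _ _).trans (ih (by omega))) (hb _)

/-- A size is processed only at the beginning of the next run of `decide`. The invariant therefore
says that `update` leads to a memory in state `Awaits`; before the first item `update` does nothing.
-/
lemma packs_decide {K : Controller} {n len b : ℕ} (hact : ∀ i s, K.act i s ≤ K.top)
    (htop : 1 ≤ K.top) (hb : ∀ ℓ, K.wt ℓ ≤ b) {σ : Mem}
    (h : Awaits K n len b 0 ((0, 0), 0) σ) (x : Fin n → ℝ≥0) :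
    ∃ t ≤ n * decideTime n K.top, Packs (decide K.res K.tol K.top) σ
      (List.ofFn fun i => (x i, ((K.policy n).bin x i : ℕ))) t := by
  set l := List.ofFn fun i => (x i, ((K.policy n).bin x i : ℕ)) with hl
  have hlen : l.length = n := by rw [hl, List.length_ofFn]
  suffices hs : ∀ r i σ, i + r = n → Run Oracle.none (update K.res K.tol K.top) σ
      (60 * (K.top + 6)) (Awaits K n len b i (K.config n (extend x) i)) →
      ∃ t ≤ r * decideTime n K.top, Packs (decide K.res K.tol K.top) σ (l.drop i) t from
    hs n 0 σ (Nat.zero_add n) ((Run.cond (T := 0) (T' := 1)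
      (fun hh => absurd hh (by simp [h.item])) (fun _ => Run.skip h)).mono (by simp; omega)
      fun _ h => h)
  intro r
  induction r with
  | zero =>
    intro i σ hi _
    rw [List.drop_of_length_le (by omega)]
    exact ⟨0, Nat.zero_le _, .nil σ⟩
  | succ r ih =>
    intro i σ hi hrun
    have hin : i < n := by omega
    obtain ⟨t, τ, h1, h2, h3, h4⟩ : Run Oracle.none (decide K.res K.tol K.top) σ
        (decideTime n K.top) fun τ => Packed K n len b ⟨i, hin⟩ (K.config n (extend x) i) τ ∧
          τ.nat 0 = K.bin ⟨i, hin⟩ (K.config n (extend x) i) := by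
      refine Run.cons (60 * (K.top + 6)) (50 * (n + 4) + 1) (by rw [decideTime]; omega)
        (hrun.mono le_rfl fun σ' h' => Run.singleton ?_)
      exact run_choose (i := ⟨i, hin⟩) h' (hact _ _) (config_code_le hb _ hin.le)
    obtain ⟨t', h5, h6⟩ := ih (i + 1) (τ.reveal (x ⟨i, hin⟩)) (by omega) (by
      have hp : Packed K n len b ⟨i, hin⟩ (K.config n (extend x) i) (τ.reveal (x ⟨i, hin⟩)) :=
        ⟨h3.awaits.congr (fun _ _ _ => rfl) fun a ha => Function.update_of_ne (by omega) _ _,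
          h3.bin, h3.level⟩
      refine (Run.cond (T := 60 * (K.top + 5)) (T' := 0) (fun _ => ?_)
        (fun hh => absurd ?_ hh)).mono (by simp; omega) fun _ h => h
      · rw [K.config_succ (extend x) ⟨i, hin⟩, show extend x i = x ⟨i, hin⟩ from dif_pos hin]
        exact run_observe hp (by simp [Mem.reveal]) (hact _ _) htop
          (config_code_le hb _ hin.le) hb
      · simp [hp.awaits.item])
    refine ⟨t + t', by rw [Nat.succ_mul]; omega, ?_⟩
    rw [List.drop_eq_getElem_cons (by omega)]
    have e : l[i]'(by omega) = (x ⟨i, hin⟩, τ.nat 0) := by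
      simp [hl, h4, K.policy_bin]
    rw [e]
    exact .cons h1 h6

/-- The program that computes a policy. -/
def prep (N q M : ℕ) : Program := block [
  block [.setNat (.lit 1) (reg 0), .setReal (.lit 2) (rreg 0),
    .setNat (.lit 5) (.lit (lists M) + reg 1)],
  .cond (.natLe (reg 1) (.lit 1)) .skip (fill N q M)]

/-- The algorithm with resolution `N` and tolerance `q`. -/
def algorithm (N q : ℕ) : Algorithm where
  prep := prep N q (N + q + 2)
  decide := decide N q (N + q + 2)

lemma size_initial (n : ℕ) (C : ℝ≥0) (ε : ℝ) : (Mem.initial n C ε).size ≤ 3 := by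
  have h1 : {a | (Mem.initial n C ε).nat a ≠ 0}.encard ≤ 1 := by
    refine (Set.encard_le_encard (t := {0}) fun a ha => ?_).trans (by simp)
    by_contra hne
    exact ha (Function.update_of_ne hne _ _)
  have h2 : {a | (Mem.initial n C ε).real a ≠ 0}.encard ≤ 2 := by
    refine (Set.encard_le_encard (t := {0, 1}) fun a ha => ?_).trans ?_
    · by_contra hne
      simp only [Set.mem_insert_iff, Set.mem_singleton_iff, not_or] at hne
      refine ha ?_
      simp [Mem.initial, Function.update_of_ne hne.1, Function.update_of_ne hne.2]
    · exact (Set.encard_insert_le _ _).trans (by rw [Set.encard_singleton]; norm_num)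
  exact (add_le_add h1 h2).trans (by norm_num)

/-- The three input cells and at most one cell per time unit bound the size of the description. -/
lemma computes_of_run {O : Oracle} {N q n len b T : ℕ} {C : ℝ≥0} {ε : ℝ} {K : Controller}
    (hN : K.res = N) (hq : K.tol = q) (hM : K.top = N + q + 2) (hact : ∀ i s, K.act i s ≤ K.top)
    (hb : ∀ ℓ, K.wt ℓ ≤ b)
    (h : Run O (prep N q (N + q + 2)) (Mem.initial n C ε) T (Awaits K n len b 0 ((0, 0), 0))) :
    (algorithm N q).Computes O (Mem.initial n C ε) (K.policy n)
      (T + 3 + n * decideTime n (N + q + 2)) := by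
  obtain ⟨s, σ, h1, h2, h3⟩ := h
  refine ⟨s, σ, h1, ?_, fun x => ?_⟩
  · calc σ.size ≤ 3 + s := h1.size_le.trans (add_le_add_left (size_initial n C ε) _)
      _ ≤ (T + 3 + n * decideTime n (N + q + 2) : ℕ) := by
        norm_cast
        omega
  · obtain ⟨t, ht, hp⟩ := packs_decide hact (by omega) hb h3 x
    rw [hN, hq, hM] at hp
    rw [hM] at ht
    exact ⟨t, hp, by omega⟩

lemma run_prep {D : Instance} (hn : 1 < D.items) {C : ℝ≥0} {ε : ℝ} (hC : D.penalty = C) :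
    Run D.oracle (prep D.res D.tol D.top) (Mem.initial D.items C ε)
      (fillTime D.items D.base D.top + 30)
      (Awaits D.controller D.items (D.base ^ D.top) (D.base ^ (D.top - 1)) 0 ((0, 0), 0)) := by
  refine Run.cons 20 (fillTime D.items D.base D.top + 8) (by omega)
    (Run.straight_le (by simp [block, Straight]) (by simp [block, steps]) ?_)
  refine (Run.singleton (T := fillTime D.items D.base D.top + 6)
    ((Run.cond (T := 0) (T' := fillTime D.items D.base D.top) (fun h => absurd h ?_)
      (fun _ => (run_fill ?_ ?_ ?_ ?_ ?_).mono le_rfl ?_)).mono (by simp; omega)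
      fun _ h => h)).mono (by omega) fun _ h => h
  · simp [block, result, Mem.initial, hn]
  · intro a ha ha'
    simp [block, result, Mem.initial, ha']
    rw [if_neg (by omega), Function.update_of_ne (by omega)]
    rfl
  · simp [block, result, Mem.initial]
  · simp [block, result, Mem.initial]
  · simp [block, result, Mem.initial, hC]
  · intro a ha
    simp [block, result, Mem.initial]
    rw [if_neg (by omega), Function.update_of_ne (by omega), Function.update_of_ne (by omega)]
    rfl
  · rintro τ ⟨h, h4⟩
    exact ⟨h.tables, h.item, h4, h.row.trans (by simp [Instance.controller]),
      fun j => (h.lists _ (Nat.le_add_right _ _) (Nat.add_lt_add_left j.2 _)).1,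
      fun j => (h.lists _ (Nat.le_add_right _ _) (Nat.add_lt_add_left j.2 _)).2⟩

/-- The controller that always uses the first bin. -/
noncomputable def constController (N q : ℕ) (C : ℝ) : Controller :=
  ⟨N + q + 2, N, q, C, fun _ => 0, fun _ _ => 0, fun _ _ => 0⟩

/-- For a single item the table would have rows of length `3 ^ M`, too long for a bound polynomial
in `1 / ε`. The untouched zeros in the memory already serve as tables of `constController`. -/
lemma run_prep_one {O : Oracle} {N q : ℕ} {C : ℝ≥0} {ε : ℝ} :
    Run O (prep N q (N + q + 2)) (Mem.initial 1 C ε) 40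
      (Awaits (constController N q C) 1 0 0 0 ((0, 0), 0)) := by
  refine Run.cons 20 20 (by omega)
    (Run.straight_le (by simp [block, Straight]) (by simp [block, steps]) ?_)
  set σ := (block [.setNat (.lit 1) (reg 0), .setReal (.lit 2) (rreg 0),
    .setNat (.lit 5) (.lit (lists (N + q + 2)) + reg 1)]).result O (Mem.initial 1 C ε) with hσ
  have h1 : σ.nat 1 = 1 := by simp [hσ, block, result, Mem.initial]
  have h5 : σ.nat 5 = lists (N + q + 2) + 1 := by simp [hσ, block, result, Mem.initial]
  have h2 : σ.real 2 = C := by simp [hσ, block, result, Mem.initial]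
  have h0 : ∀ a, 1 < a → a ≠ 5 → σ.nat a = 0 := by
    intro a ha ha'
    simp [hσ, block, result, Mem.initial, ha']
    rw [if_neg (by omega), Function.update_of_ne (by omega)]
    rfl
  have hr : ∀ a, 2 < a → σ.real a = 0 := by
    intro a ha
    simp [hσ, block, result, Mem.initial]
    rw [if_neg (by omega), Function.update_of_ne (by omega), Function.update_of_ne (by omega)]
    rfl
  clear_value σ
  have hlists : lists (N + q + 2) = 32 + 2 * (N + q + 2) := rfl
  refine (Run.singleton (T := 10) ((Run.cond (T := 1) (T' := 0) (fun _ => Run.skip ?_)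
    (fun h => absurd ?_ h)).mono (by simp) fun _ h => h)).mono (by omega) fun _ h => h
  · refine ⟨⟨fun ℓ _ => h0 _ (by omega) (by omega), h2, h0 _ (by omega) (by omega),
      fun i s _ _ _ => h0 _ ?_ ?_, fun i s _ _ _ => hr _ ?_⟩, h0 _ (by omega) (by omega),
      h0 _ (by omega) (by omega), h5, fun j => h0 _ ?_ ?_, fun j => hr _ ?_⟩ <;>
    · simp only [constController]
      omega
  · simp [h1]

end Code
end BinPacking

/-! ### Choice of the parameters and the running time. -/

namespace BinPacking

/-- Larger bins break less often. -/
lemma Policy.cost_anti {n : ℕ} (P : Policy n) (μ : Fin n → Measure ℝ≥0) (C : ℝ≥0) {c c' : ℝ}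
    (h : c ≤ c') : P.cost μ C c' ≤ P.cost μ C c := by
  refine add_le_add le_rfl (mul_le_mul_right (lintegral_mono fun x => ?_) _)
  refine Nat.cast_le.2 (Finset.card_le_card fun j hj => ?_)
  simp only [broken, Finset.mem_filter, Finset.mem_univ, true_and] at hj ⊢
  exact h.trans_lt hj

instance : Subsingleton (Policy 1) where
  allEq P Q := by
    cases P
    cases Q
    congr 1
    exact Subsingleton.elim _ _

lemma Policy.feasible_one (P : Policy 1) {c : ℝ} (hc : 0 ≤ c) : P.Feasible c := by
  intro x i
  have : (i : ℕ) = 0 := by omega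
  simpa [Policy.usage, this] using hc

/-- For one item there is only one policy, which is therefore optimal. -/
lemma Policy.cost_one_le (P : Policy 1) (μ : Fin 1 → Measure ℝ≥0) (C : ℝ≥0) {ε : ℝ} (hε : 0 ≤ ε) :
    P.cost μ C (1 + ε) ≤ ENNReal.ofReal (1 + ε) * optCost μ C 1 := by
  have h1 : P.cost μ C 1 ≤ optCost μ C 1 :=
    le_iInf fun Q => le_iInf fun _ => (congrArg (Policy.cost · μ C 1) (Subsingleton.elim P Q)).le
  calc P.cost μ C (1 + ε) ≤ P.cost μ C 1 := P.cost_anti μ C (by linarith)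
    _ ≤ 1 * optCost μ C 1 := by rwa [one_mul]
    _ ≤ _ := by
      gcongr
      rw [← ENNReal.ofReal_one]
      exact ENNReal.ofReal_le_ofReal (by linarith)

/-- The discretization with parameter `k`. -/
noncomputable def Instance.ofParam (n k : ℕ) (C : ℝ≥0) (μ : Fin n → Measure ℝ≥0) : Instance :=
  ⟨n, 27 * k ^ 3, 9 * k ^ 2, C, Oracle.ofLaws μ⟩

namespace Instance
variable {n k : ℕ} {C : ℝ≥0} {μ : Fin n → Measure ℝ≥0} {ε : ℝ}

lemma top_ofParam : (ofParam n k C μ).top = 27 * k ^ 3 + 9 * k ^ 2 + 2 := rfl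

lemma top_le (hk : 1 ≤ k) : 27 * k ^ 3 + 9 * k ^ 2 + 2 ≤ 38 * k ^ 3 := by
  have h1 : k ^ 2 ≤ k ^ 3 := Nat.pow_le_pow_right hk (by decide)
  have h2 : 1 ≤ k ^ 3 := Nat.one_le_pow _ _ hk
  omega

/-- The excess of `top + tol` over `N` is `18 k² + 2 ≤ 27 k² ≤ 27 k³ ε`. -/
lemma capacity_ofParam (hk : 1 ≤ k) (hε : 1 ≤ ε * k) :
    ((ofParam n k C μ).top : ℝ) + (ofParam n k C μ).tol ≤ (ofParam n k C μ).res * (1 + ε) := by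
  have hk' : (1 : ℝ) ≤ k := by exact_mod_cast hk
  rw [top_ofParam]
  simp only [ofParam]
  push_cast
  have h2 : (1 : ℝ) ≤ (k : ℝ) ^ 2 := one_le_pow₀ hk'
  nlinarith [mul_le_mul_of_nonneg_left hε (show (0 : ℝ) ≤ 27 * (k : ℝ) ^ 2 by positivity)]

/-- The two factors exceed `1` by at most `38 / (81 k) ≤ 1 / (2 k)` and by `27 / (81 k) = 1 / (3
k)`. -/
lemma loss_ofParam (hk : 1 ≤ k) (hε : 1 ≤ ε * k) : (ofParam n k C μ).loss ≤ 1 + ε := by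
  have hk' : (1 : ℝ) ≤ k := by exact_mod_cast hk
  have hk0 : (0 : ℝ) < k := by linarith
  have h1 : (1 : ℝ) / k ≤ ε := by rwa [div_le_iff₀ hk0]
  have h2 : ((ofParam n k C μ).top : ℝ) / ((ofParam n k C μ).tol : ℝ) ^ 2 ≤ 1 / (2 * k) := by
    have h : ((ofParam n k C μ).top : ℝ) ≤ 38 * k ^ 3 := by
      rw [top_ofParam]
      exact_mod_cast top_le hk
    simp only [show (ofParam n k C μ).tol = 9 * k ^ 2 from rfl]
    push_cast
    rw [div_le_div_iff₀ (by positivity) (by positivity)]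
    have : (0 : ℝ) ≤ (k : ℝ) ^ 4 := by positivity
    nlinarith [mul_le_mul_of_nonneg_right h (show (0 : ℝ) ≤ 2 * k by positivity)]
  have h3 : ((ofParam n k C μ).res : ℝ) / ((ofParam n k C μ).tol : ℝ) ^ 2 = 1 / (3 * k) := by
    simp only [show (ofParam n k C μ).tol = 9 * k ^ 2 from rfl,
      show (ofParam n k C μ).res = 27 * k ^ 3 from rfl]
    push_cast
    field_simp
    norm_num
  rw [loss, price, h3]
  calc (1 + ((ofParam n k C μ).top : ℝ) / ((ofParam n k C μ).tol : ℝ) ^ 2) * (1 + 1 / (3 * k))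
      ≤ (1 + 1 / (2 * k)) * (1 + 1 / (3 * k)) := by gcongr
    _ = 1 + 5 / 6 * (1 / k) + 1 / 6 * (1 / k * (1 / k)) := by
      field_simp
      ring
    -- Since `1 / k² ≤ 1 / k`, the coefficients `5/6` and `1/6` add up to `1`.
    _ ≤ 1 + 1 / k := by
      have h4 : (1 : ℝ) / k ≤ 1 := by rw [div_le_one hk0]; exact hk'
      have h5 : (0 : ℝ) ≤ 1 / k := by positivity
      nlinarith
    _ ≤ 1 + ε := by linarith

lemma policy_cost_le_optCost [hμ : ∀ i, IsProbabilityMeasure (μ i)] (hk : 1 ≤ k) (hε : 1 ≤ ε * k) :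
    (ofParam n k C μ).policy.cost μ C (1 + ε) ≤ ENNReal.ofReal (1 + ε) * optCost μ C 1 := by
  have : ∀ i : Fin (ofParam n k C μ).items, IsProbabilityMeasure (μ i) := hμ
  have hres : 0 < (ofParam n k C μ).res := by simp only [ofParam]; positivity
  have htol : 0 < (ofParam n k C μ).tol := by simp only [ofParam]; positivity
  calc (ofParam n k C μ).policy.cost μ C (1 + ε)
      ≤ ENNReal.ofReal ((ofParam n k C μ).value 0 0) :=
        cost_policy_le (ofParam n k C μ) μ rfl hres htol rfl (capacity_ofParam hk hε)
    _ ≤ ENNReal.ofReal (ofParam n k C μ).loss * optCost μ C 1 :=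
        value_le_optCost (D := ofParam n k C μ) μ rfl hres htol rfl
    _ ≤ _ := by
      gcongr
      exact loss_ofParam hk hε

end Instance

namespace Code

/-- For `n ≥ 2` everything is absorbed into powers of `n`: the base is at most `n ^ 3`, and each
factor `M` at most `n ^ M`. -/
lemma time_le {n M : ℕ} (hn : 2 ≤ n) (hM : 38 ≤ M) :
    fillTime n (2 * n + 1) M + 30 + 3 + n * decideTime n M ≤ 25000 * n ^ (5 * M + 4) := by
  have hM' : M ≤ n ^ M := (Nat.lt_pow_self hn).le
  have hB : 2 * n + 1 ≤ n ^ 3 := by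
    have : 2 * 2 * n ≤ n ^ 3 := by
      rw [show n ^ 3 = n * n * n by ring]
      gcongr
    omega
  have h1 : 1 ≤ n ^ (3 * M) := Nat.one_le_pow _ _ (by omega)
  have h2 : (2 * n + 1) ^ M ≤ n ^ (3 * M) := by
    rw [pow_mul]
    exact Nat.pow_le_pow_left hB M
  have h3 : M + (2 * n + 1) + 7 ≤ 3 * (M * n ^ 3) := by
    have e1 : M ≤ M * n ^ 3 := Nat.le_mul_of_pos_right _ (by positivity)
    have e2 : n ^ 3 ≤ M * n ^ 3 := Nat.le_mul_of_pos_left _ (by omega)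
    omega
  have h4 : fillTime n (2 * n + 1) M ≤ 24000 * n ^ (5 * M + 4) := by
    calc fillTime n (2 * n + 1) M
        ≤ 1000 * (2 * n) * (2 * n ^ (3 * M)) * (2 * M) * (3 * (M * n ^ 3)) := by
          rw [fillTime]
          gcongr <;> omega
      _ = 24000 * n ^ (3 * M + 4) * (M * M) := by ring
      _ ≤ 24000 * n ^ (3 * M + 4) * (n ^ M * n ^ M) := by gcongr
      _ = 24000 * n ^ (5 * M + 4) := by ring
  have h5 : n * decideTime n M ≤ 180 * n ^ (5 * M + 4) := by
    have e1 : n ≤ n * M := Nat.le_mul_of_pos_right _ (by omega)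
    have e2 : M ≤ n * M := Nat.le_mul_of_pos_left _ (by omega)
    calc n * decideTime n M ≤ n * (60 * (3 * (n * M))) := by
          rw [decideTime]
          gcongr
          omega
      _ ≤ n * (60 * (3 * (n * n ^ M))) := by gcongr
      _ = 180 * n ^ (M + 2) := by ring
      _ ≤ 180 * n ^ (5 * M + 4) := by gcongr <;> omega
  have h6 : 1 ≤ n ^ (5 * M + 4) := Nat.one_le_pow _ _ (by omega)
  omega

end Code

lemma tolerance_bound : √6 * (√15 - 3) ≤ 12 / 5 := by
  have h1 : √6 ≤ 5 / 2 := Real.sqrt_le_iff.2 ⟨by norm_num, by norm_num⟩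
  have h2 : √15 ≤ 39 / 10 := Real.sqrt_le_iff.2 ⟨by norm_num, by norm_num⟩
  have h3 : 0 ≤ √6 := Real.sqrt_nonneg _
  nlinarith

/-- For `ε ≥ 1` the ceiling is `1`, and `ε ≤ 12 / 5` is assumed; for `ε < 1` its product with `ε` is
at most `1 + ε ≤ 2`. -/
lemma ceil_inv_spec {ε : ℝ} (h0 : 0 < ε) (h1 : ε ≤ 12 / 5) :
    1 ≤ ⌈1 / ε⌉₊ ∧ 1 ≤ ε * ⌈1 / ε⌉₊ ∧ (⌈1 / ε⌉₊ : ℝ) ≤ 12 / 5 / ε := by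
  have hpos : 0 < 1 / ε := by positivity
  refine ⟨Nat.one_le_ceil_iff.2 hpos, ?_, ?_⟩
  · rw [← div_le_iff₀' h0]
    exact Nat.le_ceil _
  · rw [le_div_iff₀ h0]
    rcases le_or_gt 1 ε with h | h
    · have : (⌈1 / ε⌉₊ : ℝ) ≤ 1 := by
        exact_mod_cast Nat.ceil_le.2 (by rw [Nat.cast_one, div_le_one h0]; exact h)
      nlinarith
    · have h2 := (Nat.ceil_lt_add_one hpos.le).le
      have h3 : (1 / ε + 1) * ε = 1 + ε := by
        field_simp
      nlinarith [mul_le_mul_of_nonneg_right h2 h0.le]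

/-- For `n ≥ 2` the factor `1 / ε ^ 10` is not needed, only that it is bounded below. -/
lemma le_time_bound {ε A : ℝ} (h0 : 0 < ε) (h1 : ε ≤ 12 / 5) (hA : 0 ≤ A) :
    A ≤ 10000 * (A / ε ^ 10) := by
  have h : ε ^ 10 ≤ 10000 := (pow_le_pow_left₀ h0.le h1 10).trans (by norm_num)
  rw [← mul_div_assoc, le_div_iff₀ (by positivity), mul_comm]
  gcongr

/-- The exponent is at most `(135 + 45 + 14) k⁵ = 194 k⁵`, while `2 * (5 / 2) ^ 5 > 195` and `(5 /
2) * (12 / 5) = 6`. -/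
lemma time_bound {n k : ℕ} {ε : ℝ} (hn : 2 ≤ n) (hk : 1 ≤ k) (h0 : 0 < ε) (h1 : ε ≤ 12 / 5)
    (hkε : (k : ℝ) ≤ 12 / 5 / ε) :
    ((25000 * n ^ (5 * (27 * k ^ 3 + 9 * k ^ 2 + 2) + 4) : ℕ) : ℝ) ≤
      25000 * 10000 * ((n : ℝ) ^ (2 * (6 / ε) ^ 5) / ε ^ 10) := by
  have hn' : (1 : ℝ) ≤ n := by exact_mod_cast (by omega : 1 ≤ n)
  have h2 : (25 / 10 * k : ℝ) ≤ 6 / ε := by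
    calc (25 / 10 * k : ℝ) ≤ 25 / 10 * (12 / 5 / ε) := by gcongr
      _ = 6 / ε := by ring
  have h3 : ((5 * (27 * k ^ 3 + 9 * k ^ 2 + 2) + 4 : ℕ) : ℝ) ≤ 2 * (6 / ε) ^ 5 := by
    have e1 : 5 * (27 * k ^ 3 + 9 * k ^ 2 + 2) + 4 ≤ 194 * k ^ 5 := by
      have e2 : k ^ 2 ≤ k ^ 5 := Nat.pow_le_pow_right hk (by decide)
      have e3 : k ^ 3 ≤ k ^ 5 := Nat.pow_le_pow_right hk (by decide)
      have e4 : 1 ≤ k ^ 5 := Nat.one_le_pow _ _ hk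
      omega
    calc ((5 * (27 * k ^ 3 + 9 * k ^ 2 + 2) + 4 : ℕ) : ℝ) ≤ ((194 * k ^ 5 : ℕ) : ℝ) := by
          exact_mod_cast e1
      _ ≤ 2 * (25 / 10 * k) ^ 5 := by
          push_cast
          have : (0 : ℝ) ≤ (k : ℝ) ^ 5 := by positivity
          rw [mul_pow]
          linarith
      _ ≤ 2 * (6 / ε) ^ 5 := by gcongr
  have h4 : ((n ^ (5 * (27 * k ^ 3 + 9 * k ^ 2 + 2) + 4) : ℕ) : ℝ) ≤
      (n : ℝ) ^ (2 * (6 / ε) ^ 5) := by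
    rw [Nat.cast_pow, ← Real.rpow_natCast]
    exact Real.rpow_le_rpow_of_exponent_le hn' h3
  have h5 := le_time_bound h0 h1 (show (0 : ℝ) ≤ (n : ℝ) ^ (2 * (6 / ε) ^ 5) by positivity)
  rw [Nat.cast_mul]
  push_cast at h4 ⊢
  linarith

/-- For one item the time is linear in `M`, hence of order `k³`, and the factor `1 / ε ^ 10` alone
covers it. -/
lemma time_bound_one {k : ℕ} {ε : ℝ} (hk : 1 ≤ k) (h0 : 0 < ε) (hkε : (k : ℝ) ≤ 12 / 5 / ε) :
    ((40 + 3 + 1 * Code.decideTime 1 (27 * k ^ 3 + 9 * k ^ 2 + 2) : ℕ) : ℝ) ≤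
      25000 * 10000 * (((1 : ℕ) : ℝ) ^ (2 * (6 / ε) ^ 5) / ε ^ 10) := by
  have e1 : 40 + 3 + 1 * Code.decideTime 1 (27 * k ^ 3 + 9 * k ^ 2 + 2) ≤ 4000 * k ^ 10 := by
    rw [Code.decideTime]
    have e2 : k ^ 2 ≤ k ^ 10 := Nat.pow_le_pow_right hk (by decide)
    have e3 : k ^ 3 ≤ k ^ 10 := Nat.pow_le_pow_right hk (by decide)
    have e4 : 1 ≤ k ^ 10 := Nat.one_le_pow _ _ hk
    omega
  calc _ ≤ ((4000 * k ^ 10 : ℕ) : ℝ) := by exact_mod_cast e1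
    _ ≤ 4000 * (12 / 5 / ε) ^ 10 := by
        push_cast
        gcongr
    _ = 4000 * (12 / 5) ^ 10 * (1 / ε ^ 10) := by
        rw [div_pow]
        ring
    _ ≤ 25000 * 10000 * (1 / ε ^ 10) := by
        gcongr <;> norm_num
    _ = _ := by rw [Nat.cast_one, Real.one_rpow]

end BinPacking

theorem theorem4 :
    ∃ K : ℝ, ∀ ε : ℝ, 0 < ε → ε ≤ √6 * (√15 - 3) →
      ∃ A : BinPacking.Algorithm,
        ∀ (n : ℕ) (_ : 1 ≤ n) (C : ℝ≥0) (_ : 1 ≤ C)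
          (μ : Fin n → Measure ℝ≥0) (_ : ∀ i, IsProbabilityMeasure (μ i)),
          ∃ (P : BinPacking.Policy n) (T : ℕ),
            A.Computes (BinPacking.Oracle.ofLaws μ) (BinPacking.Mem.initial n C ε) P T ∧
            (T : ℝ) ≤ K * ((n : ℝ) ^ (2 * (6 / ε) ^ 5) / ε ^ 10) ∧
            P.Feasible (1 + ε) ∧
            P.cost μ C (1 + ε) ≤ ENNReal.ofReal (1 + ε) * BinPacking.optCost μ C 1 := by
  refine ⟨25000 * 10000, fun ε h0 h1 => ?_⟩
  replace h1 := h1.trans BinPacking.tolerance_bound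
  obtain ⟨hk, hkε, hkε'⟩ := BinPacking.ceil_inv_spec h0 h1
  set k := ⌈1 / ε⌉₊
  refine ⟨BinPacking.Code.algorithm (27 * k ^ 3) (9 * k ^ 2), fun n hn C _ μ _ => ?_⟩
  rcases hn.eq_or_lt with rfl | hn
  · exact ⟨_, _, BinPacking.Code.computes_of_run rfl rfl rfl (fun _ _ => Nat.zero_le _)
      (fun _ => le_rfl) BinPacking.Code.run_prep_one, BinPacking.time_bound_one hk h0 hkε',
      BinPacking.Policy.feasible_one _ (by linarith), BinPacking.Policy.cost_one_le _ μ C h0.le⟩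
  · let D := BinPacking.Instance.ofParam n k C μ
    refine ⟨D.policy, _, BinPacking.Code.computes_of_run (K := D.controller) rfl rfl rfl
      (fun i s => D.scan_fst_le _ i s _) D.wt_le (BinPacking.Code.run_prep (D := D) hn rfl), ?_,
      D.policy_feasible ?_ ?_ (BinPacking.Instance.capacity_ofParam hk hkε),
      BinPacking.Instance.policy_cost_le_optCost hk hkε⟩
    · refine le_trans (Nat.cast_le.2 (BinPacking.Code.time_le hn ?_))
        (BinPacking.time_bound hn hk h0 h1 hkε')
      have h2 : 1 ≤ k ^ 2 := Nat.one_le_pow _ _ hk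
      have h3 : 1 ≤ k ^ 3 := Nat.one_le_pow _ _ hk
      simp only [D, BinPacking.Instance.top_ofParam]
      omega
    · exact Nat.mul_pos (by decide) (Nat.pow_pos hk)
    · exact Nat.mul_pos (by decide) (Nat.pow_pos hk)
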